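/- Let $\mathbb K=\mathbb R$ or $\mathbb C$; everything below is $\mathbb K$-analytic. Identify (locally) the Lagrangian Grassmannian of 3-planes in a 6-dimensional symplectic space with the space $\mathrm{Sym}_3(\mathbb K)$ of symmetric $3\times3$ matrices $U=(u_{ij})$, $i,j\in\{x,y,t\}$. Let $F$ be an analytic function on an open set $\Omega\subset \mathrm{Sym}_3(\mathbb K)$ and let $M^5=\{U\in\Omega : F(U)=0\}$ be the hypersurface of the equation $F(u_{xx},u_{xy},u_{yy},u_{xt},u_{yt},u_{tt})=0$. Assume that at every $s\in M^5$ the conic $dF_s(\xi\xi^T)=0$ in the projective plane of $\xi\in\mathbb K^3$ (for $\xi=(1,\mu,\lambda)^T$ this is the dispersion relation) is nonsingular and has a $\mathbb K$-point; equivalently, the rank-one matrices in $T_sM^5=\ker dF_s$ (the *characteristic* vectors) form, after projectivisation, a rational normal quartic curve $\gamma_s\subset\mathbb P(T_sM^5)$. *Definitions.* A *bisecant surface* (*trisecant 3-fold*) is a submanifold $\Sigma\subset M^5$ of dimension $n=2$ ($n=3$) such that $\mathbb P(T_s\Sigma)$ is spanned by $n$ points of $\gamma_s$ for every $s\in\Sigma$.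 A trisecant 3-fold is *holonomic* if near each of its points it has local coordinates $R^1,R^2,R^3$ whose coordinate lines are characteristic (have characteristic velocity vectors). An *$n$-component hydrodynamic reduction* consists of functions $U(R)\in\mathrm{Sym}_3(\mathbb K)$ and $\lambda^i(R),\mu^i(R)$, $1\le i\le n$, of $R=(R^1,\dots,R^n)$ in an open set, with $\partial_iU\neq0$ for all $i$ and with the pairs $(\lambda^i,\mu^i)$ pairwise distinct at every $R$, such that the systems $$R^i_t=\lambda^i(R)R^i_x,\qquad R^i_y=\mu^i(R)R^i_x$$ commute, i.e. $\partial_j\lambda^i\,(\mu^j-\mu^i)=\partial_j\mu^i\,(\lambda^j-\lambda^i)$ for $i\ne j$, and such that for every solution $R(x,y,t)$ of both systems $U(R(x,y,t))$ takes values in $M^5$ and is locally the matrix of second derivatives of a function $u(x,y,t)$ (which is therefore a solution of the equation). The equation is *integrable* if for every $n$ it has $n$-component reductions parametrized, modulo reparametrizations $R^i\to\varphi^i(R^i)$, by $n$ arbitrary functions of one variable, in the following sense. Let $s\in M^5$, let $(\mu^i_0,\lambda^i_0)$, $1\le i\le n$, be distinct solutions of the dispersion relation at $s$, and let $\psi^i$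 be affine functions on the $(\mu,\lambda)$-plane that are local parameters on the conic at these points. Then for all analytic germs $h^i(t)$ at $t=0$ with $h^i(0)=\psi^i(\mu_0^i,\lambda_0^i)$ there is one and only one germ at $R=0$ of a reduction with $U(0)=s$, with speeds $(\mu^i_0,\lambda^i_0)$ at $R=0$, and such that on the $i$-th coordinate axis, for every $i$, $u_{xx}=s_{xx}+R^i$ and $\psi^i(\mu^i,\lambda^i)=h^i(R^i)$. Submanifolds $\Sigma^n\subset M^5$ of a given class are *parametrized by $n$ arbitrary functions of one variable* if the following holds. Let $s\in M^5$, let $[\xi^i_0]$, $1\le i\le n$, be distinct points of the conic at $s$, and let $\theta^i,\psi^i$ be linear functions on $\mathbb K^3$ with $\theta^i(\xi^i_0)=1$ such that $\psi^i$, restricted to the part of the cone $dF_s(\xi\xi^T)=0$ on which $\theta^i=1$, is a local parameter at $\xi^i_0$. Then the germs at $s$ of submanifolds $\Sigma\ni s$ of the class that are tangent to all $\xi^i_0(\xi^i_0)^T$ are in bijection with the $n$-tuples of analytic germs $h^i(t)$ with $h^i(0)=\psi^i(\xi_0^i)$, where $\Sigma$ corresponds to $(h^i)$ if for each $i$ it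 contains a curve $c_i(t)$ with $c_i(0)=s$ and $c_i'=\xi^i(\xi^i)^T$, where $\xi^i(0)=\xi^i_0$, $\theta^i(\xi^i)=1$ and $\psi^i(\xi^i(t))=h^i(t)$. **Theorem 3.** Bisecant surfaces and holonomic trisecant 3-folds of $M^5$ correspond to the two- and three-component hydrodynamic reductions of the equation. That is, for $n=2$ (bisecant surfaces) and $n=3$ (holonomic trisecant 3-folds): for every $n$-component reduction, $U$ maps a neighbourhood of each point of its domain diffeomorphically onto a submanifold of this class; a submanifold $\Sigma$ of this class is, near $s\in\Sigma$, the image of an $n$-component reduction, with $R^1,\dots,R^n$ as local coordinates on it, if and only if every characteristic vector in $T_s\Sigma$ has nonzero $xx$-entry (finite speeds); and for each $s\in\Sigma$ some linear change of the independent variables $x,y,t$ makes $\Sigma$ near $s$ the image of an $n$-component reduction of the transformed equation. Moreover: (i) every $M^5$ possesses infinitely many bisecant surfaces, parametrized by two arbitrary functions of one variable; (ii) the equation of $M^5$ is integrable if and only if $M^5$ possesses infinitely many holonomic trisecant 3-folds, parametrized by three arbitrary functions of one variable. -/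

import Mathlib

open Set Filter Topology

-- The sup norm on matrices; all norms on this finite-dimensional space are equivalent.
attribute [local instance] Matrix.normedAddCommGroup Matrix.normedSpace

noncomputable section

namespace DispersionlessHirota

variable {𝕜 : Type*} [RCLike 𝕜]

/-- The space of symmetric `3 × 3` matrices, the standard affine chart of the Lagrangian
Grassmannian of Lagrangian 3-planes in a 6-dimensional symplectic space. The indices `0, 1, 2` stand
for the independent variables `x, y, t`; a point is the matrix of second derivatives of `u`. -/
def symMatrices (𝕜 : Type*) [RCLike 𝕜] : Submodule 𝕜 (Matrix (Fin 3) (Fin 3) 𝕜) where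
  carrier := {U | U.IsSymm}
  add_mem' := fun hU hV => hU.add hV
  zero_mem' := Matrix.isSymm_zero
  smul_mem' := fun c _ hU => hU.smul c

/-- Symmetric `3 × 3` matrices, as a normed space. -/
abbrev SymMat (𝕜 : Type*) [RCLike 𝕜] : Type _ := symMatrices 𝕜

/-- The symmetric matrix `ξ ηᵀ + η ξᵀ`. -/
def symProd (ξ η : Fin 3 → 𝕜) : SymMat 𝕜 :=
  ⟨Matrix.vecMulVec ξ η + Matrix.vecMulVec η ξ, by
    change (Matrix.vecMulVec ξ η + Matrix.vecMulVec η ξ).transpose = _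
    rw [Matrix.transpose_add, Matrix.transpose_vecMulVec, Matrix.transpose_vecMulVec, add_comm]⟩

/-- The symmetric matrix `ξ ξᵀ` (of rank one if `ξ ≠ 0`). -/
def sqMat (ξ : Fin 3 → 𝕜) : SymMat 𝕜 :=
  ⟨Matrix.vecMulVec ξ ξ, by
    change (Matrix.vecMulVec ξ ξ).transpose = _
    rw [Matrix.transpose_vecMulVec]⟩

/-- The transformation `U ↦ Aᵀ U A` of second derivatives induced by the linear change of
independent variables with matrix `A`. -/
def changeVars (A : Matrix (Fin 3) (Fin 3) 𝕜) (U : SymMat 𝕜) : SymMat 𝕜 :=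
  ⟨A.transpose * U.1 * A, by
    have h : U.1.transpose = U.1 := U.2
    change (A.transpose * U.1 * A).transpose = _
    rw [Matrix.transpose_mul, Matrix.transpose_mul, Matrix.transpose_transpose, h,
      Matrix.mul_assoc]⟩

/-- The partial derivative `∂g/∂R^j` at the point `R`. -/
def pd {n : ℕ} {E : Type*} [NormedAddCommGroup E] [NormedSpace 𝕜 E]
    (j : Fin n) (g : (Fin n → 𝕜) → E) (R : Fin n → 𝕜) : E :=
  fderiv 𝕜 g R (Pi.single j 1)

/-! ### The hypersurface and its field of rational normal curves -/

/-- The hypersurface `M = {U ∈ Ω : F U = 0}` of the equation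
`F(u_xx, u_xy, u_yy, u_xt, u_yt, u_tt) = 0`. -/
def hypersurface (Ω : Set (SymMat 𝕜)) (F : SymMat 𝕜 → 𝕜) : Set (SymMat 𝕜) :=
  {U | U ∈ Ω ∧ F U = 0}

/-- `V` is a characteristic vector at `s`: a rank-one matrix in the tangent space `ker dF_s`. The
rational normal curve at `s` is the set of lines spanned by these vectors. -/
def IsCharacteristic (F : SymMat 𝕜 → 𝕜) (s V : SymMat 𝕜) : Prop :=
  fderiv 𝕜 F s V = 0 ∧ V.1.rank = 1

/-- The conic `dF_s(ξ ξᵀ) = 0` in the plane of directions `(ξ₀ : ξ₁ : ξ₂)`, which is the dispersion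
relation when `ξ = (1, μ, λ)`, is nonsingular and has a `𝕜`-point (automatic for `𝕜 = ℂ`).
Equivalently, the rank-one matrices in `ker dF_s` form a rational normal quartic curve over `𝕜`. -/
def HasRationalNormalCurve (F : SymMat 𝕜 → 𝕜) (s : SymMat 𝕜) : Prop :=
  (∀ ξ : Fin 3 → 𝕜, (∀ η : Fin 3 → 𝕜, fderiv 𝕜 F s (symProd ξ η) = 0) → ξ = 0) ∧
    ∃ ξ : Fin 3 → 𝕜, ξ ≠ 0 ∧ fderiv 𝕜 F s (sqMat ξ) = 0

/-! ### Submanifolds, bisecant surfaces, trisecant 3-folds -/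

/-- `φ`, defined on the open set `D`, is an analytic parametrization of an open piece of `S`: an
immersion and a homeomorphism onto a relatively open subset of `S`. -/
structure IsLocalParam (n : ℕ) (S : Set (SymMat 𝕜)) (D : Set (Fin n → 𝕜))
    (φ : (Fin n → 𝕜) → SymMat 𝕜) : Prop where
  isOpen : IsOpen D
  analytic : AnalyticOnNhd 𝕜 φ D
  immersion : ∀ R ∈ D, Function.Injective (fderiv 𝕜 φ R)
  embedding : IsEmbedding (D.domRestrict φ)
  image : ∃ W : Set (SymMat 𝕜), IsOpen W ∧ φ '' D = S ∩ W

/-- `S` is an (embedded, analytic) `n`-dimensional submanifold. -/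
def IsSubmanifold (n : ℕ) (S : Set (SymMat 𝕜)) : Prop :=
  ∀ s ∈ S, ∃ (D : Set (Fin n → 𝕜)) (φ : (Fin n → 𝕜) → SymMat 𝕜), IsLocalParam n S D φ ∧ s ∈ φ '' D

/-- The tangent space at `s` of an `n`-dimensional submanifold `S`. -/
def tangentVectors (n : ℕ) (S : Set (SymMat 𝕜)) (s : SymMat 𝕜) : Set (SymMat 𝕜) :=
  {V | ∃ (D : Set (Fin n → 𝕜)) (φ : (Fin n → 𝕜) → SymMat 𝕜), IsLocalParam n S D φ ∧
    ∃ R ∈ D, φ R = s ∧ V ∈ range (fderiv 𝕜 φ R)}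

/-- `S` is an `n`-dimensional submanifold of `M` whose projectivised tangent spaces are `n`-secant
to the rational normal curves: each is spanned by `n` points of the curve. -/
def IsSecant (n : ℕ) (Ω : Set (SymMat 𝕜)) (F : SymMat 𝕜 → 𝕜) (S : Set (SymMat 𝕜)) : Prop :=
  IsSubmanifold n S ∧ S ⊆ hypersurface Ω F ∧
    ∀ s ∈ S, ∃ V : Fin n → SymMat 𝕜, LinearIndependent 𝕜 V ∧
      ∀ i, V i ∈ tangentVectors n S s ∧ IsCharacteristic F s (V i)

/-- The characteristic net of `S` is a coordinate net: near every point there are local coordinates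
whose coordinate lines have characteristic directions. -/
def IsHolonomic (n : ℕ) (F : SymMat 𝕜 → 𝕜) (S : Set (SymMat 𝕜)) : Prop :=
  ∀ s ∈ S, ∃ (D : Set (Fin n → 𝕜)) (φ : (Fin n → 𝕜) → SymMat 𝕜),
    IsLocalParam n S D φ ∧ s ∈ φ '' D ∧ ∀ R ∈ D, ∀ i, IsCharacteristic F (φ R) (pd i φ R)

/-- Bisecant surfaces of the hypersurface. -/
def IsBisecantSurface (Ω : Set (SymMat 𝕜)) (F : SymMat 𝕜 → 𝕜) (S : Set (SymMat 𝕜)) : Prop :=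
  IsSecant 2 Ω F S

/-- Holonomic trisecant 3-folds of the hypersurface. -/
def IsHolonomicTrisecant (Ω : Set (SymMat 𝕜)) (F : SymMat 𝕜 → 𝕜) (S : Set (SymMat 𝕜)) : Prop :=
  IsSecant 3 Ω F S ∧ IsHolonomic 3 F S

/-! ### Hydrodynamic reductions -/

/-- `r(x, y, t) = (R^1, …, R^n)`, defined on the open set `X`, is a solution with values in `D` of
the pair of systems of hydrodynamic type `R^i_t = λ^i(R) R^i_x`, `R^i_y = μ^i(R) R^i_x`. -/
structure IsHydroSolution (n : ℕ) (D : Set (Fin n → 𝕜)) (lam mu : Fin n → (Fin n → 𝕜) → 𝕜)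
    (X : Set (Fin 3 → 𝕜)) (r : (Fin 3 → 𝕜) → (Fin n → 𝕜)) : Prop where
  isOpen : IsOpen X
  analytic : AnalyticOnNhd 𝕜 r X
  mapsTo : MapsTo r X D
  eq_t : ∀ z ∈ X, ∀ i, pd 2 (fun w => r w i) z = lam i (r z) * pd 0 (fun w => r w i) z
  eq_y : ∀ z ∈ X, ∀ i, pd 1 (fun w => r w i) z = mu i (r z) * pd 0 (fun w => r w i) z

/-- `(U, λ, μ)` is an `n`-component hydrodynamic reduction, on the open set `D` of the space of
phases, of the equation whose hypersurface is `M`: the two systems of hydrodynamic type commute,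
their characteristic speeds `(λ^i, μ^i)` are pairwise distinct, `U` depends effectively on every
phase, and for each solution `r(x, y, t)` of the two systems the matrix `U(r(x, y, t))` takes values
in `M` and satisfies the quasilinear system `∂_k U_ij = ∂_j U_ik` (`a_y = b_x`, `a_t = p_x`, …),
which says that it is locally the matrix of second derivatives of a function `u(x, y, t)`. -/
structure IsReduction (M : Set (SymMat 𝕜)) (n : ℕ) (D : Set (Fin n → 𝕜))
    (U : (Fin n → 𝕜) → SymMat 𝕜) (lam mu : Fin n → (Fin n → 𝕜) → 𝕜) : Prop where
  isOpen : IsOpen D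
  analytic_U : AnalyticOnNhd 𝕜 U D
  analytic_lam : ∀ i, AnalyticOnNhd 𝕜 (lam i) D
  analytic_mu : ∀ i, AnalyticOnNhd 𝕜 (mu i) D
  distinct : ∀ R ∈ D, ∀ i j, i ≠ j → (lam i R, mu i R) ≠ (lam j R, mu j R)
  commute : ∀ R ∈ D, ∀ i j, i ≠ j →
    pd j (lam i) R * (mu j R - mu i R) = pd j (mu i) R * (lam j R - lam i R)
  effective : ∀ R ∈ D, ∀ i, pd i U R ≠ 0
  solves : ∀ (X : Set (Fin 3 → 𝕜)) (r : (Fin 3 → 𝕜) → (Fin n → 𝕜)),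
    IsHydroSolution n D lam mu X r → ∀ z ∈ X,
      U (r z) ∈ M ∧
      ∀ i j k : Fin 3, pd k (fun w => (U (r w)).1 i j) z = pd j (fun w => (U (r w)).1 i k) z

/-- Near its point `s`, the submanifold `S` of `M` is the image of an `n`-component hydrodynamic
reduction, the phases being local coordinates on `S`. -/
def IsReductionImageAt (M : Set (SymMat 𝕜)) (n : ℕ) (S : Set (SymMat 𝕜)) (s : SymMat 𝕜) : Prop :=
  ∃ (D : Set (Fin n → 𝕜)) (U : (Fin n → 𝕜) → SymMat 𝕜) (lam mu : Fin n → (Fin n → 𝕜) → 𝕜),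
    IsReduction M n D U lam mu ∧ IsLocalParam n S D U ∧ s ∈ U '' D

/-- The submanifolds with the property `P` correspond to the `n`-component reductions:

* the image of a reduction is, near each point of its domain, a submanifold with the property `P`;
* a submanifold with the property `P` is, near its point `s`, the image of a reduction if and only
  if its characteristic directions `ξ ξᵀ` at `s` have finite speeds, that is, `ξ₀ ≠ 0`;
* this can be achieved at every point by a linear change of the independent variables. -/
def CorrespondToReductions (n : ℕ) (Ω : Set (SymMat 𝕜)) (F : SymMat 𝕜 → 𝕜)
    (P : Set (SymMat 𝕜) → Prop) : Prop :=
  (∀ (D : Set (Fin n → 𝕜)) (U : (Fin n → 𝕜) → SymMat 𝕜) (lam mu : Fin n → (Fin n → 𝕜) → 𝕜),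
    IsReduction (hypersurface Ω F) n D U lam mu → ∀ R ∈ D,
      ∃ D' ⊆ D, R ∈ D' ∧ IsLocalParam n (U '' D') D' U ∧ P (U '' D')) ∧
  (∀ S : Set (SymMat 𝕜), P S → ∀ s ∈ S,
    (IsReductionImageAt (hypersurface Ω F) n S s ↔
      ∀ V ∈ tangentVectors n S s, IsCharacteristic F s V → V.1 0 0 ≠ 0)) ∧
  (∀ S : Set (SymMat 𝕜), P S → ∀ s ∈ S, ∃ A : Matrix (Fin 3) (Fin 3) 𝕜, IsUnit A.det ∧
    IsReductionImageAt (changeVars A '' hypersurface Ω F) n (changeVars A '' S) (changeVars A s))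

/-! ### Dependence on arbitrary functions of one variable -/

/-- On the cone `dF_s(ξ ξᵀ) = 0`, the linear functions `θ · ξ` and `ψ · ξ` are local coordinates
near `ξ`. Thus, with the normalization `θ · ξ = 1`, `ψ · ξ` is a local parameter on the conic. -/
def IsLocalParameter (F : SymMat 𝕜 → 𝕜) (s : SymMat 𝕜) (ξ θ ψ : Fin 3 → 𝕜) : Prop :=
  ∀ η : Fin 3 → 𝕜, dotProduct θ η = 0 → dotProduct ψ η = 0 →
    fderiv 𝕜 F s (symProd ξ η) = 0 → η = 0

/-- For each `i`, `S` contains a characteristic curve `c` with `c(0) = s` and `c' = ξ ξᵀ`, where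
`ξ(0) = ξ₀ⁱ`, `θⁱ · ξ(t) = 1` and `ψⁱ · ξ(t) = hⁱ(t)`. -/
def HasCharacteristicCurves {n : ℕ} (s : SymMat 𝕜) (ξ₀ θ ψ : Fin n → Fin 3 → 𝕜)
    (h : Fin n → 𝕜 → 𝕜) (S : Set (SymMat 𝕜)) : Prop :=
  ∀ i, ∃ (c : 𝕜 → SymMat 𝕜) (ξ : 𝕜 → Fin 3 → 𝕜),
    AnalyticAt 𝕜 c 0 ∧ AnalyticAt 𝕜 ξ 0 ∧ c 0 = s ∧ ξ 0 = ξ₀ i ∧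
    ∀ᶠ t in 𝓝 (0 : 𝕜), c t ∈ S ∧ HasDerivAt c (sqMat (ξ t)) t ∧
      dotProduct (θ i) (ξ t) = 1 ∧ dotProduct (ψ i) (ξ t) = h i t

/-- The `n`-dimensional submanifolds with the property `P` are parametrized by `n` arbitrary
functions of one variable. At every point `s` of the hypersurface, for every choice of `n` distinct
characteristic directions `ξ₀ⁱ` at `s` and every choice of local parameters on the conic at these
directions, the germs at `s` of such submanifolds tangent to the `n` directions are in bijection with
the `n`-tuples of germs of analytic functions `hⁱ(t)` with the appropriate value at `0`: `hⁱ` gives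
the direction of the `i`-th characteristic curve through `s`. -/
def ParametrizedByFunctions (n : ℕ) (Ω : Set (SymMat 𝕜)) (F : SymMat 𝕜 → 𝕜)
    (P : Set (SymMat 𝕜) → Prop) : Prop :=
  ∀ s ∈ hypersurface Ω F, ∀ ξ₀ θ ψ : Fin n → Fin 3 → 𝕜,
    (∀ i, fderiv 𝕜 F s (sqMat (ξ₀ i)) = 0) →
    (∀ i j, i ≠ j → LinearIndependent 𝕜 ![ξ₀ i, ξ₀ j]) →
    (∀ i, dotProduct (θ i) (ξ₀ i) = 1) →
    (∀ i, IsLocalParameter F s (ξ₀ i) (θ i) (ψ i)) →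
    (∀ h : Fin n → 𝕜 → 𝕜,
      (∀ i, AnalyticAt 𝕜 (h i) 0 ∧ h i 0 = dotProduct (ψ i) (ξ₀ i)) →
      (∃ S, P S ∧ s ∈ S ∧ HasCharacteristicCurves s ξ₀ θ ψ h S) ∧
      ∀ S S', P S → P S' → HasCharacteristicCurves s ξ₀ θ ψ h S →
        HasCharacteristicCurves s ξ₀ θ ψ h S' → ∀ᶠ U in 𝓝 s, U ∈ S ↔ U ∈ S') ∧
    (∀ S, P S → s ∈ S → (∀ i, sqMat (ξ₀ i) ∈ tangentVectors n S s) →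
      ∃ h : Fin n → 𝕜 → 𝕜,
        (∀ i, AnalyticAt 𝕜 (h i) 0 ∧ h i 0 = dotProduct (ψ i) (ξ₀ i)) ∧
        HasCharacteristicCurves s ξ₀ θ ψ h S ∧
        ∀ h' : Fin n → 𝕜 → 𝕜, HasCharacteristicCurves s ξ₀ θ ψ h' S →
          ∀ i, h' i =ᶠ[𝓝 0] h i)

/-- A reduction on `D ∋ 0` passes through `s` at `R = 0` with the speeds `ξ₀ⁱ = (1, μ₀ⁱ, λ₀ⁱ)` there,
and along the `i`-th coordinate axis one has `u_xx = s_xx + R^i` (this fixes the freedom of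
reparametrization `R^i → φ^i(R^i)`) and `ψⁱ · (1, μ^i, λ^i) = hⁱ(R^i)`. -/
def HasGoursatData {n : ℕ} (s : SymMat 𝕜) (ξ₀ ψ : Fin n → Fin 3 → 𝕜) (h : Fin n → 𝕜 → 𝕜)
    (D : Set (Fin n → 𝕜)) (U : (Fin n → 𝕜) → SymMat 𝕜) (lam mu : Fin n → (Fin n → 𝕜) → 𝕜) :
    Prop :=
  0 ∈ D ∧ U 0 = s ∧ (∀ i, ![1, mu i 0, lam i 0] = ξ₀ i) ∧
    ∀ i, ∀ᶠ t in 𝓝 (0 : 𝕜), (U (Pi.single i t)).1 0 0 = s.1 0 0 + t ∧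
      dotProduct (ψ i) ![1, mu i (Pi.single i t), lam i (Pi.single i t)] = h i t

/-- The equation has `n`-component reductions parametrized, modulo reparametrizations
`R^i → φ^i(R^i)`, by `n` arbitrary functions of one variable: at every point `s` of the hypersurface,
for every choice of `n` distinct solutions `(μ₀ⁱ, λ₀ⁱ)` of the dispersion relation at `s` and every
choice of local parameters on the conic at these points (for instance `μ`, where it is a local
parameter), each `n`-tuple of analytic germs `hⁱ` with the appropriate value at `0` prescribes the
speeds along the coordinate axes of exactly one germ of a normalized reduction through `s`. -/
def HasReductionsParametrizedByFunctions (n : ℕ) (Ω : Set (SymMat 𝕜)) (F : SymMat 𝕜 → 𝕜) : Prop :=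
  ∀ s ∈ hypersurface Ω F, ∀ ξ₀ ψ : Fin n → Fin 3 → 𝕜,
    (∀ i, ξ₀ i 0 = 1 ∧ fderiv 𝕜 F s (sqMat (ξ₀ i)) = 0) →
    (∀ i j, i ≠ j → ξ₀ i ≠ ξ₀ j) →
    (∀ i, IsLocalParameter F s (ξ₀ i) ![1, 0, 0] (ψ i)) →
    ∀ h : Fin n → 𝕜 → 𝕜,
      (∀ i, AnalyticAt 𝕜 (h i) 0 ∧ h i 0 = dotProduct (ψ i) (ξ₀ i)) →
      (∃ (D : Set (Fin n → 𝕜)) (U : (Fin n → 𝕜) → SymMat 𝕜) (lam mu : Fin n → (Fin n → 𝕜) → 𝕜),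
        IsReduction (hypersurface Ω F) n D U lam mu ∧ HasGoursatData s ξ₀ ψ h D U lam mu) ∧
      ∀ (D D' : Set (Fin n → 𝕜)) (U U' : (Fin n → 𝕜) → SymMat 𝕜)
        (lam mu lam' mu' : Fin n → (Fin n → 𝕜) → 𝕜),
        IsReduction (hypersurface Ω F) n D U lam mu → HasGoursatData s ξ₀ ψ h D U lam mu →
        IsReduction (hypersurface Ω F) n D' U' lam' mu' →
        HasGoursatData s ξ₀ ψ h D' U' lam' mu' →
        ∀ᶠ R in 𝓝 (0 : Fin n → 𝕜), U R = U' R ∧ ∀ i, lam i R = lam' i R ∧ mu i R = mu' i R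

/-- The equation `F = 0` is integrable: for every `n`, it possesses infinitely many `n`-component
hydrodynamic reductions parametrized by `n` arbitrary functions of one variable. -/
def IsIntegrable (Ω : Set (SymMat 𝕜)) (F : SymMat 𝕜 → 𝕜) : Prop :=
  ∀ n : ℕ, HasReductionsParametrizedByFunctions n Ω F

end DispersionlessHirota

end

open Set Filter Topology

attribute [local instance] Matrix.normedAddCommGroup Matrix.normedSpace

noncomputable section

namespace DispersionlessHirota

/-! A reduction can be tested on simple waves, the solutions in which a single phase varies. On them
the closure conditions say that the tensor `∂_iU ⊗ ξ_i`, with `ξ_i = (1, μ^i, λ^i)`, is totally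
symmetric, so `∂_iU` is a nonzero multiple of `ξ_i ξ_iᵀ` (`IsReduction.pd_eq`). Conversely, if all
`∂_iU` have this form, equality of mixed derivatives yields commutativity of the two systems. Along
any solution the derivatives of `U` are then sums of cubes `ξ_i ⊗ ξ_i ⊗ ξ_i`, so closure holds
(`isReduction_of_pd_eq`). Thus reductions are the maps to the hypersurface whose coordinate lines
are characteristic with finite, pairwise distinct speeds.

On a nonsingular conic two or three distinct points are linearly independent
(`linearIndependent_of_conic`), which makes such a map an immersion. The only rank-one matrices in
its tangent space are the multiples of the `∂_iU` (`exists_eq_smul_of_mem_span`). On a bisecant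
surface the characteristic directions form two transversal direction fields, which are coordinate
directions in suitable coordinates (`IsSecant.isHolonomic_two`). Both classes of the theorem are
therefore the holonomic ones, and finiteness of the speeds at a point is achieved by a linear change
of variables.

For the parametrization, write `∂_iΦ = η_i η_iᵀ`. Equality of mixed derivatives becomes `η_i ·
∂_jη_i = η_j · ∂_iη_j` for symmetric products, so `∂_jη_i = β_ij η_j`. The derivative of the
isotropy condition `dF(η_i η_iᵀ) = 0` then expresses `β_ij` through `Φ, η_i, η_j`
(`IsNet.rotation`). The free data are the values of `η_i` on the `i`-th axis. Isotropy and a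
normalization of the parameter leave one function of one variable for each `i`. The compatibility
condition is `∂_kβ_ij = β_ik β_jk` for distinct `i, j, k`, an algebraic condition on three points of
the conic (`obstruction`). It is void for two components, and if it holds for three it holds for any
number. If three-component objects exist for all data, the condition holds at all triples of
directions. For reductions this covers only finite speeds, and the others follow by continuity
(`IsIntegrable.isInvolutive`). So integrability and the existence of holonomic trisecant 3-folds
both amount to the vanishing of `obstruction`.

The analytic core is existence and uniqueness for this overdetermined Goursat problem. Only the
radial combinations `∑ R^k (∂_k - …)` of the equations are imposed at first. They form a determined
problem, solved by the analytic inverse function theorem in a space of continuous functions on a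
cube (`exists_goursat`). The remaining errors are then bounded, on small balls, by a small multiple
of their own total, and hence vanish (`SmallRel.eventually_eq_zero`, `isNet_of_radial`). The same
argument gives uniqueness (`IsNet.eq_of_goursat`). -/

section

variable {𝕜 : Type*} [RCLike 𝕜]

/-! ### Analytic inverse functions and superposition operators -/

section Analysis

variable {X Z V W : Type*} [NormedAddCommGroup X] [NormedSpace 𝕜 X]
  [NormedAddCommGroup Z] [NormedSpace 𝕜 Z] [NormedAddCommGroup V] [NormedSpace 𝕜 V]
  [NormedAddCommGroup W] [NormedSpace 𝕜 W]

/-- The analytic inverse function theorem. -/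
theorem exists_analytic_inverse [CompleteSpace X] [CompleteSpace Z] {f : X → Z} {x : X}
    (hf : AnalyticAt 𝕜 f x) (e : X ≃L[𝕜] Z) (he : HasFDerivAt f (e : X →L[𝕜] Z) x) :
    ∃ g : Z → X, AnalyticAt 𝕜 g (f x) ∧ g (f x) = x ∧ (∀ᶠ z in 𝓝 (f x), f (g z) = z) ∧
      ∀ᶠ y in 𝓝 x, g (f y) = y := by
  have hs : HasStrictFDerivAt f (e : X →L[𝕜] Z) x := by
    have := hf.hasStrictFDerivAt
    rwa [he.fderiv] at this
  refine ⟨hs.localInverse f e x, ?_, hs.localInverse_apply_image, hs.eventually_right_inverse,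
    hs.eventually_left_inverse⟩
  have h1 : (hs.toOpenPartialHomeomorph f).symm (f x) = x := hs.localInverse_apply_image
  refine (hs.toOpenPartialHomeomorph f).analyticAt_symm (i := e) ?_ ?_ ?_
  · exact hs.image_mem_toOpenPartialHomeomorph_target
  · rw [h1]; exact hf
  · rw [h1]; exact he.fderiv

/-- The analytic inverse function theorem in finite dimension. -/
theorem exists_analytic_inverse_of_injective [FiniteDimensional 𝕜 X] [FiniteDimensional 𝕜 Z]
    {f : X → Z} {x : X} (hf : AnalyticAt 𝕜 f x) (hdim : Module.finrank 𝕜 X = Module.finrank 𝕜 Z)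
    (hinj : ∀ v, fderiv 𝕜 f x v = 0 → v = 0) :
    ∃ g : Z → X, AnalyticAt 𝕜 g (f x) ∧ g (f x) = x ∧ (∀ᶠ z in 𝓝 (f x), f (g z) = z) ∧
      ∀ᶠ y in 𝓝 x, g (f y) = y := by
  have : CompleteSpace X := FiniteDimensional.complete 𝕜 X
  have : CompleteSpace Z := FiniteDimensional.complete 𝕜 Z
  have hi : Function.Injective (fderiv 𝕜 f x : X →ₗ[𝕜] Z) :=
    (injective_iff_map_eq_zero _).2 hinj
  let e : X ≃L[𝕜] Z := (LinearEquiv.ofInjectiveOfFinrankEq _ hi hdim).toContinuousLinearEquiv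
  refine exists_analytic_inverse hf e ?_
  have : (e : X →L[𝕜] Z) = fderiv 𝕜 f x := by ext v; rfl
  rw [this]
  exact hf.differentiableAt.hasFDerivAt

/-- An analytic equation `x = f (p, x)` whose right-hand side is constant in `x` for `p = p₀` has a
locally unique solution `x(p)`, which is analytic. -/
theorem exists_analytic_fixedPoint [CompleteSpace X] [CompleteSpace Z] {f : Z × X → X} {p₀ : Z}
    {x₀ : X} (hf : AnalyticAt 𝕜 f (p₀, x₀)) (h0 : ∀ᶠ x in 𝓝 x₀, f (p₀, x) = x₀) :
    ∃ g : Z → X, AnalyticAt 𝕜 g p₀ ∧ g p₀ = x₀ ∧ (∀ᶠ p in 𝓝 p₀, g p = f (p, g p)) ∧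
      ∀ᶠ q in 𝓝 (p₀, x₀), q.2 = f q → q.2 = g q.1 := by
  have hf0 : f (p₀, x₀) = x₀ := h0.self_of_nhds
  set f' := fderiv 𝕜 f (p₀, x₀)
  have hd : HasFDerivAt f f' (p₀, x₀) := hf.differentiableAt.hasFDerivAt
  -- Over `p₀` the map is constant in `x`, so its partial derivative in `x` vanishes. Hence `(p, x)
  -- ↦ (p, x - f (p, x))` has the triangular invertible derivative `e`, and no contraction estimate
  -- is needed.
  have hz : ∀ v, f' (0, v) = 0 := by
    intro v
    have h1 : HasFDerivAt (fun x => f (p₀, x)) (f'.comp (ContinuousLinearMap.inr 𝕜 Z X)) x₀ :=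
      HasFDerivAt.comp x₀ hd (hasFDerivAt_prodMk_right p₀ x₀)
    have h2 : HasFDerivAt (fun x => f (p₀, x)) (0 : X →L[𝕜] X) x₀ :=
      (hasFDerivAt_const x₀ x₀).congr_of_eventuallyEq h0
    simpa using congrArg (fun L : X →L[𝕜] X => L v) (h1.unique h2)
  have hsplit : ∀ u v, f' (u, v) = f' (u, 0) := by
    intro u v
    have : ((u, v) : Z × X) = (u, 0) + (0, v) := by simp
    rw [this, map_add, hz, add_zero]
  let e : (Z × X) ≃L[𝕜] (Z × X) := (ContinuousLinearEquiv.refl 𝕜 Z).skewProd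
    (ContinuousLinearEquiv.refl 𝕜 X) (-(f'.comp (ContinuousLinearMap.inl 𝕜 Z X)))
  have hΨ : AnalyticAt 𝕜 (fun q : Z × X => (q.1, q.2 - f q)) (p₀, x₀) :=
    analyticAt_fst.prod (analyticAt_snd.sub hf)
  have hΨ' : HasFDerivAt (fun q : Z × X => (q.1, q.2 - f q)) (e : (Z × X) →L[𝕜] (Z × X))
      (p₀, x₀) := by
    have h := HasFDerivAt.prodMk (hasFDerivAt_fst (𝕜 := 𝕜) (p := (p₀, x₀)))
      ((hasFDerivAt_snd (𝕜 := 𝕜) (p := (p₀, x₀))).sub hd)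
    refine h.congr_fderiv (ContinuousLinearMap.ext fun u => Prod.ext rfl ?_)
    have := hsplit u.1 u.2
    change u.2 - f' u = u.2 + -f' (u.1, 0)
    rw [← this, sub_eq_add_neg]
  obtain ⟨g, hg, hg0, hr, hl⟩ := exists_analytic_inverse hΨ e hΨ'
  simp only [hf0, sub_self] at hg hg0 hr
  have hin : Tendsto (fun p : Z => (p, (0 : X))) (𝓝 p₀) (𝓝 (p₀, 0)) :=
    (Continuous.prodMk_left (0 : X)).tendsto p₀
  refine ⟨fun p => (g (p, 0)).2, ?_, by simp [hg0], ?_, ?_⟩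
  · exact (analyticAt_snd (𝕜 := 𝕜)).comp
      (AnalyticAt.fun_comp_of_eq hg (analyticAt_id.prod analyticAt_const) rfl)
  · filter_upwards [hin.eventually hr] with p hp
    have h1 : (g (p, 0)).1 = p := congrArg Prod.fst hp
    have h2 : (g (p, 0)).2 - f (g (p, 0)) = 0 := congrArg Prod.snd hp
    have h3 : g (p, 0) = (p, (g (p, 0)).2) := Prod.ext h1 rfl
    rw [← h3]
    exact sub_eq_zero.1 h2
  · filter_upwards [hl] with q hq hfix
    have h1 : q.2 - f q = 0 := sub_eq_zero.2 hfix
    rw [h1] at hq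
    exact (congrArg Prod.snd hq).symm

/-- The pointwise application of a multilinear map to continuous functions. -/
def superMultilinear (K : Type*) [TopologicalSpace K] [CompactSpace K] {m : ℕ}
    (p : V [×m]→L[𝕜] W) : C(K, V) [×m]→L[𝕜] C(K, W) :=
  MultilinearMap.mkContinuous
    { toFun := fun v => ⟨fun s => p fun i => v i s, by fun_prop⟩
      map_update_add' := by
        intro _ v i x y
        ext s
        have h : ∀ z : C(K, V), (fun j => (Function.update v i z j) s) =
            Function.update (fun j => v j s) i (z s) := by
          intro z; ext j
          by_cases hj : j = i
          · subst hj; simp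
          · simp [hj]
        have hd : ‹DecidableEq (Fin m)› = instDecidableEqFin m := Subsingleton.elim _ _
        subst hd
        simp only [ContinuousMap.coe_mk, ContinuousMap.add_apply, h]
        rw [p.map_update_add]
      map_update_smul' := by
        intro _ v i c x
        ext s
        have h : ∀ z : C(K, V), (fun j => (Function.update v i z j) s) =
            Function.update (fun j => v j s) i (z s) := by
          intro z; ext j
          by_cases hj : j = i
          · subst hj; simp
          · simp [hj]
        have hd : ‹DecidableEq (Fin m)› = instDecidableEqFin m := Subsingleton.elim _ _
        subst hd
        simp only [ContinuousMap.coe_mk, ContinuousMap.smul_apply, h]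
        rw [p.map_update_smul] }
    ‖p‖ (by
      intro v
      rw [ContinuousMap.norm_le _ (by positivity)]
      intro s
      refine (p.le_opNorm _).trans ?_
      gcongr with i
      exact (v i).norm_coe_le_norm s)

theorem superMultilinear_apply (K : Type*) [TopologicalSpace K] [CompactSpace K] {m : ℕ}
    (p : V [×m]→L[𝕜] W) (v : Fin m → C(K, V)) (s : K) :
    superMultilinear K p v s = p fun i => v i s := rfl

theorem norm_superMultilinear_le (K : Type*) [TopologicalSpace K] [CompactSpace K] {m : ℕ}
    (p : V [×m]→L[𝕜] W) : ‖superMultilinear K p‖ ≤ ‖p‖ :=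
  MultilinearMap.mkContinuous_norm_le _ (norm_nonneg _) _

/-- Evaluation at `s` is continuous and linear, so it commutes with the sum of the series. What
remains is the series of `g` at `y s`, which converges because the norm of `y s` is at most that of
`y`. -/
theorem superMultilinear_sum_apply (K : Type*) [TopologicalSpace K] [CompactSpace K]
    [CompleteSpace W] {g : V → W} {v₀ : V} {p : FormalMultilinearSeries 𝕜 V W} {r : ENNReal}
    (hp : HasFPowerSeriesOnBall g p v₀ r) (y : C(K, V)) (hy : ‖y‖ₑ < r) (s : K)
    (q : FormalMultilinearSeries 𝕜 C(K, V) C(K, W)) (hq : ∀ m, q m = superMultilinear K (p m))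
    (hr : r ≤ q.radius) : q.sum y s = g (v₀ + y s) := by
  have hsum : HasSum (fun m => q m fun _ => y) (q.sum y) := by
    apply q.hasSum
    rw [Metric.mem_eball, edist_zero_right]
    exact hy.trans_le hr
  have hsum' : HasSum (fun m => (q m fun _ => y) s) (q.sum y s) :=
    (ContinuousMap.evalCLM 𝕜 s).hasSum hsum
  have hys : y s ∈ Metric.eball (0 : V) r := by
    rw [Metric.mem_eball, edist_zero_right]
    refine lt_of_le_of_lt ?_ hy
    rw [enorm_le_iff_norm_le]
    exact y.norm_coe_le_norm s
  have h2 := hp.hasSum hys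
  have h3 : (fun m => (q m fun _ => y) s) = fun m => p m fun _ => y s := by
    funext m
    rw [hq]
    exact superMultilinear_apply K (p m) _ s
  rw [h3] at hsum'
  exact hsum'.unique h2

/-- Composition with an analytic function is an analytic operator on continuous functions. -/
theorem exists_analytic_superposition (K : Type*) [TopologicalSpace K] [CompactSpace K]
    [CompleteSpace W] {g : V → W} {v₀ : V} (hg : AnalyticAt 𝕜 g v₀) :
    ∃ Γ : C(K, V) → C(K, W), AnalyticAt 𝕜 Γ (ContinuousMap.const K v₀) ∧
      ∀ᶠ f in 𝓝 (ContinuousMap.const K v₀), ∀ s, Γ f s = g (f s) := by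
  obtain ⟨p, r, hp⟩ := hg
  obtain ⟨q, hqp⟩ : ∃ q : FormalMultilinearSeries 𝕜 C(K, V) C(K, W),
      ∀ m, q m = superMultilinear K (p m) := ⟨fun m => superMultilinear K (p m), fun _ => rfl⟩
  -- In the sup norm the pointwise operators are no larger than the coefficients of the series of
  -- `g`, so nothing is lost in the radius of convergence.
  have hle : p.radius ≤ q.radius :=
    FormalMultilinearSeries.radius_le_of_le fun m => by
      rw [hqp]; exact norm_superMultilinear_le K (p m)
  have hq : HasFPowerSeriesOnBall q.sum q 0 q.radius :=
    q.hasFPowerSeriesOnBall ((hp.r_pos.trans_le hp.r_le).trans_le hle)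
  have hq' := hq.comp_sub (ContinuousMap.const K v₀)
  rw [zero_add] at hq'
  refine ⟨fun f => q.sum (f - ContinuousMap.const K v₀), hq'.analyticAt, ?_⟩
  filter_upwards [Metric.eball_mem_nhds (ContinuousMap.const K v₀) hp.r_pos] with f hf s
  have hyn : ‖f - ContinuousMap.const K v₀‖ₑ < r := by
    rw [Metric.mem_eball, edist_eq_enorm_sub] at hf
    exact hf
  rw [superMultilinear_sum_apply K hp _ hyn s q hqp (hp.r_le.trans hle)]
  simp

end Analysis

/-! ### Analytic solutions of Goursat problems -/

/-- Multiplication by `c` of the coordinates in `T`. -/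
def scaleOn {n : ℕ} (T : Finset (Fin n)) (c : 𝕜) (R : Fin n → 𝕜) : Fin n → 𝕜 :=
  fun k => if k ∈ T then c * R k else R k

/-- The projection to the coordinates in `T`. -/
def coordsOn {n : ℕ} (T : Finset (Fin n)) (R : Fin n → 𝕜) : Fin n → 𝕜 :=
  fun k => if k ∈ T then R k else 0

theorem scaleOn_one {n : ℕ} (T : Finset (Fin n)) (R : Fin n → 𝕜) : scaleOn T 1 R = R := by
  funext k; simp [scaleOn]

theorem scaleOn_scaleOn {n : ℕ} (T : Finset (Fin n)) (c d : 𝕜) (R : Fin n → 𝕜) :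
    scaleOn T c (scaleOn T d R) = scaleOn T (c * d) R := by
  funext k
  by_cases h : k ∈ T <;> simp [scaleOn, h, mul_assoc]

theorem hasDerivAt_scaleOn {n : ℕ} (T : Finset (Fin n)) (c : 𝕜) (R : Fin n → 𝕜) :
    HasDerivAt (fun c => scaleOn T c R) (coordsOn T R) c := by
  rw [hasDerivAt_pi]
  intro k
  by_cases h : k ∈ T
  · simpa [scaleOn, coordsOn, h] using (hasDerivAt_id c).mul_const (R k)
  · simpa [scaleOn, coordsOn, h] using hasDerivAt_const c (R k)

theorem norm_scaleOn_le {n : ℕ} (T : Finset (Fin n)) {c : 𝕜} (hc : ‖c‖ ≤ 1) (R : Fin n → 𝕜) :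
    ‖scaleOn T c R‖ ≤ ‖R‖ := by
  rw [pi_norm_le_iff_of_nonneg (norm_nonneg _)]
  intro k
  by_cases h : k ∈ T
  · simp only [scaleOn, h, if_true, norm_mul]
    exact (mul_le_of_le_one_left (norm_nonneg _) hc).trans (norm_le_pi_norm R k)
  · simp only [scaleOn, h, if_false]
    exact norm_le_pi_norm R k

/-! ### Scaling and integration on the cube -/

section Goursat

variable {V : Type*} [NormedAddCommGroup V] [NormedSpace 𝕜 V] {n : ℕ} {ι : Type*} [Fintype ι]

/-- The unit cube. -/
abbrev Cube (n : ℕ) : Type := Fin n → unitInterval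

/-- Multiplication by `τ` of the coordinates in `T` of a point of the cube. -/
def cubeScale (T : Finset (Fin n)) (τ : unitInterval) (s : Cube n) : Cube n :=
  fun k => if k ∈ T then τ * s k else s k

theorem continuous_cubeScale (T : Finset (Fin n)) :
    Continuous fun p : unitInterval × Cube n => cubeScale T p.1 p.2 := by
  refine continuous_pi fun k => ?_
  by_cases h : k ∈ T
  · simp only [cubeScale, h, if_true]; fun_prop
  · simp only [cubeScale, h, if_false]; fun_prop

/-- The point `R` with its coordinates multiplied by those of a point of the cube. -/
def cubeSMul (s : Cube n) (R : Fin n → 𝕜) : Fin n → 𝕜 := fun k => ((s k : ℝ) : 𝕜) * R k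

theorem cubeSMul_one (R : Fin n → 𝕜) : cubeSMul 1 R = R := by
  funext k; simp [cubeSMul]

theorem cubeSMul_mul (s σ : Cube n) (R : Fin n → 𝕜) :
    cubeSMul (s * σ) R = cubeSMul s (cubeSMul σ R) := by
  funext k; simp [cubeSMul, mul_assoc]

theorem cubeSMul_cubeScale_one (T : Finset (Fin n)) (τ : unitInterval) (R : Fin n → 𝕜) :
    cubeSMul (cubeScale T τ 1) R = scaleOn T ((τ : ℝ) : 𝕜) R := by
  funext k
  by_cases h : k ∈ T <;> simp [cubeSMul, cubeScale, scaleOn, h]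

theorem cubeScale_mul (T : Finset (Fin n)) (τ : unitInterval) (s σ : Cube n) :
    cubeScale T τ (s * σ) = cubeScale T τ s * σ := by
  funext k
  by_cases h : k ∈ T <;> simp [cubeScale, h, mul_assoc]

theorem continuous_cubeSMul (R : Fin n → 𝕜) : Continuous fun s : Cube n => cubeSMul s R := by
  unfold cubeSMul
  fun_prop

theorem norm_cubeSMul_le (s : Cube n) (R : Fin n → 𝕜) : ‖cubeSMul s R‖ ≤ ‖R‖ := by
  rw [pi_norm_le_iff_of_nonneg (norm_nonneg _)]
  intro k
  have h0 : ‖((s k : ℝ) : 𝕜)‖ ≤ 1 := by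
    rw [RCLike.norm_ofReal, abs_of_nonneg (s k).2.1]; exact (s k).2.2
  simp only [cubeSMul, norm_mul]
  exact (mul_le_of_le_one_left (norm_nonneg _) h0).trans (norm_le_pi_norm R k)

/-- The functions of a point `s` of the cube given by `s • R` and by a family of functions. -/
def cubeJoin (𝕜 : Type*) [RCLike 𝕜] (n : ℕ) (ι : Type*) [Fintype ι] (V : Type*)
    [NormedAddCommGroup V] [NormedSpace 𝕜 V] :
    ((Fin n → 𝕜) × (ι → C(Cube n, V))) →L[𝕜] C(Cube n, (Fin n → 𝕜) × (ι → V)) :=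
  LinearMap.mkContinuous
    { toFun := fun p => ⟨fun s => (cubeSMul s p.1, fun i => p.2 i s),
        (continuous_cubeSMul p.1).prodMk (by fun_prop)⟩
      map_add' := by
        intro p q; ext s
        · simp [cubeSMul, mul_add]
        · simp
      map_smul' := by
        intro c p; ext s
        · simp [cubeSMul, mul_left_comm]
        · simp }
    1 (by
      intro p
      rw [one_mul, ContinuousMap.norm_le _ (norm_nonneg _)]
      intro s
      refine norm_prod_le_iff.2 ⟨(norm_cubeSMul_le s p.1).trans (norm_fst_le p), ?_⟩
      refine le_trans ?_ (norm_snd_le p)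
      rw [pi_norm_le_iff_of_nonneg (norm_nonneg _)]
      exact fun i => ((p.2 i).norm_coe_le_norm s).trans (norm_le_pi_norm p.2 i))

theorem cubeJoin_apply (p : (Fin n → 𝕜) × (ι → C(Cube n, V))) (s : Cube n) :
    cubeJoin 𝕜 n ι V p s = (cubeSMul s p.1, fun i => p.2 i s) := rfl

theorem continuous_cubePath {V : Type*} [TopologicalSpace V] (T : Finset (Fin n))
    (f : C(Cube n, V)) : Continuous fun p : Cube n × ℝ =>
      f (cubeScale T (projIcc 0 1 zero_le_one p.2) p.1) := by
  have h : Continuous fun p : Cube n × ℝ =>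
      ((projIcc 0 1 zero_le_one p.2 : unitInterval), p.1) :=
    (continuous_projIcc.comp continuous_snd).prodMk continuous_fst
  exact f.continuous.comp ((continuous_cubeScale T).comp h)

section Integral

variable [NormedSpace ℝ V] [SMulCommClass ℝ 𝕜 V]

/-- The integral of a function along the segment from `s` to the point where the coordinates in `T`
vanish, multiplied by the `k`-th coordinate. -/
def cubeIntegral (𝕜 : Type*) [RCLike 𝕜] [NormedSpace 𝕜 V] [SMulCommClass ℝ 𝕜 V]
    (T : Finset (Fin n)) (k : Fin n) : C(Cube n, V) →L[𝕜] C(Cube n, V) :=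
  LinearMap.mkContinuous
    { toFun := fun f => ⟨fun s => ((s k : ℝ) : 𝕜) •
          ∫ τ in (0 : ℝ)..1, f (cubeScale T (projIcc 0 1 zero_le_one τ) s),
        Continuous.smul (by fun_prop)
          (intervalIntegral.continuous_parametric_intervalIntegral_of_continuous'
            (continuous_cubePath T f) 0 1)⟩
      map_add' := by
        intro f g
        ext s
        have h : ∀ f : C(Cube n, V), IntervalIntegrable
            (fun τ => f (cubeScale T (projIcc 0 1 zero_le_one τ) s)) MeasureTheory.volume 0 1 :=
          fun f => ((continuous_cubePath T f).comp (Continuous.prodMk_right s)).intervalIntegrable 0 1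
        simp only [ContinuousMap.add_apply, ContinuousMap.coe_mk]
        rw [intervalIntegral.integral_add (h f) (h g), smul_add]
      map_smul' := by
        intro c f
        ext s
        simp only [ContinuousMap.smul_apply, ContinuousMap.coe_mk, RingHom.id_apply]
        rw [intervalIntegral.integral_smul, smul_comm] }
    1 (by
      intro f
      rw [one_mul, ContinuousMap.norm_le _ (norm_nonneg _)]
      intro s
      have h0 : ‖((s k : ℝ) : 𝕜)‖ ≤ 1 := by
        rw [RCLike.norm_ofReal, abs_of_nonneg (s k).2.1]; exact (s k).2.2
      have h1 : ‖∫ τ in (0 : ℝ)..1, f (cubeScale T (projIcc 0 1 zero_le_one τ) s)‖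
          ≤ ‖f‖ * |1 - 0| :=
        intervalIntegral.norm_integral_le_of_norm_le_const fun τ _ => f.norm_coe_le_norm _
      simp only [LinearMap.coe_mk, AddHom.coe_mk, ContinuousMap.coe_mk, norm_smul]
      refine (mul_le_of_le_one_left (norm_nonneg _) h0).trans (h1.trans_eq (by simp)))

theorem cubeIntegral_apply (T : Finset (Fin n)) (k : Fin n) (f : C(Cube n, V)) (s : Cube n) :
    cubeIntegral 𝕜 T k f s = ((s k : ℝ) : 𝕜) •
      ∫ τ in (0 : ℝ)..1, f (cubeScale T (projIcc 0 1 zero_le_one τ) s) := rfl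

end Integral

end Goursat

/-! ### The Goursat problem in integral form -/

section Goursat

variable {V : Type*} [NormedAddCommGroup V] [NormedSpace 𝕜 V] {n : ℕ} {ι : Type*} [Fintype ι]

/-- The number `τ`, moved to the unit interval. -/
abbrev clampUnit (τ : ℝ) : unitInterval := projIcc 0 1 zero_le_one τ

/-- For each `R` the unknown is the family of functions `x_i(s) = w_i(s · R)` of a point `s` of the
cube. The problem becomes `x = M(R, x)` in a Banach space of continuous functions, with `R` as a
parameter. At `R = 0` the factors `R k` annihilate the integrals and `M` is locally constant, so
`exists_analytic_fixedPoint` gives a solution analytic in `R`, and `w` is its value at `s = 1`. A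
cube is used rather than a segment because the sets `T i` differ: the equation for one unknown
involves all the others at points where only some coordinates are shrunk. -/
theorem exists_goursat_integral [CompleteSpace V] [NormedSpace ℝ V] [SMulCommClass ℝ 𝕜 V]
    (T : ι → Finset (Fin n)) (G : ι → Fin n → (Fin n → 𝕜) × (ι → V) → V)
    (a : ι → (Fin n → 𝕜) → V) (ha : ∀ i, AnalyticAt 𝕜 (a i) 0)
    (hG : ∀ i, ∀ k ∈ T i, AnalyticAt 𝕜 (G i k) (0, fun j => a j 0)) :
    ∃ w : (Fin n → 𝕜) → ι → V, AnalyticAt 𝕜 w 0 ∧ (w 0 = fun i => a i 0) ∧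
      ∀ᶠ R in 𝓝 (0 : Fin n → 𝕜), ∀ i,
        (∀ k ∈ T i, Continuous fun τ : ℝ => G i k (scaleOn (T i) ((clampUnit τ : ℝ) : 𝕜) R,
          w (scaleOn (T i) ((clampUnit τ : ℝ) : 𝕜) R))) ∧
        w R i = a i R + ∑ k ∈ T i, R k • ∫ τ in (0 : ℝ)..1,
          G i k (scaleOn (T i) ((clampUnit τ : ℝ) : 𝕜) R,
            w (scaleOn (T i) ((clampUnit τ : ℝ) : 𝕜) R)) := by
  set w₀ : ι → V := fun i => a i 0 with hw₀
  set x₀ : ι → C(Cube n, V) := fun i => ContinuousMap.const _ (w₀ i) with hx₀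
  set J := cubeJoin 𝕜 n ι V with hJ
  have hJ0 : J (0, x₀) = ContinuousMap.const (Cube n) (0, w₀) := by
    ext s
    · simp [J, cubeJoin_apply, cubeSMul]
    · simp [J, cubeJoin_apply, x₀]
  have hA : ∀ i, AnalyticAt 𝕜 (fun q : (Fin n → 𝕜) × (ι → V) => a i q.1) (0, w₀) := fun i =>
    (ha i).comp_of_eq analyticAt_fst rfl
  choose ΓA hΓA hΓA' using fun i => exists_analytic_superposition (Cube n) (hA i)
  have hΓ : ∀ i k, ∃ Γ : C(Cube n, (Fin n → 𝕜) × (ι → V)) → C(Cube n, V), k ∈ T i →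
      AnalyticAt 𝕜 Γ (ContinuousMap.const _ (0, w₀)) ∧
      ∀ᶠ f in 𝓝 (ContinuousMap.const _ (0, w₀)), ∀ s, Γ f s = G i k (f s) := by
    intro i k
    by_cases h : k ∈ T i
    · obtain ⟨Γ, h1, h2⟩ := exists_analytic_superposition (Cube n) (hG i k h)
      exact ⟨Γ, fun _ => ⟨h1, h2⟩⟩
    · exact ⟨0, fun h' => absurd h' h⟩
  choose Γ hΓ using hΓ
  have hJt : Tendsto J (𝓝 (0, x₀)) (𝓝 (ContinuousMap.const _ (0, w₀))) := by
    rw [← hJ0]; exact J.continuous.tendsto _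
  set M : (Fin n → 𝕜) × (ι → C(Cube n, V)) → ι → C(Cube n, V) := fun q i =>
    ΓA i (J q) + ∑ k ∈ T i, q.1 k • cubeIntegral 𝕜 (T i) k (Γ i k (J q)) with hM
  have hMan : AnalyticAt 𝕜 M (0, x₀) := by
    rw [analyticAt_pi_iff]
    intro i
    refine AnalyticAt.add ?_ (Finset.analyticAt_fun_sum _ fun k hk => AnalyticAt.fun_smul ?_ ?_)
    · exact (hΓA i).comp_of_eq (J.analyticAt _) hJ0
    · exact ((ContinuousLinearMap.proj (R := 𝕜) k).comp
        (ContinuousLinearMap.fst 𝕜 (Fin n → 𝕜) (ι → C(Cube n, V)))).analyticAt _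
    · exact ((cubeIntegral 𝕜 (T i) k).analyticAt _).comp_of_eq
        ((hΓ i k hk).1.comp_of_eq (J.analyticAt _) hJ0) rfl
  have hval : ∀ᶠ q in 𝓝 (0, x₀), (∀ i s, ΓA i (J q) s = a i (cubeSMul s q.1)) ∧
      ∀ i, ∀ k ∈ T i, ∀ s, Γ i k (J q) s = G i k (cubeSMul s q.1, fun j => q.2 j s) := by
    refine (eventually_all.2 fun i => hJt.eventually (hΓA' i)).and
      (eventually_all.2 fun i => (Finset.eventually_all _).2 fun k hk => ?_)
    exact hJt.eventually (hΓ i k hk).2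
  have hM0 : ∀ᶠ x in 𝓝 x₀, M (0, x) = x₀ := by
    have ht : Tendsto (fun x => ((0 : Fin n → 𝕜), x)) (𝓝 x₀) (𝓝 (0, x₀)) :=
      (Continuous.prodMk_right _).tendsto x₀
    filter_upwards [ht.eventually hval] with x hx
    funext i
    ext s
    have h := hx.1 i s
    have h0 : cubeSMul s (0 : Fin n → 𝕜) = 0 := by funext k; simp [cubeSMul]
    rw [h0] at h
    simp [M, h, x₀, w₀]
  obtain ⟨g, hg, hg0, hgfix, hguniq⟩ := exists_analytic_fixedPoint hMan hM0
  -- a radius on which everything holds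
  have hev : ∀ᶠ q in 𝓝 ((0 : Fin n → 𝕜), x₀),
      (q.2 = M q → q.2 = g q.1) ∧ (∀ i s, ΓA i (J q) s = a i (cubeSMul s q.1)) ∧
      ∀ i, ∀ k ∈ T i, ∀ s, Γ i k (J q) s = G i k (cubeSMul s q.1, fun j => q.2 j s) :=
    hguniq.and hval
  obtain ⟨ε, hε, hball⟩ := Metric.eventually_nhds_iff_ball.1 hev
  have hgc : ∀ᶠ R in 𝓝 (0 : Fin n → 𝕜), g R ∈ Metric.ball x₀ ε := by
    have := hg.continuousAt.tendsto
    rw [hg0] at this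
    exact this.eventually (Metric.ball_mem_nhds _ hε)
  obtain ⟨δ, hδ, hδball⟩ := Metric.eventually_nhds_iff_ball.1
    ((hgfix.and hgc).and (show ∀ᶠ R in 𝓝 (0 : Fin n → 𝕜), R ∈ Metric.ball 0 ε from
      Metric.ball_mem_nhds _ hε))
  -- Consistency of the families: `s ↦ x(R)(s σ)` solves the fixed-point equation with parameter `σ
  -- · R`, so by local uniqueness it is `x(σ · R)`. This is what turns values on the cube into
  -- values of `w` at other points.
  have hcomp : ∀ R ∈ Metric.ball (0 : Fin n → 𝕜) δ, ∀ σ : Cube n, ∀ i,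
      g (cubeSMul σ R) i 1 = g R i σ := by
    intro R hR σ
    obtain ⟨⟨hfix, hgR⟩, hRε⟩ := hδball R hR
    set w' : ι → C(Cube n, V) := fun i => (g R i).comp ⟨fun s => s * σ, by fun_prop⟩ with hw'
    have hRσ : cubeSMul σ R ∈ Metric.ball (0 : Fin n → 𝕜) ε := by
      rw [mem_ball_zero_iff] at hRε ⊢
      exact (norm_cubeSMul_le σ R).trans_lt hRε
    have hw'b : w' ∈ Metric.ball x₀ ε := by
      rw [mem_ball_iff_norm] at hgR ⊢
      refine lt_of_le_of_lt ?_ hgR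
      rw [pi_norm_le_iff_of_nonneg (norm_nonneg _)]
      intro i
      rw [ContinuousMap.norm_le _ (norm_nonneg _)]
      intro s
      have h1 := (g R i - x₀ i).norm_coe_le_norm (s * σ)
      have h2 := norm_le_pi_norm (g R - x₀) i
      exact h1.trans h2
    have hq : (cubeSMul σ R, w') ∈ Metric.ball ((0 : Fin n → 𝕜), x₀) ε := by
      rw [← ball_prod_same]; exact ⟨hRσ, hw'b⟩
    have hq2 : (R, g R) ∈ Metric.ball ((0 : Fin n → 𝕜), x₀) ε := by
      rw [← ball_prod_same]; exact ⟨hRε, hgR⟩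
    obtain ⟨hu, hv1, hv2⟩ := hball _ hq
    obtain ⟨-, hv1', hv2'⟩ := hball _ hq2
    have heq : w' = M (cubeSMul σ R, w') := by
      funext i
      ext s
      have e0 : w' i s = M (R, g R) i (s * σ) := by rw [← hfix]; rfl
      rw [e0]
      simp only [M, ContinuousMap.add_apply, ContinuousMap.sum_apply, ContinuousMap.smul_apply,
        hv1, hv1', cubeIntegral_apply, cubeSMul_mul]
      congr 1
      refine Finset.sum_congr rfl fun k hk => ?_
      have e1 : ∀ τ, Γ i k (J (R, g R)) (cubeScale (T i) τ (s * σ)) =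
          Γ i k (J (cubeSMul σ R, w')) (cubeScale (T i) τ s) := by
        intro τ
        rw [hv2 i k hk, hv2' i k hk, cubeScale_mul, cubeSMul_mul]
        rfl
      simp only [e1]
      rw [smul_smul, smul_smul]
      congr 1
      simp [cubeSMul]
      ring
    intro i
    have := hu heq
    rw [show g (cubeSMul σ R) = w' from this.symm]
    change g R i (1 * σ) = _
    rw [one_mul]
  refine ⟨fun R i => g R i 1, ?_, ?_, ?_⟩
  · rw [analyticAt_pi_iff]
    intro i
    have h1 : AnalyticAt 𝕜 (fun R => g R i) 0 := (analyticAt_pi_iff.1 hg) i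
    exact ((ContinuousMap.evalCLM 𝕜 (1 : Cube n)).analyticAt _).comp_of_eq h1 rfl
  · funext i; simp [hg0, x₀]
  · filter_upwards [Metric.ball_mem_nhds (0 : Fin n → 𝕜) hδ] with R hR i
    obtain ⟨⟨hfix, hgR⟩, hRε⟩ := hδball R hR
    have hq2 : (R, g R) ∈ Metric.ball ((0 : Fin n → 𝕜), x₀) ε := by
      rw [← ball_prod_same]; exact ⟨hRε, hgR⟩
    obtain ⟨-, hv1', hv2'⟩ := hball _ hq2
    have hk' : ∀ k ∈ T i, ∀ τ : unitInterval, G i k (scaleOn (T i) ((τ : ℝ) : 𝕜) R,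
        fun j => g (scaleOn (T i) ((τ : ℝ) : 𝕜) R) j 1) =
        Γ i k (J (R, g R)) (cubeScale (T i) τ 1) := by
      intro k hk τ
      rw [hv2' i k hk, cubeSMul_cubeScale_one]
      congr 2
      funext j
      rw [← hcomp R hR, cubeSMul_cubeScale_one]
    constructor
    · intro k hk
      have := (continuous_cubePath (T i) (Γ i k (J (R, g R)))).comp
        (Continuous.prodMk_right (1 : Cube n))
      refine this.congr fun τ => ?_
      exact (hk' k hk _).symm
    · have e0 : g R i 1 = M (R, g R) i 1 := by rw [← hfix]
      rw [e0]
      simp only [M, ContinuousMap.add_apply, ContinuousMap.sum_apply, ContinuousMap.smul_apply,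
        hv1', cubeIntegral_apply, cubeSMul_one]
      congr 1
      refine Finset.sum_congr rfl fun k hk => ?_
      simp [hk' k hk]

end Goursat

/-! ### The Goursat problem in differential form -/

section Goursat

variable {V : Type*} [NormedAddCommGroup V] [NormedSpace 𝕜 V] {n : ℕ} {ι : Type*} [Fintype ι]

theorem clampUnit_of_mem {τ : ℝ} (h : τ ∈ Icc (0 : ℝ) 1) : ((clampUnit τ : ℝ)) = τ := by
  rw [clampUnit, projIcc_of_mem _ h]

/-- The analytic Goursat problem: the derivative of the `i`-th unknown function is prescribed along
the coordinates in `T i`, in the radial direction, and the function is prescribed where these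
coordinates vanish. -/
theorem exists_goursat [CompleteSpace V]
    (T : ι → Finset (Fin n)) (G : ι → Fin n → (Fin n → 𝕜) × (ι → V) → V)
    (a : ι → (Fin n → 𝕜) → V) (ha : ∀ i, AnalyticAt 𝕜 (a i) 0)
    (hinv : ∀ i c R, a i (scaleOn (T i) c R) = a i R)
    (hG : ∀ i, ∀ k ∈ T i, AnalyticAt 𝕜 (G i k) (0, fun j => a j 0)) :
    ∃ w : (Fin n → 𝕜) → ι → V, AnalyticAt 𝕜 w 0 ∧ (w 0 = fun i => a i 0) ∧
      ∀ᶠ R in 𝓝 (0 : Fin n → 𝕜), ∀ i, w (scaleOn (T i) 0 R) i = a i R ∧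
        fderiv 𝕜 (fun R => w R i) R (coordsOn (T i) R) = ∑ k ∈ T i, R k • G i k (R, w R) := by
  let : NormedSpace ℝ V := NormedSpace.restrictScalars ℝ 𝕜 V
  have : IsScalarTower ℝ 𝕜 V := RestrictScalars.isScalarTower ℝ 𝕜 V
  have : SMulCommClass ℝ 𝕜 V := IsScalarTower.to_smulCommClass
  obtain ⟨w, hw, hw0, hev⟩ := exists_goursat_integral T G a ha hG
  refine ⟨w, hw, hw0, ?_⟩
  obtain ⟨δ, hδ, hball⟩ := Metric.eventually_nhds_iff_ball.1 (hev.and hw.eventually_analyticAt)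
  filter_upwards [Metric.ball_mem_nhds (0 : Fin n → 𝕜) hδ] with R hR i
  have hsc : ∀ {σ : ℝ}, σ ∈ Icc (0 : ℝ) 1 → scaleOn (T i) (σ : 𝕜) R ∈ Metric.ball 0 δ := by
    intro σ hσ
    rw [mem_ball_zero_iff] at hR ⊢
    refine (norm_scaleOn_le _ ?_ R).trans_lt hR
    rw [RCLike.norm_ofReal, abs_of_nonneg hσ.1]; exact hσ.2
  set φ : Fin n → ℝ → V := fun k τ => G i k (scaleOn (T i) ((clampUnit τ : ℝ) : 𝕜) R,
            w (scaleOn (T i) ((clampUnit τ : ℝ) : 𝕜) R)) with hφ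
  have hφc : ∀ k ∈ T i, Continuous (φ k) := ((hball R hR).1 i).1
  -- On the ray through `R` the integral equation exhibits `w` as a primitive: the substitution `τ ↦
  -- τ σ` absorbs the factor `σ` of the scaled coordinates.
  have hray : ∀ σ ∈ Icc (0 : ℝ) 1, w (scaleOn (T i) (σ : 𝕜) R) i =
      a i R + ∑ k ∈ T i, R k • ∫ τ in (0 : ℝ)..σ, φ k τ := by
    intro σ hσ
    rw [((hball _ (hsc hσ)).1 i).2, hinv]
    congr 1
    refine Finset.sum_congr rfl fun k hk => ?_
    have e1 : ∫ τ in (0 : ℝ)..1, G i k (scaleOn (T i) ((clampUnit τ : ℝ) : 𝕜)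
        (scaleOn (T i) (σ : 𝕜) R),
        w (scaleOn (T i) ((clampUnit τ : ℝ) : 𝕜) (scaleOn (T i) (σ : 𝕜) R))) =
        ∫ τ in (0 : ℝ)..1, φ k (τ * σ) := by
      refine intervalIntegral.integral_congr fun τ hτ => ?_
      rw [uIcc_of_le zero_le_one] at hτ
      have hm : τ * σ ∈ Icc (0 : ℝ) 1 :=
        ⟨mul_nonneg hτ.1 hσ.1, mul_le_one₀ hτ.2 hσ.1 hσ.2⟩
      simp only [φ, scaleOn_scaleOn, clampUnit_of_mem hτ, clampUnit_of_mem hm, RCLike.ofReal_mul]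
    rw [e1]
    have e2 : scaleOn (T i) (σ : 𝕜) R k = R k * (σ : 𝕜) := by simp [scaleOn, hk, mul_comm]
    rw [e2, mul_smul]
    congr 1
    have e3 := intervalIntegral.smul_integral_comp_mul_right (a := 0) (b := 1) (φ k) σ
    rw [zero_mul, one_mul] at e3
    rw [← e3, RCLike.real_smul_eq_coe_smul (K := 𝕜)]
  constructor
  · have := hray 0 (by simp)
    simpa using this
  · have hd1 : HasDerivAt (fun c : 𝕜 => w (scaleOn (T i) c R) i)
        (fderiv 𝕜 (fun R => w R i) R (coordsOn (T i) R)) ((1 : ℝ) : 𝕜) := by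
      have hwi : AnalyticAt 𝕜 (fun R => w R i) R := (analyticAt_pi_iff.1 (hball R hR).2) i
      have h1 := hwi.differentiableAt.hasFDerivAt
      have h2 := hasDerivAt_scaleOn (T i) ((1 : ℝ) : 𝕜) R
      rw [← scaleOn_one (T i) R] at h1
      have h3 := HasFDerivAt.comp_hasDerivAt ((1 : ℝ) : 𝕜)
        (by simpa using h1 : HasFDerivAt (fun R => w R i)
          (fderiv 𝕜 (fun R => w R i) (scaleOn (T i) 1 R)) (scaleOn (T i) ((1 : ℝ) : 𝕜) R)) h2
      rw [scaleOn_one] at h3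
      exact h3
    have hd2 : HasDerivAt (fun σ : ℝ => w (scaleOn (T i) (σ : 𝕜) R) i)
        (fderiv 𝕜 (fun R => w R i) R (coordsOn (T i) R)) 1 := by
      have h1 := hd1.hasFDerivAt.restrictScalars ℝ
      have h2 : HasDerivAt (fun σ : ℝ => (σ : 𝕜)) 1 1 := by
        have := (RCLike.ofRealCLM (K := 𝕜)).hasDerivAt (x := (1 : ℝ))
        simpa using this
      have h3 := HasFDerivAt.comp_hasDerivAt (1 : ℝ) h1 h2
      simp only [ContinuousLinearMap.coe_restrictScalars', ContinuousLinearMap.toSpanSingleton_apply,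
        one_smul] at h3
      exact h3
    have hd3 : HasDerivAt (fun σ : ℝ => a i R + ∑ k ∈ T i, R k • ∫ τ in (0 : ℝ)..σ, φ k τ)
        (∑ k ∈ T i, R k • φ k 1) 1 := by
      refine HasDerivAt.const_add _ (HasDerivAt.fun_sum fun k hk => ?_)
      exact ((hφc k hk).integral_hasStrictDerivAt 0 1).hasDerivAt.const_smul (R k)
    -- The formula on the ray is available only for `σ ≤ 1`, so the derivatives at `σ = 1` are
    -- compared within the interval. Differentiability of `w` itself is already known.
    have hu : UniqueDiffWithinAt ℝ (Icc (0 : ℝ) 1) 1 :=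
      uniqueDiffOn_Icc zero_lt_one 1 (by simp)
    have he := hu.eq_deriv _ hd2.hasDerivWithinAt
      (hd3.hasDerivWithinAt.congr hray (hray 1 (by simp)))
    rw [he]
    refine Finset.sum_congr rfl fun k _ => ?_
    have : ((clampUnit (1 : ℝ) : ℝ)) = 1 := clampUnit_of_mem (by simp)
    simp only [φ, this, RCLike.ofReal_one, scaleOn_one]

/-- Analytic ordinary differential equations with parameters. -/
theorem exists_analytic_ode [CompleteSpace V] (k : Fin n) (G : (Fin n → 𝕜) × V → V)
    (a : (Fin n → 𝕜) → V) (ha : AnalyticAt 𝕜 a 0)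
    (hinv : ∀ c R, a (scaleOn {k} c R) = a R) (hG : AnalyticAt 𝕜 G (0, a 0)) :
    ∃ w : (Fin n → 𝕜) → V, AnalyticAt 𝕜 w 0 ∧
      ∀ᶠ R in 𝓝 (0 : Fin n → 𝕜), w (scaleOn {k} 0 R) = a R ∧ pd k w R = G (R, w R) := by
  obtain ⟨w, hw, hw0, hev⟩ := exists_goursat (ι := Unit) (fun _ => {k})
    (fun _ _ p => G (p.1, p.2 ())) (fun _ => a) (fun _ => ha) (fun _ => hinv)
    (fun _ _ _ => hG.comp_of_eq (analyticAt_fst.prod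
      (((ContinuousLinearMap.proj (R := 𝕜) (φ := fun _ : Unit => V) ()).analyticAt _).comp
        analyticAt_snd)) rfl)
  have hwu : AnalyticAt 𝕜 (fun R => w R ()) 0 := (analyticAt_pi_iff.1 hw) ()
  have hw0' : w 0 () = a 0 := by rw [hw0]
  refine ⟨fun R => w R (), hwu, ?_⟩
  -- the two sides agree where the `k`-th coordinate is not zero, hence everywhere
  have hc : ∀ᶠ R in 𝓝 (0 : Fin n → 𝕜), ContinuousAt
      (fun R => pd k (fun R => w R ()) R - G (R, w R ())) R := by
    have h1 : AnalyticAt 𝕜 (fun R => pd k (fun R => w R ()) R) 0 :=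
      ((ContinuousLinearMap.apply 𝕜 V (Pi.single k (1 : 𝕜) : Fin n → 𝕜)).analyticAt _).comp_of_eq
        hwu.fderiv rfl
    have h2 : AnalyticAt 𝕜 (fun R => G (R, w R ())) 0 :=
      hG.comp_of_eq (analyticAt_id.prod hwu) (by simp [hw0'])
    filter_upwards [(h1.sub h2).eventually_analyticAt] with R hR using hR.continuousAt
  obtain ⟨δ, hδ, hball⟩ := Metric.eventually_nhds_iff_ball.1 (hev.and hc)
  filter_upwards [Metric.ball_mem_nhds (0 : Fin n → 𝕜) hδ] with R hR
  refine ⟨((hball R hR).1 ()).1, ?_⟩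
  by_contra hne
  have hne' : pd k (fun R => w R ()) R - G (R, w R ()) ≠ 0 := sub_ne_zero.2 hne
  have hev2 : ∀ᶠ S in 𝓝 R, S ∈ Metric.ball (0 : Fin n → 𝕜) δ ∧
      pd k (fun R => w R ()) S - G (S, w S ()) ≠ 0 :=
    (show ∀ᶠ S in 𝓝 R, S ∈ Metric.ball (0 : Fin n → 𝕜) δ from Metric.isOpen_ball.mem_nhds hR).and
      (((hball R hR).2.eventually_ne hne'))
  have hkne : ∀ S ∈ Metric.ball (0 : Fin n → 𝕜) δ, S k ≠ 0 →
      pd k (fun R => w R ()) S - G (S, w S ()) = 0 := by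
    intro S hS hk
    have h := ((hball S hS).1 ()).2
    have e : coordsOn {k} S = S k • (Pi.single k (1 : 𝕜) : Fin n → 𝕜) := by
      funext j
      by_cases hj : j = k
      · subst hj; simp [coordsOn]
      · simp [coordsOn, hj]
    rw [e, map_smul, Finset.sum_singleton] at h
    exact sub_eq_zero.2 (smul_right_injective _ hk h)
  have ht : Tendsto (fun t : 𝕜 => R + t • (Pi.single k (1 : 𝕜) : Fin n → 𝕜)) (𝓝[≠] 0) (𝓝 R) := by
    have : Continuous fun t : 𝕜 => R + t • (Pi.single k (1 : 𝕜) : Fin n → 𝕜) := by fun_prop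
    have h := this.tendsto 0
    simp only [zero_smul, add_zero] at h
    exact h.mono_left nhdsWithin_le_nhds
  have hRk : R k = 0 := by
    by_contra h
    exact hne' (hkne R hR h)
  obtain ⟨t, ⟨h1, h2⟩, h3⟩ := ((ht.eventually hev2).and self_mem_nhdsWithin).exists
  exact h2 (hkne _ h1 (by simpa [hRk] using h3))

end Goursat

/-! ### Estimates along rays -/

section SmallRel

variable {V W : Type*} [NormedAddCommGroup V] [NormedAddCommGroup W] {n : ℕ}

/-- On small balls of radius `ρ`, the function `f` is bounded by a constant times `ρ` times the
supremum of `N`. -/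
def SmallRel (N : (Fin n → 𝕜) → ℝ) (f : (Fin n → 𝕜) → V) : Prop :=
  ∃ C, 0 ≤ C ∧ ∃ ρ₀ > 0, ∀ ρ, 0 < ρ → ρ ≤ ρ₀ → ∀ m, 0 ≤ m → (∀ R, ‖R‖ ≤ ρ → N R ≤ m) →
    ∀ R, ‖R‖ ≤ ρ → ‖f R‖ ≤ C * ρ * m

theorem eventually_exists_closedBall {P : (Fin n → 𝕜) → Prop} (h : ∀ᶠ R in 𝓝 0, P R) :
    ∃ ρ₀ > 0, ∀ R, ‖R‖ ≤ ρ₀ → P R := by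
  obtain ⟨ε, hε, hb⟩ := Metric.eventually_nhds_iff_ball.1 h
  exact ⟨ε / 2, by positivity, fun R hR => hb R (by rw [mem_ball_zero_iff]; linarith)⟩

theorem eventually_of_closedBall {P : (Fin n → 𝕜) → Prop} {ρ : ℝ} (hρ : 0 < ρ)
    (h : ∀ R, ‖R‖ ≤ ρ → P R) : ∀ᶠ R in 𝓝 0, P R := by
  filter_upwards [Metric.ball_mem_nhds (0 : Fin n → 𝕜) hρ] with R hR
  exact h R (mem_ball_zero_iff.1 hR).le

namespace SmallRel

variable {N : (Fin n → 𝕜) → ℝ} {f : (Fin n → 𝕜) → V} {g : (Fin n → 𝕜) → W}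

/-- On a ball with `C * ρ ≤ 1/2` a bound `m` for `N` improves to `m / 2`. Iterating from any local
bound leaves only zero. -/
theorem eventually_eq_zero (hN0 : ∀ R, 0 ≤ N R) (hN : ∃ B, ∀ᶠ R in 𝓝 0, N R ≤ B)
    (h : SmallRel N N) : ∀ᶠ R in 𝓝 0, N R = 0 := by
  obtain ⟨C, hC, ρ₀, hρ₀, h⟩ := h
  obtain ⟨B, hB⟩ := hN
  obtain ⟨ρ₁, hρ₁, hB⟩ := eventually_exists_closedBall hB
  -- The last entry makes `C * ρ ≤ 1/2`; the shift `C + 1` covers the case `C = 0`.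
  set ρ := min (min ρ₀ ρ₁) (1 / (2 * (C + 1))) with hρdef
  have hρ : 0 < ρ := by positivity
  have hCρ : C * ρ ≤ 1 / 2 := by
    calc C * ρ ≤ (C + 1) * (1 / (2 * (C + 1))) := by
          gcongr
          · linarith
          · exact min_le_right _ _
      _ = 1 / 2 := by field_simp
  have hB0 : 0 ≤ B := (hN0 0).trans (hB 0 (by simpa using hρ₁.le))
  have hk : ∀ k : ℕ, ∀ R, ‖R‖ ≤ ρ → N R ≤ B * (1 / 2) ^ k := by
    intro k
    induction k with
    | zero =>
      intro R hR
      simpa using hB R (hR.trans ((min_le_left _ _).trans (min_le_right _ _)))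
    | succ k ih =>
      intro R hR
      have h1 := h ρ hρ ((min_le_left _ _).trans (min_le_left _ _)) _ (by positivity) ih R hR
      rw [Real.norm_of_nonneg (hN0 R)] at h1
      refine h1.trans ?_
      rw [pow_succ]
      have : 0 ≤ B * (1 / 2 : ℝ) ^ k := by positivity
      nlinarith
  refine eventually_of_closedBall hρ fun R hR => le_antisymm ?_ (hN0 R)
  have ht : Tendsto (fun k : ℕ => B * (1 / 2 : ℝ) ^ k) atTop (𝓝 (B * 0)) :=
    (tendsto_pow_atTop_nhds_zero_of_lt_one (by norm_num) (by norm_num)).const_mul B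
  rw [mul_zero] at ht
  exact ge_of_tendsto' ht fun k => hk k R hR

theorem of_isBigO (hf : SmallRel N f) (h : g =O[𝓝 0] f) : SmallRel N g := by
  obtain ⟨C, hC, ρ₀, hρ₀, hf⟩ := hf
  obtain ⟨c, hc, hb⟩ := h.exists_nonneg
  obtain ⟨ρ₁, hρ₁, hb⟩ := eventually_exists_closedBall hb.bound
  refine ⟨c * C, by positivity, min ρ₀ ρ₁, by positivity, fun ρ h0 h1 m hm hN R hR => ?_⟩
  have := hf ρ h0 (h1.trans (min_le_left _ _)) m hm hN R hR
  calc ‖g R‖ ≤ c * ‖f R‖ := hb R (hR.trans (h1.trans (min_le_right _ _)))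
    _ ≤ c * (C * ρ * m) := by gcongr
    _ = c * C * ρ * m := by ring

theorem norm_add (hf : SmallRel N f) (hg : SmallRel N g) :
    SmallRel N (fun R => ‖f R‖ + ‖g R‖) := by
  obtain ⟨C, hC, ρ₀, hρ₀, hf⟩ := hf
  obtain ⟨D, hD, ρ₁, hρ₁, hg⟩ := hg
  refine ⟨C + D, by positivity, min ρ₀ ρ₁, by positivity, fun ρ h0 h1 m hm hN R hR => ?_⟩
  have h2 := hf ρ h0 (h1.trans (min_le_left _ _)) m hm hN R hR
  have h3 := hg ρ h0 (h1.trans (min_le_right _ _)) m hm hN R hR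
  rw [Real.norm_of_nonneg (by positivity)]
  linarith

theorem zero : SmallRel N (fun _ => (0 : V)) :=
  ⟨0, le_rfl, 1, one_pos, fun ρ _ _ m _ _ R _ => by simp⟩

theorem add {f g : (Fin n → 𝕜) → V} (hf : SmallRel N f) (hg : SmallRel N g) :
    SmallRel N (fun R => f R + g R) := by
  refine (hf.norm_add hg).of_isBigO (Asymptotics.IsBigO.of_bound 1 (Eventually.of_forall ?_))
  intro R
  rw [one_mul, Real.norm_of_nonneg (by positivity)]
  exact norm_add_le _ _

theorem norm (hf : SmallRel N f) : SmallRel N (fun R => ‖f R‖) :=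
  hf.of_isBigO (Asymptotics.isBigO_norm_left.2 (Asymptotics.isBigO_refl _ _))

theorem sum {κ : Type*} {f : κ → (Fin n → 𝕜) → V} (s : Finset κ)
    (hf : ∀ c ∈ s, SmallRel N (f c)) : SmallRel N (fun R => ∑ c ∈ s, f c R) := by
  classical
  induction s using Finset.induction_on with
  | empty => simpa using zero (N := N) (V := V)
  | insert a s ha ih =>
    simp only [Finset.sum_insert ha]
    exact (hf a (by simp)).add (ih fun c hc => hf c (by simp [hc]))

theorem comp_scaleOn (hf : SmallRel N f) (T : Finset (Fin n)) {c : 𝕜} (hc : ‖c‖ ≤ 1) :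
    SmallRel N (fun R => f (scaleOn T c R)) := by
  obtain ⟨C, hC, ρ₀, hρ₀, hf⟩ := hf
  exact ⟨C, hC, ρ₀, hρ₀, fun ρ h0 h1 m hm hN R hR =>
    hf ρ h0 h1 m hm hN _ ((norm_scaleOn_le T hc R).trans hR)⟩

end SmallRel

end SmallRel

/-! ### Bounds obtained by integrating along rays -/

section Rays

variable {V W : Type*} [NormedAddCommGroup V] [NormedSpace 𝕜 V] [NormedAddCommGroup W]
  [NormedSpace 𝕜 W] {n : ℕ}

theorem fderiv_eq_sum_pd (f : (Fin n → 𝕜) → V) (R v : Fin n → 𝕜) :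
    fderiv 𝕜 f R v = ∑ k, v k • pd k f R := by
  conv_lhs => rw [pi_eq_sum_univ' v, map_sum]
  refine Finset.sum_congr rfl fun k _ => ?_
  rw [map_smul]
  rfl

theorem fderiv_coordsOn (f : (Fin n → 𝕜) → V) (T : Finset (Fin n)) (R S : Fin n → 𝕜) :
    fderiv 𝕜 f R (coordsOn T S) = ∑ k ∈ T, S k • pd k f R := by
  rw [fderiv_eq_sum_pd]
  simp [coordsOn, ite_smul, Finset.sum_ite_mem]

theorem norm_sub_le_of_norm_deriv_le {f f' : 𝕜 → V} {C : ℝ}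
    (hf : ∀ c : 𝕜, ‖c‖ ≤ 1 → HasDerivAt f (f' c) c) (hC : ∀ c : 𝕜, ‖c‖ ≤ 1 → ‖f' c‖ ≤ C) :
    ‖f 1 - f 0‖ ≤ C := by
  have h := Convex.norm_image_sub_le_of_norm_hasDerivWithin_le (f := f) (f' := f') (C := C)
    (s := Metric.closedBall (0 : 𝕜) 1) (x := 0) (y := 1)
    (fun c hc => (hf c (by simpa using hc)).hasDerivWithinAt)
    (fun c hc => hC c (by simpa using hc)) (convex_closedBall _ _) (by simp) (by simp)
  simpa using h

theorem hasDerivAt_comp_scaleOn {f : (Fin n → 𝕜) → V} {T : Finset (Fin n)} {c : 𝕜} {R : Fin n → 𝕜}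
    (hf : DifferentiableAt 𝕜 f (scaleOn T c R)) :
    HasDerivAt (fun c => f (scaleOn T c R)) (fderiv 𝕜 f (scaleOn T c R) (coordsOn T R)) c :=
  hf.hasFDerivAt.comp_hasDerivAt c (hasDerivAt_scaleOn T c R)

theorem coordsOn_scaleOn (T : Finset (Fin n)) (c : 𝕜) (R : Fin n → 𝕜) :
    coordsOn T (scaleOn T c R) = c • coordsOn T R := by
  funext k
  by_cases h : k ∈ T <;> simp [coordsOn, scaleOn, h]

/-- Estimate of a function through its partial derivatives. -/
theorem smallRel_sub_scaleOn {N : (Fin n → 𝕜) → ℝ} {f : (Fin n → 𝕜) → V} (hN0 : ∀ R, 0 ≤ N R)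
    (T : Finset (Fin n)) (hf : ∀ᶠ R in 𝓝 0, DifferentiableAt 𝕜 f R)
    (h : ∀ k ∈ T, pd k f =O[𝓝 0] N) : SmallRel N (fun R => f R - f (scaleOn T 0 R)) := by
  have h' : ∀ k, ∃ C, 0 ≤ C ∧ ∀ᶠ R in 𝓝 0, k ∈ T → ‖pd k f R‖ ≤ C * N R := by
    intro k
    by_cases hk : k ∈ T
    · obtain ⟨C, hC, hb⟩ := (h k hk).exists_nonneg
      refine ⟨C, hC, hb.bound.mono fun R hR _ => ?_⟩
      rwa [Real.norm_of_nonneg (hN0 R)] at hR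
    · exact ⟨0, le_rfl, Eventually.of_forall fun _ h => absurd h hk⟩
  choose C hC hb using h'
  obtain ⟨ρ₀, hρ₀, hb⟩ := eventually_exists_closedBall (hf.and (eventually_all.2 hb))
  refine ⟨∑ k ∈ T, C k, Finset.sum_nonneg fun k _ => hC k, ρ₀, hρ₀, fun ρ _ h1 m hm hN R hR => ?_⟩
  have key := norm_sub_le_of_norm_deriv_le (f := fun c => f (scaleOn T c R))
    (f' := fun c => fderiv 𝕜 f (scaleOn T c R) (coordsOn T R)) (C := (∑ k ∈ T, C k) * ρ * m) ?_ ?_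
  · rwa [scaleOn_one] at key
  · intro c hc
    exact hasDerivAt_comp_scaleOn
      (hb _ ((norm_scaleOn_le T hc R).trans (hR.trans h1))).1
  · intro c hc
    have hS : ‖scaleOn T c R‖ ≤ ρ := (norm_scaleOn_le T hc R).trans hR
    rw [fderiv_coordsOn, Finset.sum_mul, Finset.sum_mul]
    refine (norm_sum_le _ _).trans (Finset.sum_le_sum fun k hk => ?_)
    rw [norm_smul]
    calc ‖R k‖ * ‖pd k f (scaleOn T c R)‖ ≤ ρ * (C k * m) := by
          have h2 := (hb _ (hS.trans h1)).2 k hk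
          have h3 := hN _ hS
          have h4 := hC k
          have h5 := (norm_le_pi_norm R k).trans hR
          have h6 : ‖pd k f (scaleOn T c R)‖ ≤ C k * m := h2.trans (by gcongr)
          have h7 : 0 ≤ ρ := (norm_nonneg _).trans hR
          gcongr
      _ = C k * ρ * m := by ring

theorem smallRel_of_pd {N : (Fin n → 𝕜) → ℝ} {f : (Fin n → 𝕜) → V} (hN0 : ∀ R, 0 ≤ N R)
    (T : Finset (Fin n)) (hf : ∀ᶠ R in 𝓝 0, DifferentiableAt 𝕜 f R)
    (h : ∀ k ∈ T, pd k f =O[𝓝 0] N) (h0 : ∀ᶠ R in 𝓝 0, f (scaleOn T 0 R) = 0) :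
    SmallRel N f := by
  refine (smallRel_sub_scaleOn hN0 T hf h).of_isBigO (Asymptotics.IsBigO.of_bound 1 ?_)
  filter_upwards [h0] with R hR
  simp [hR]

/-- Estimate of a function through its Euler operator. -/
theorem smallRel_of_euler {N : (Fin n → 𝕜) → ℝ} {f : (Fin n → 𝕜) → V} (hN0 : ∀ R, 0 ≤ N R)
    (T : Finset (Fin n)) (hf : ∀ᶠ R in 𝓝 0, DifferentiableAt 𝕜 f R)
    (h : (fun R => f R + fderiv 𝕜 f R (coordsOn T R)) =O[𝓝 0] fun R => ‖R‖ * N R) :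
    SmallRel N f := by
  obtain ⟨C, hC, hb⟩ := h.exists_nonneg
  obtain ⟨ρ₀, hρ₀, hb⟩ := eventually_exists_closedBall (hf.and hb.bound)
  refine ⟨C, hC, ρ₀, hρ₀, fun ρ _ h1 m hm hN R hR => ?_⟩
  -- The derivative of `c • f (c R)` in `c` is the Euler expression at the scaled point. The factor
  -- `c` makes the function vanish at `c = 0`, so no boundary value of `f` is needed.
  have key := norm_sub_le_of_norm_deriv_le (f := fun c : 𝕜 => c • f (scaleOn T c R))
    (f' := fun c => f (scaleOn T c R) + fderiv 𝕜 f (scaleOn T c R) (coordsOn T (scaleOn T c R)))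
    (C := C * ρ * m) ?_ ?_
  · simpa [scaleOn_one] using key
  · intro c hc
    have h2 := hasDerivAt_comp_scaleOn
      (hb _ ((norm_scaleOn_le T hc R).trans (hR.trans h1))).1
    have h3 := (hasDerivAt_id c).smul h2
    rw [coordsOn_scaleOn, map_smul]
    exact h3.congr_deriv (by simp only [id, one_smul]; exact add_comm _ _)
  · intro c hc
    have hS : ‖scaleOn T c R‖ ≤ ρ := (norm_scaleOn_le T hc R).trans hR
    refine (hb _ (hS.trans h1)).2.trans ?_
    rw [Real.norm_of_nonneg (mul_nonneg (norm_nonneg _) (hN0 _)), mul_assoc]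
    have := hN _ hS
    have := hN0 (scaleOn T c R)
    gcongr

end Rays

/-! ### Symmetric products and rank-one matrices -/

/-- The topology of the norm, so that it is found by instance resolution. -/
abbrev symMatTopology : TopologicalSpace (SymMat 𝕜) :=
  PseudoMetricSpace.toUniformSpace.toTopologicalSpace


section Algebra

/-- The symmetric product as a continuous bilinear map. -/
def symProdL (𝕜 : Type*) [RCLike 𝕜] : (Fin 3 → 𝕜) →L[𝕜] (Fin 3 → 𝕜) →L[𝕜] SymMat 𝕜 :=
  (LinearMap.mk₂ 𝕜 symProd
    (fun a b c => Subtype.ext (Matrix.ext fun i j => by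
      change (a i + b i) * c j + c i * (a j + b j) = a i * c j + c i * a j + (b i * c j + c i * b j)
      ring))
    (fun k a c => Subtype.ext (Matrix.ext fun i j => by
      change k * a i * c j + c i * (k * a j) = k * (a i * c j + c i * a j)
      ring))
    (fun a b c => Subtype.ext (Matrix.ext fun i j => by
      change a i * (b j + c j) + (b i + c i) * a j = a i * b j + b i * a j + (a i * c j + c i * a j)
      ring))
    (fun k a c => Subtype.ext (Matrix.ext fun i j => by
      change a i * (k * c j) + k * c i * a j = k * (a i * c j + c i * a j)
      ring))).toContinuousBilinearMap

theorem symProdL_apply (ξ η : Fin 3 → 𝕜) : symProdL 𝕜 ξ η = symProd ξ η := rfl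

theorem symProd_apply (ξ η : Fin 3 → 𝕜) (i j : Fin 3) :
    (symProd ξ η).1 i j = ξ i * η j + η i * ξ j := rfl

theorem sqMat_apply (ξ : Fin 3 → 𝕜) (i j : Fin 3) : (sqMat ξ).1 i j = ξ i * ξ j := rfl

theorem symMat_ext {U V : SymMat 𝕜} (h : ∀ i j, U.1 i j = V.1 i j) : U = V :=
  Subtype.ext (Matrix.ext h)

theorem symMat_symm (U : SymMat 𝕜) (i j : Fin 3) : U.1 i j = U.1 j i :=
  (congrFun (congrFun U.2 i) j).symm

theorem symProd_comm (ξ η : Fin 3 → 𝕜) : symProd ξ η = symProd η ξ :=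
  symMat_ext fun i j => by simp only [symProd_apply]; ring

theorem symProd_self (ξ : Fin 3 → 𝕜) : symProd ξ ξ = (2 : 𝕜) • sqMat ξ :=
  symMat_ext fun i j => by
    change ξ i * ξ j + ξ i * ξ j = 2 * (ξ i * ξ j)
    ring

theorem sqMat_eq (ξ : Fin 3 → 𝕜) : sqMat ξ = (2⁻¹ : 𝕜) • symProdL 𝕜 ξ ξ := by
  rw [symProdL_apply, symProd_self, smul_smul]
  simp

theorem sqMat_smul (c : 𝕜) (ξ : Fin 3 → 𝕜) : sqMat (c • ξ) = c ^ 2 • sqMat ξ :=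
  symMat_ext fun i j => by
    change c * ξ i * (c * ξ j) = c ^ 2 * (ξ i * ξ j)
    ring

theorem symProd_smul_right (c : 𝕜) (ξ η : Fin 3 → 𝕜) : symProd ξ (c • η) = c • symProd ξ η := by
  rw [← symProdL_apply, map_smul]; rfl

theorem symProd_add_right (ξ η ζ : Fin 3 → 𝕜) :
    symProd ξ (η + ζ) = symProd ξ η + symProd ξ ζ := by
  rw [← symProdL_apply, map_add]; rfl

/-- The contraction of a symmetric matrix with a vector. -/
def contract (θ : Fin 3 → 𝕜) : SymMat 𝕜 →L[𝕜] (Fin 3 → 𝕜) :=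
  LinearMap.toContinuousLinearMap
    { toFun := fun V => V.1.mulVec θ
      map_add' := fun V W => Matrix.add_mulVec V.1 W.1 θ
      map_smul' := fun c V => Matrix.smul_mulVec c V.1 θ }

/-- The linear form `θ · ξ` of `ξ`. -/
def dotL (θ : Fin 3 → 𝕜) : (Fin 3 → 𝕜) →L[𝕜] 𝕜 :=
  LinearMap.toContinuousLinearMap
    { toFun := fun ξ => dotProduct θ ξ
      map_add' := fun ξ η => dotProduct_add θ ξ η
      map_smul' := fun c ξ => dotProduct_smul c θ ξ }

theorem dotL_apply (θ ξ : Fin 3 → 𝕜) : dotL θ ξ = dotProduct θ ξ := rfl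

theorem contract_sqMat (θ ξ : Fin 3 → 𝕜) : contract θ (sqMat ξ) = dotL θ ξ • ξ := by
  funext i
  change ∑ j, ξ i * ξ j * θ j = (∑ j, θ j * ξ j) * ξ i
  rw [Finset.sum_mul]
  exact Finset.sum_congr rfl fun j _ => by ring

theorem contract_symProd (θ ξ η : Fin 3 → 𝕜) :
    contract θ (symProd ξ η) = dotL θ η • ξ + dotL θ ξ • η := by
  funext i
  change ∑ j, (ξ i * η j + η i * ξ j) * θ j = (∑ j, θ j * η j) * ξ i + (∑ j, θ j * ξ j) * η i
  rw [Finset.sum_mul, Finset.sum_mul, ← Finset.sum_add_distrib]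
  exact Finset.sum_congr rfl fun j _ => by ring

theorem exists_dual {m : ℕ} {ξ : Fin m → Fin 3 → 𝕜} (h : LinearIndependent 𝕜 ξ) :
    ∃ l : Fin m → Fin 3 → 𝕜, ∀ i j, dotL (l i) (ξ j) = if i = j then 1 else 0 := by
  obtain ⟨g, hg⟩ := LinearMap.exists_leftInverse_of_injective (Fintype.linearCombination 𝕜 ξ)
    (LinearMap.ker_eq_bot.2 (h.fintypeLinearCombination_injective))
  refine ⟨fun i a => g (Pi.single a 1) i, fun i j => ?_⟩
  have h1 : g (ξ j) = Pi.single j 1 := by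
    have := congrArg (fun L => L (Pi.single j (1 : 𝕜))) hg
    simpa [Fintype.linearCombination_apply_single] using this
  have h2 : ∀ v : Fin 3 → 𝕜, dotL (fun a => g (Pi.single a 1) i) v = g v i := by
    intro v
    conv_rhs => rw [pi_eq_sum_univ' v, map_sum]
    simp [dotL_apply, dotProduct, mul_comm]
  rw [h2, h1, Pi.single_apply]

/-- In the symmetric algebra the equation reads `ξ v = ζ w` with coprime linear forms `ξ` and `ζ`,
so `ζ` divides `v`. Contraction with vectors dual to `ξ, ζ` recovers the quotient. -/
theorem symProd_eq_symProd {ξ ζ v w : Fin 3 → 𝕜} (hi : LinearIndependent 𝕜 ![ξ, ζ])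
    (h : symProd ξ v = symProd ζ w) : ∃ c : 𝕜, v = c • ζ ∧ w = c • ξ := by
  obtain ⟨l, hl⟩ := exists_dual hi
  have h00 : dotL (l 0) ξ = 1 := by simpa using hl 0 0
  have h01 : dotL (l 0) ζ = 0 := by simpa using hl 0 1
  have h10 : dotL (l 1) ξ = 0 := by simpa using hl 1 0
  have h11 : dotL (l 1) ζ = 1 := by simpa using hl 1 1
  have e0 := congrArg (contract (l 0)) h
  have e1 := congrArg (contract (l 1)) h
  simp only [contract_symProd, h00, h01, h10, h11, zero_smul, one_smul, add_zero] at e0 e1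
  have e1' := congrArg (dotL (l 1)) e1
  simp only [map_add, map_smul, h10, h11, smul_eq_mul, mul_one, mul_zero] at e1'
  have hw1 : dotL (l 1) w = 0 := by
    have h2 : (2 : 𝕜) * dotL (l 1) w = 0 := by linear_combination -e1'
    simpa using h2
  rw [hw1, zero_smul, zero_add] at e1
  refine ⟨dotL (l 1) v, ?_, e1.symm⟩
  have e0' := congrArg (dotL (l 0)) e0
  have hw0 : dotL (l 0) w = dotL (l 1) v := by rw [← e1]; simp [h00]
  simp only [map_add, map_smul, h00, h01, smul_eq_mul, mul_one, mul_zero] at e0'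
  have hv0 : dotL (l 0) v = 0 := by
    have h2 : (2 : 𝕜) * dotL (l 0) v = 0 := by linear_combination e0'
    simpa using h2
  rw [hv0, zero_smul, zero_add, hw0] at e0
  exact e0

/-- All columns are multiples of one vector `v`, and symmetry makes the factors proportional to the
entries of `v`. Over the reals the scalar `a` may be negative, so it cannot be absorbed in `ζ`. -/
theorem exists_eq_smul_sqMat {V : SymMat 𝕜} (h : V.1.rank = 1) :
    ∃ (a : 𝕜) (ζ : Fin 3 → 𝕜), a ≠ 0 ∧ ζ ≠ 0 ∧ V = a • sqMat ζ := by
  obtain ⟨⟨v, hv⟩, hv0, hall⟩ := finrank_eq_one_iff'.1 h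
  have hv0' : v ≠ 0 := fun h => hv0 (Subtype.ext h)
  have hc : ∀ j, ∃ c : 𝕜, ∀ i, V.1 i j = c * v i := by
    intro j
    obtain ⟨c, hc⟩ := hall ⟨V.1.mulVec (Pi.single j 1), ⟨Pi.single j 1, rfl⟩⟩
    refine ⟨c, fun i => ?_⟩
    have := congrFun (congrArg Subtype.val hc) i
    simpa using this.symm
  choose c hc using hc
  obtain ⟨p, hp⟩ := Function.ne_iff.1 hv0'
  have hp' : v p ≠ 0 := hp
  have hcj : ∀ j, c j = c p / v p * v j := by
    intro j
    have h1 := symMat_symm V p j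
    rw [hc, hc] at h1
    field_simp
    exact h1
  have hV : V = (c p / v p) • sqMat v := symMat_ext fun i j => by
    change V.1 i j = c p / v p * (v i * v j)
    rw [hc, hcj]; ring
  refine ⟨c p / v p, v, ?_, hv0', hV⟩
  intro h0
  rw [h0, zero_smul] at hV
  have : V.1 = 0 := by rw [hV]; rfl
  rw [this, Matrix.rank_zero] at h
  exact zero_ne_one h

theorem sqMat_ne_zero {ζ : Fin 3 → 𝕜} (h : ζ ≠ 0) : sqMat ζ ≠ 0 := by
  intro h0
  apply h
  funext i
  have : (sqMat ζ).1 i i = 0 := by rw [h0]; rfl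
  rw [sqMat_apply] at this
  simpa using this

theorem rank_smul_sqMat {a : 𝕜} {ζ : Fin 3 → 𝕜} (ha : a ≠ 0) (hζ : ζ ≠ 0) :
    (a • sqMat ζ).1.rank = 1 := by
  have h1 : (a • sqMat ζ).1 = Matrix.vecMulVec (a • ζ) ζ := by
    ext i j
    change a * (ζ i * ζ j) = a * ζ i * ζ j
    ring
  have hle : (a • sqMat ζ).1.rank ≤ 1 := h1 ▸ Matrix.rank_vecMulVec_le _ _
  refine le_antisymm hle (Nat.one_le_iff_ne_zero.2 fun h0 => ?_)
  have hne : a • sqMat ζ ≠ 0 := smul_ne_zero ha (sqMat_ne_zero hζ)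
  apply hne
  have h2 : LinearMap.range (a • sqMat ζ).1.mulVecLin = ⊥ := Submodule.finrank_eq_zero.1 h0
  rw [LinearMap.range_eq_bot] at h2
  refine symMat_ext fun i j => ?_
  have := congrFun (congrArg (fun L => L (Pi.single j (1 : 𝕜))) h2) i
  simpa using this

/-- A rank-one symmetric matrix is determined by its contraction with a vector. -/
theorem smul_eq_sqMat_contract {V : SymMat 𝕜} (h : V.1.rank = 1) (θ : Fin 3 → 𝕜) :
    dotL θ (contract θ V) • V = sqMat (contract θ V) := by
  obtain ⟨a, ζ, -, -, rfl⟩ := exists_eq_smul_sqMat h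
  simp only [map_smul, contract_sqMat, smul_smul, sqMat_smul, smul_eq_mul]
  congr 1
  ring

/-- In the span of the squares of independent vectors, only multiples of these squares have rank
one. -/
theorem mul_eq_zero_of_sum_smul_sqMat {m : ℕ} {ξ : Fin m → Fin 3 → 𝕜} (hξ : LinearIndependent 𝕜 ξ)
    {c : Fin m → 𝕜} (h : (∑ k, c k • sqMat (ξ k)).1.rank = 1) {i j : Fin m} (hij : i ≠ j) :
    c i * c j = 0 := by
  obtain ⟨l, hl⟩ := exists_dual hξ
  obtain ⟨a, ζ, -, -, hV⟩ := exists_eq_smul_sqMat h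
  -- In the frame dual to `ξ` the matrix is diagonal with entries `c k`. Being of rank one, it has
  -- zero principal minors, and these are the products `c i * c j`.
  have key : ∀ p q, dotL (l p) (contract (l q) (∑ k, c k • sqMat (ξ k))) =
      if p = q then c p else 0 := by
    intro p q
    simp only [map_sum, map_smul, contract_sqMat, hl, smul_eq_mul]
    simp
    split_ifs with h1 h2 h2
    all_goals grind
  have key2 : ∀ p q, dotL (l p) (contract (l q) (∑ k, c k • sqMat (ξ k))) =
      a * (dotL (l q) ζ * dotL (l p) ζ) := by
    intro p q
    rw [hV]
    simp [contract_sqMat]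
  have h1 := key i i
  have h2 := key j j
  have h3 := key i j
  rw [key2] at h1 h2 h3
  simp only [if_true, hij, if_false] at h1 h2 h3
  calc c i * c j = (a * (dotL (l j) ζ * dotL (l i) ζ)) * (a * (dotL (l j) ζ * dotL (l i) ζ)) := by
        rw [← h1, ← h2]; ring
    _ = 0 := by rw [h3]; simp

end Algebra

attribute [local instance] symMatTopology

/-! ### Nonsingular conics -/

section Conic

/-- The conic `dF_s(ξ ξᵀ) = 0` is nonsingular. -/
def IsNonsingularConic (F : SymMat 𝕜 → 𝕜) (s : SymMat 𝕜) : Prop :=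
  ∀ ξ : Fin 3 → 𝕜, (∀ η : Fin 3 → 𝕜, fderiv 𝕜 F s (symProd ξ η) = 0) → ξ = 0

variable {F : SymMat 𝕜 → 𝕜} {s : SymMat 𝕜}

theorem polar_self {ξ : Fin 3 → 𝕜} (h : fderiv 𝕜 F s (sqMat ξ) = 0) :
    fderiv 𝕜 F s (symProd ξ ξ) = 0 := by
  rw [symProd_self, map_smul, h, smul_zero]

/-- Otherwise `ξ` and `η` span a totally isotropic plane, which is too large for a nondegenerate
form in three variables. If the two polar functionals are independent, their common kernel is a
line, yet it contains both vectors. If they are dependent, a nonzero combination of the vectors lies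
in the radical. -/
theorem polar_ne_zero (hs : IsNonsingularConic F s) {ξ η : Fin 3 → 𝕜}
    (hξ : fderiv 𝕜 F s (sqMat ξ) = 0) (hη : fderiv 𝕜 F s (sqMat η) = 0)
    (hi : LinearIndependent 𝕜 ![ξ, η]) : fderiv 𝕜 F s (symProd ξ η) ≠ 0 := by
  intro h
  let L : (Fin 3 → 𝕜) →ₗ[𝕜] 𝕜 × 𝕜 :=
    (((fderiv 𝕜 F s).comp (symProdL 𝕜 ξ)).prod ((fderiv 𝕜 F s).comp (symProdL 𝕜 η))).toLinearMap
  have hL : ∀ v, L v = (fderiv 𝕜 F s (symProd ξ v), fderiv 𝕜 F s (symProd η v)) := fun v => rfl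
  have hξk : L ξ = 0 := by rw [hL, polar_self hξ, symProd_comm, h]; rfl
  have hηk : L η = 0 := by rw [hL, polar_self hη, h]; rfl
  by_cases hsurj : LinearMap.range L = ⊤
  · have h1 := L.finrank_range_add_finrank_ker
    rw [hsurj, finrank_top] at h1
    simp only [Module.finrank_prod, Module.finrank_self, Module.finrank_fin_fun] at h1
    have h2 : LinearIndependent 𝕜 (![⟨ξ, hξk⟩, ⟨η, hηk⟩] : Fin 2 → LinearMap.ker L) := by
      apply LinearIndependent.of_comp (LinearMap.ker L).subtype
      convert hi using 1
      funext i
      fin_cases i <;> rfl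
    have h3 := h2.fintype_card_le_finrank
    simp at h3
    omega
  · obtain ⟨f, hf, hle⟩ := Submodule.exists_le_ker_of_lt_top _ (lt_top_iff_ne_top.2 hsurj)
    have hpq : ∀ a b, f (a, b) = a * f (1, 0) + b * f (0, 1) := by
      intro a b
      have : ((a, b) : 𝕜 × 𝕜) = a • (1, 0) + b • (0, 1) := by simp
      rw [this, map_add, map_smul, map_smul]; rfl
    have h0 : f (1, 0) • ξ + f (0, 1) • η = 0 := by
      refine hs _ fun v => ?_
      have h1 : f (L v) = 0 := hle ⟨v, rfl⟩
      rw [hL, hpq] at h1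
      rw [symProd_comm, symProd_add_right, symProd_smul_right, symProd_smul_right, map_add,
        map_smul, map_smul, symProd_comm v ξ, symProd_comm v η]
      simp only [smul_eq_mul]
      linear_combination h1
    obtain ⟨h1, h2⟩ := LinearIndependent.pair_iff.1 hi _ _ h0
    apply hf
    refine LinearMap.ext fun p => ?_
    rw [show p = (p.1, p.2) from rfl, hpq, h1, h2]
    simp

/-- A line meets a nonsingular conic in at most two points. For three points the Gram matrix has
zero diagonal and nonzero off-diagonal entries `A, B, C`, with determinant `2ABC`. -/
theorem linearIndependent_of_conic (hs : IsNonsingularConic F s) {n : ℕ} (hn : n = 2 ∨ n = 3)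
    {ξ : Fin n → Fin 3 → 𝕜} (hξ : ∀ i, fderiv 𝕜 F s (sqMat (ξ i)) = 0)
    (hi : ∀ i j, i ≠ j → LinearIndependent 𝕜 ![ξ i, ξ j]) : LinearIndependent 𝕜 ξ := by
  obtain rfl | rfl := hn
  · have h := hi 0 1 (by decide)
    convert h using 1
    funext i
    fin_cases i <;> rfl
  · rw [Fintype.linearIndependent_iff]
    intro g hg
    have hne : ∀ i j, i ≠ j → fderiv 𝕜 F s (symProd (ξ i) (ξ j)) ≠ 0 := fun i j hij =>
      polar_ne_zero hs (hξ i) (hξ j) (hi i j hij)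
    have hp : ∀ j, ∑ i, g i * fderiv 𝕜 F s (symProd (ξ j) (ξ i)) = 0 := by
      intro j
      have h1 := congrArg (fun v => fderiv 𝕜 F s (symProdL 𝕜 (ξ j) v)) hg
      simp only [map_sum, map_smul, map_zero] at h1
      exact h1
    have h0 := hp 0
    have h1 := hp 1
    have h2 := hp 2
    simp only [Fin.sum_univ_three, polar_self (hξ _), mul_zero, zero_add, add_zero] at h0 h1 h2
    rw [symProd_comm (ξ 1) (ξ 0)] at h1
    rw [symProd_comm (ξ 2) (ξ 0), symProd_comm (ξ 2) (ξ 1)] at h2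
    have a := hne 0 1 (by decide)
    have b := hne 0 2 (by decide)
    have c := hne 1 2 (by decide)
    set A := fderiv 𝕜 F s (symProd (ξ 0) (ξ 1))
    set B := fderiv 𝕜 F s (symProd (ξ 0) (ξ 2))
    set C := fderiv 𝕜 F s (symProd (ξ 1) (ξ 2))
    have g0 : g 0 = 0 := by
      have : (2 * A * B) * g 0 = 0 := by linear_combination B * h1 + A * h2 - C * h0
      simpa [a, b] using this
    have g1 : g 1 = 0 := by
      have : C * g 1 = 0 := by linear_combination h2 - B * g0
      simpa [c] using this
    have g2 : g 2 = 0 := by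
      have : C * g 2 = 0 := by linear_combination h1 - A * g0
      simpa [c] using this
    intro i
    fin_cases i <;> assumption

theorem linearIndependent_sqMat {m : ℕ} {ξ : Fin m → Fin 3 → 𝕜} (hξ : LinearIndependent 𝕜 ξ) :
    LinearIndependent 𝕜 fun i => sqMat (ξ i) := by
  obtain ⟨l, hl⟩ := exists_dual hξ
  rw [Fintype.linearIndependent_iff]
  intro g hg i
  have := congrArg (fun V => dotL (l i) (contract (l i) V)) hg
  simpa [contract_sqMat, hl] using this

end Conic

/-! ### Calculus -/

section Calculus

variable {V W X : Type*} [NormedAddCommGroup V] [NormedSpace 𝕜 V] [NormedAddCommGroup W]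
  [NormedSpace 𝕜 W] [NormedAddCommGroup X] [NormedSpace 𝕜 X] {n : ℕ}

theorem pd_comp {g : V → W} {f : (Fin n → 𝕜) → V} {R : Fin n → 𝕜} (j : Fin n)
    (hg : DifferentiableAt 𝕜 g (f R)) (hf : DifferentiableAt 𝕜 f R) :
    pd j (fun R => g (f R)) R = fderiv 𝕜 g (f R) (pd j f R) := by
  unfold pd
  have h : HasFDerivAt (fun R => g (f R)) _ R := hg.hasFDerivAt.comp R hf.hasFDerivAt
  rw [h.fderiv]
  rfl

theorem pd_prodMk {f : (Fin n → 𝕜) → V} {g : (Fin n → 𝕜) → W} {R : Fin n → 𝕜} (j : Fin n)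
    (hf : DifferentiableAt 𝕜 f R) (hg : DifferentiableAt 𝕜 g R) :
    pd j (fun R => (f R, g R)) R = (pd j f R, pd j g R) := by
  unfold pd
  rw [(hf.hasFDerivAt.prodMk hg.hasFDerivAt).fderiv]
  rfl

theorem pd_sub {f g : (Fin n → 𝕜) → V} {R : Fin n → 𝕜} (j : Fin n)
    (hf : DifferentiableAt 𝕜 f R) (hg : DifferentiableAt 𝕜 g R) :
    pd j (fun R => f R - g R) R = pd j f R - pd j g R := by
  unfold pd
  have h : HasFDerivAt (fun R => f R - g R) _ R := hf.hasFDerivAt.sub hg.hasFDerivAt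
  rw [h.fderiv]
  rfl

theorem pd_smul {c : (Fin n → 𝕜) → 𝕜} {f : (Fin n → 𝕜) → V} {R : Fin n → 𝕜} (j : Fin n)
    (hc : DifferentiableAt 𝕜 c R) (hf : DifferentiableAt 𝕜 f R) :
    pd j (fun R => c R • f R) R = c R • pd j f R + pd j c R • f R := by
  unfold pd
  have h : HasFDerivAt (fun R => c R • f R) _ R := hc.hasFDerivAt.smul hf.hasFDerivAt
  rw [h.fderiv]
  rfl

theorem pd_clm_apply {c : (Fin n → 𝕜) → V →L[𝕜] W} {f : (Fin n → 𝕜) → V} {R : Fin n → 𝕜}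
    (j : Fin n) (hc : DifferentiableAt 𝕜 c R) (hf : DifferentiableAt 𝕜 f R) :
    pd j (fun R => c R (f R)) R = c R (pd j f R) + pd j c R (f R) := by
  unfold pd
  rw [(hc.hasFDerivAt.clm_apply hf.hasFDerivAt).fderiv]
  rfl

theorem pd_congr {f g : (Fin n → 𝕜) → V} {R : Fin n → 𝕜} (j : Fin n) (h : f =ᶠ[𝓝 R] g) :
    pd j f R = pd j g R := by
  unfold pd
  rw [h.fderiv_eq]

theorem analyticAt_clm_apply {c : X → V →L[𝕜] W} {f : X → V} {x : X}
    (hc : AnalyticAt 𝕜 c x) (hf : AnalyticAt 𝕜 f x) : AnalyticAt 𝕜 (fun x => c x (f x)) x :=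
  ((ContinuousLinearMap.id 𝕜 (V →L[𝕜] W)).analyticAt_bilinear (c x, f x)).comp_of_eq
    (hc.prod hf) rfl

theorem analyticAt_pd {f : (Fin n → 𝕜) → V} {R : Fin n → 𝕜} [CompleteSpace V] (j : Fin n)
    (hf : AnalyticAt 𝕜 f R) : AnalyticAt 𝕜 (pd j f) R :=
  analyticAt_clm_apply hf.fderiv analyticAt_const

theorem pd_pd_comm {f : (Fin n → 𝕜) → V} {R : Fin n → 𝕜} [CompleteSpace V] (j k : Fin n)
    (hf : AnalyticAt 𝕜 f R) : pd j (pd k f) R = pd k (pd j f) R := by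
  have h : ∀ j k : Fin n, pd j (pd k f) R =
      fderiv 𝕜 (fderiv 𝕜 f) R (Pi.single j 1) (Pi.single k 1) := by
    intro j k
    change pd j (fun S => fderiv 𝕜 f S (Pi.single k 1)) R = _
    rw [pd_clm_apply j hf.fderiv.differentiableAt (differentiableAt_const _)]
    simp [pd]
  rw [h, h]
  exact (hf.contDiffAt (n := ⊤)).isSymmSndFDerivAt_of_omega _ _

theorem isBigO_comp_sub {g : V → W} {v₀ : V} (hg : AnalyticAt 𝕜 g v₀) {α : Type*} {l : Filter α}
    {u v : α → V} (hu : Tendsto u l (𝓝 v₀)) (hv : Tendsto v l (𝓝 v₀)) :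
    (fun a => g (u a) - g (v a)) =O[l] fun a => u a - v a :=
  (hg.hasStrictFDerivAt.isBigO_sub).comp_tendsto (hu.prodMk_nhds hv)

theorem tendsto_of_analyticAt {f : V → W} {v : V} {w : W} (hf : AnalyticAt 𝕜 f v)
    (h : f v = w) : Tendsto f (𝓝 v) (𝓝 w) :=
  h ▸ hf.continuousAt.tendsto

/-- If `g` vanishes where the analytic equations `C = 0` of maximal rank hold, then `g` is bounded
by a multiple of `C`. -/
theorem isBigO_of_eq_zero [FiniteDimensional 𝕜 V] [FiniteDimensional 𝕜 W] {Z : Type*}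
    [NormedAddCommGroup Z] [NormedSpace 𝕜 Z] {C : V → W} {g : V → Z} {x₀ : V}
    (hC : AnalyticAt 𝕜 C x₀) (hg : AnalyticAt 𝕜 g x₀) (hC0 : C x₀ = 0)
    (hsurj : ∀ z, ∃ v, fderiv 𝕜 C x₀ v = z) (h : ∀ᶠ x in 𝓝 x₀, C x = 0 → g x = 0) :
    g =O[𝓝 x₀] C := by
  have : CompleteSpace V := FiniteDimensional.complete 𝕜 V
  have : CompleteSpace W := FiniteDimensional.complete 𝕜 W
  set C' := fderiv 𝕜 C x₀
  obtain ⟨S₀, hS₀⟩ := LinearMap.exists_rightInverse_of_surjective (C' : V →ₗ[𝕜] W)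
    (LinearMap.range_eq_top.2 hsurj)
  set S : W →L[𝕜] V := LinearMap.toContinuousLinearMap S₀
  have hS : ∀ z, C' (S z) = z := fun z => congrArg (fun L => L z) hS₀
  have hin : AnalyticAt 𝕜 (fun q : V × W => q.1 + S q.2) (x₀, 0) :=
    analyticAt_fst.add ((S.analyticAt _).comp analyticAt_snd)
  -- With `S` a right inverse of `C'`, solving `C (x + S z) = 0` for `z` moves `x` to the zero set
  -- of `C`. The inverse `G` sends `(x, C x)` to `(x, 0)` and `(x, 0)` to `(x, z)`, so `z` is `O(C
  -- x)`. Since `g` vanishes at the displaced point, `g x` is a difference of values at distance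
  -- `O(C x)`.
  have hΨ : AnalyticAt 𝕜 (fun q : V × W => (q.1, C (q.1 + S q.2))) (x₀, 0) :=
    analyticAt_fst.prod (hC.comp_of_eq hin (by simp))
  let e : (V × W) ≃L[𝕜] (V × W) := (ContinuousLinearEquiv.refl 𝕜 V).skewProd
    (ContinuousLinearEquiv.refl 𝕜 W) C'
  have hΨ' : HasFDerivAt (fun q : V × W => (q.1, C (q.1 + S q.2))) (e : (V × W) →L[𝕜] (V × W))
      (x₀, 0) := by
    have h1 : HasFDerivAt C C' ((fun q : V × W => q.1 + S q.2) (x₀, 0)) := by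
      simpa using hC.differentiableAt.hasFDerivAt
    have h2 : HasFDerivAt (fun q : V × W => q.1 + S q.2)
        (ContinuousLinearMap.fst 𝕜 V W + S.comp (ContinuousLinearMap.snd 𝕜 V W)) (x₀, 0) :=
      (ContinuousLinearMap.fst 𝕜 V W + S.comp (ContinuousLinearMap.snd 𝕜 V W)).hasFDerivAt
    have h3 : HasFDerivAt (fun q : V × W => C (q.1 + S q.2)) _ (x₀, 0) :=
      HasFDerivAt.comp (x₀, (0 : W)) h1 h2
    refine (HasFDerivAt.prodMk hasFDerivAt_fst h3).congr_fderiv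
      (ContinuousLinearMap.ext fun u => Prod.ext rfl ?_)
    change C' (u.1 + S u.2) = u.2 + C' u.1
    rw [map_add, hS, add_comm]
  obtain ⟨G, hG, hG0, hr, hl⟩ := exists_analytic_inverse hΨ e hΨ'
  simp only [map_zero, add_zero, hC0] at hG hG0 hr
  have ht0 : Tendsto (fun x : V => (x, (0 : W))) (𝓝 x₀) (𝓝 (x₀, 0)) :=
    (Continuous.prodMk_left (0 : W)).tendsto x₀
  have htC : Tendsto (fun x : V => (x, C x)) (𝓝 x₀) (𝓝 (x₀, 0)) :=
    tendsto_id.prodMk_nhds (tendsto_of_analyticAt hC hC0)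
  set z : V → W := fun x => (G (x, 0)).2
  have hz : z =O[𝓝 x₀] C := by
    have h1 := isBigO_comp_sub hG ht0 htC
    have h2 : z =ᶠ[𝓝 x₀] fun x => (G (x, 0) - G (x, C x)).2 := by
      filter_upwards [ht0.eventually hl] with x hx
      simp only [map_zero, add_zero] at hx
      simp [z, hx]
    refine h2.trans_isBigO ?_
    refine (Asymptotics.isBigO_of_le _ fun x => norm_snd_le _).trans (h1.trans ?_)
    refine Asymptotics.isBigO_of_le _ fun x => ?_
    simp [Prod.norm_def]
  have hzt : Tendsto z (𝓝 x₀) (𝓝 0) := by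
    have h1 := tendsto_of_analyticAt hG hG0
    exact (continuous_snd.tendsto (x₀, (0 : W))).comp (h1.comp ht0)
  have hxt : Tendsto (fun x => x + S (z x)) (𝓝 x₀) (𝓝 x₀) := by
    have := (tendsto_id (x := 𝓝 x₀)).add ((S.continuous.tendsto 0).comp hzt)
    simpa using this
  have h3 : g =ᶠ[𝓝 x₀] fun x => g x - g (x + S (z x)) := by
    filter_upwards [ht0.eventually hr, hxt.eventually h] with x hx hx0
    have e1 : (G (x, 0)).1 = x := congrArg Prod.fst hx
    have e2 : C ((G (x, 0)).1 + S (G (x, 0)).2) = 0 := congrArg Prod.snd hx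
    rw [e1] at e2
    rw [hx0 e2, sub_zero]
  refine h3.trans_isBigO ((isBigO_comp_sub hg tendsto_id hxt).trans ?_)
  have h4 : (fun x => id x - (x + S (z x))) = fun x => -(S (z x)) := by
    funext x; simp
  rw [h4]
  exact ((S.isBigO_comp _ _).neg_left).trans hz

/-- A family of functions with `∑ R^k f_k = 0` is estimated by its curl. -/
theorem smallRel_of_curl {N : (Fin n → 𝕜) → ℝ} {f : Fin n → (Fin n → 𝕜) → V} (hN0 : ∀ R, 0 ≤ N R)
    (T : Finset (Fin n)) (hf : ∀ k ∈ T, ∀ᶠ R in 𝓝 0, DifferentiableAt 𝕜 (f k) R)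
    (h0 : ∀ᶠ R in 𝓝 0, ∑ k ∈ T, R k • f k R = 0)
    (hcurl : ∀ j ∈ T, ∀ k ∈ T, j ≠ k → (fun R => pd k (f j) R - pd j (f k) R) =O[𝓝 0] N)
    {j : Fin n} (hj : j ∈ T) : SmallRel N (f j) := by
  refine smallRel_of_euler hN0 T (hf j hj) ?_
  have hd : ∀ᶠ R in 𝓝 0, ∀ k ∈ T, DifferentiableAt 𝕜 (f k) R :=
    (Finset.eventually_all _).2 hf
  have hcoord : ∀ (k : Fin n) (R : Fin n → 𝕜), HasFDerivAt (fun R : Fin n → 𝕜 => R k)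
      (ContinuousLinearMap.proj (R := 𝕜) (φ := fun _ : Fin n => 𝕜) k) R := fun k R =>
    (ContinuousLinearMap.proj (R := 𝕜) (φ := fun _ : Fin n => 𝕜) k).hasFDerivAt
  -- The `j`-th derivative of `∑ R^k f_k = 0` gives `f_j = -∑ R^k ∂_j f_k`. Adding the Euler
  -- derivative of `f_j` leaves only curls, each with a small factor `R^k`.
  have h1 : ∀ᶠ R in 𝓝 0, f j R + fderiv 𝕜 (f j) R (coordsOn T R) =
      ∑ k ∈ T, R k • (pd k (f j) R - pd j (f k) R) := by
    filter_upwards [h0.eventually_nhds, hd] with R hR hdR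
    have h2 : fderiv 𝕜 (fun R : Fin n → 𝕜 => ∑ k ∈ T, R k • f k R) R (Pi.single j 1) = 0 := by
      have : (fun R : Fin n → 𝕜 => ∑ k ∈ T, R k • f k R) =ᶠ[𝓝 R] fun _ => (0 : V) := hR
      rw [this.fderiv_eq]
      simp
    have h3 : HasFDerivAt (fun R : Fin n → 𝕜 => ∑ k ∈ T, R k • f k R) _ R :=
      HasFDerivAt.fun_sum (u := T) fun k hk => (hcoord k R).smul (hdR k hk).hasFDerivAt
    rw [h3.fderiv] at h2
    simp only [sum_apply, add_apply,
      smul_apply, ContinuousLinearMap.smulRight_apply,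
      ContinuousLinearMap.proj_apply, Pi.single_apply, ite_smul, one_smul, zero_smul,
      Finset.sum_add_distrib, Finset.sum_ite_eq', hj, if_true] at h2
    simp only [smul_sub, Finset.sum_sub_distrib]
    rw [fderiv_coordsOn, sub_eq_add_neg, add_comm]
    congr 1
    rw [eq_neg_iff_add_eq_zero, add_comm]
    exact h2
  refine Asymptotics.IsBigO.congr' ?_ (EventuallyEq.symm h1) EventuallyEq.rfl
  refine Asymptotics.IsBigO.fun_sum fun k hk => ?_
  have hRk : (fun R : Fin n → 𝕜 => R k) =O[𝓝 0] fun R : Fin n → 𝕜 => ‖R‖ :=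
    Asymptotics.isBigO_of_le _ fun R => by simpa using norm_le_pi_norm R k
  by_cases hjk : j = k
  · subst hjk
    simp only [sub_self, smul_zero]
    exact Asymptotics.isBigO_zero _ _
  · exact hRk.smul (hcurl j hj k hk hjk)

theorem eventually_eq_of_smul {f g : 𝕜 → V} (hf : ContinuousAt f 0) (hg : ContinuousAt g 0)
    (h : ∀ᶠ t in 𝓝 (0 : 𝕜), t • f t = t • g t) : ∀ᶠ t in 𝓝 (0 : 𝕜), f t = g t := by
  have h1 : ∀ᶠ t in 𝓝[≠] (0 : 𝕜), f t = g t := by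
    filter_upwards [nhdsWithin_le_nhds h, self_mem_nhdsWithin] with t ht h0
    exact smul_right_injective _ h0 ht
  have h2 : f 0 = g 0 := by
    have h3 : Tendsto f (𝓝[≠] 0) (𝓝 (f 0)) := hf.tendsto.mono_left nhdsWithin_le_nhds
    have h4 : Tendsto g (𝓝[≠] 0) (𝓝 (g 0)) := hg.tendsto.mono_left nhdsWithin_le_nhds
    exact tendsto_nhds_unique (h3.congr' h1) h4
  rw [eventually_nhdsWithin_iff] at h1
  filter_upwards [h1] with t ht
  by_cases h0 : t = 0
  · rw [h0, h2]
  · exact ht h0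

theorem eventually_eq_of_deriv_eq {f g : 𝕜 → V} {f' : 𝕜 → V} (h0 : f 0 = g 0)
    (hf : ∀ᶠ t in 𝓝 (0 : 𝕜), HasDerivAt f (f' t) t)
    (hg : ∀ᶠ t in 𝓝 (0 : 𝕜), HasDerivAt g (f' t) t) : ∀ᶠ t in 𝓝 (0 : 𝕜), f t = g t := by
  obtain ⟨δ, hδ, hb⟩ := Metric.eventually_nhds_iff_ball.1 (hf.and hg)
  filter_upwards [Metric.ball_mem_nhds (0 : 𝕜) hδ] with t ht
  have h := Convex.norm_image_sub_le_of_norm_hasDerivWithin_le (f := fun t => f t - g t)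
    (f' := fun _ => 0) (C := 0) (s := Metric.ball (0 : 𝕜) δ) (x := 0) (y := t)
    (fun c hc => (((hb c hc).1.sub (hb c hc).2).congr_deriv (sub_self _)).hasDerivWithinAt)
    (fun c hc => by simp) (convex_ball _ _) (by simpa using hδ) ht
  simp only [h0, sub_self, sub_zero, zero_mul] at h
  exact sub_eq_zero.1 (norm_le_zero_iff.1 h)

theorem exists_analytic_ode_one [CompleteSpace V] {X : 𝕜 × V → V} {v₀ : V}
    (hX : AnalyticAt 𝕜 X (0, v₀)) : ∃ c : 𝕜 → V, AnalyticAt 𝕜 c 0 ∧ c 0 = v₀ ∧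
      ∀ᶠ t in 𝓝 (0 : 𝕜), HasDerivAt c (X (t, c t)) t := by
  obtain ⟨w, hw, hev⟩ := exists_analytic_ode (n := 1) 0 (fun p => X (p.1 0, p.2)) (fun _ => v₀)
    analyticAt_const (fun _ _ => rfl) (hX.comp_of_eq
      ((((ContinuousLinearMap.proj (R := 𝕜) (φ := fun _ : Fin 1 => 𝕜) 0).analyticAt _).comp
        analyticAt_fst).prod analyticAt_snd) rfl)
  set L : 𝕜 →L[𝕜] (Fin 1 → 𝕜) := ContinuousLinearMap.pi fun _ => ContinuousLinearMap.id 𝕜 𝕜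
  have hL1 : L 1 = Pi.single 0 1 := by
    funext i
    have : i = 0 := Subsingleton.elim _ _
    subst this
    simp [L]
  have hL : Tendsto L (𝓝 0) (𝓝 0) := by simpa using L.continuous.tendsto 0
  refine ⟨fun t => w (L t), hw.comp_of_eq (L.analyticAt 0) (map_zero L), ?_, ?_⟩
  · have h := hev.self_of_nhds.1
    have h0 : scaleOn {0} (0 : 𝕜) (0 : Fin 1 → 𝕜) = 0 := by funext k; simp [scaleOn]
    rw [h0] at h
    simp [h]
  · filter_upwards [hL.eventually hev, hL.eventually hw.eventually_analyticAt] with t ht hat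
    have h1 := hat.differentiableAt.hasFDerivAt.comp_hasDerivAt t L.hasDerivAt
    rw [hL1] at h1
    have h2 : fderiv 𝕜 w (L t) (Pi.single 0 1) = X (t, w (L t)) := ht.2
    rw [h2] at h1
    exact h1

end Calculus

/-! ### Rotation coefficients and nets -/

section Net

variable {E Y : Type*} [NormedAddCommGroup E] [NormedSpace 𝕜 E] [NormedAddCommGroup Y]
  [NormedSpace 𝕜 Y] {n : ℕ}

/-- The quadratic map associated with a symmetric bilinear map. -/
def quad (b : Y →L[𝕜] Y →L[𝕜] E) (η : Y) : E := (2⁻¹ : 𝕜) • b η η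

theorem quad_symProdL : quad (symProdL 𝕜) = sqMat := by
  funext η; exact (sqMat_eq η).symm

/-- The rotation coefficient `β` in `∂_j η^i = β η^j`, as a function of `(U, η^i, η^j)`. -/
def rot (b : Y →L[𝕜] Y →L[𝕜] E) (F : E → 𝕜) (p : E × Y × Y) : 𝕜 :=
  -(fderiv 𝕜 (fderiv 𝕜 F) p.1 (quad b p.2.2) (quad b p.2.1)) / fderiv 𝕜 F p.1 (b p.2.1 p.2.2)

/-- The obstruction to the compatibility of the equations `∂_j η^i = β_ij η^j`. -/
def obstruction (b : Y →L[𝕜] Y →L[𝕜] E) (F : E → 𝕜) (U : E) (ξ η ζ : Y) : 𝕜 :=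
  fderiv 𝕜 (rot b F) (U, ξ, η) (quad b ζ, rot b F (U, ξ, ζ) • ζ, rot b F (U, η, ζ) • ζ) -
    rot b F (U, ξ, ζ) * rot b F (U, η, ζ)

variable {b : Y →L[𝕜] Y →L[𝕜] E} {F : E → 𝕜} {s : E}

theorem analyticAt_quad (η : Y) : AnalyticAt 𝕜 (quad b) η :=
  analyticAt_const.fun_smul ((b.analyticAt_bilinear (η, η)).comp_of_eq
    (analyticAt_id.prod analyticAt_id) rfl)

theorem hasFDerivAt_quad (hb : ∀ ξ η, b ξ η = b η ξ) (ξ : Y) : HasFDerivAt (quad b) (b ξ) ξ := by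
  have h1 := (b.hasFDerivAt (x := ξ)).clm_apply (hasFDerivAt_id ξ)
  refine (h1.const_smul (2⁻¹ : 𝕜)).congr_fderiv (ContinuousLinearMap.ext fun v => ?_)
  change (2⁻¹ : 𝕜) • (b ξ v + b v ξ) = b ξ v
  rw [hb v ξ, ← two_smul 𝕜, smul_smul]
  simp

theorem fderiv_quad (hb : ∀ ξ η, b ξ η = b η ξ) (ξ v : Y) : fderiv 𝕜 (quad b) ξ v = b ξ v := by
  rw [(hasFDerivAt_quad hb ξ).fderiv]

theorem fderiv_fderiv_symm (hF : AnalyticAt 𝕜 F s) (V W : E) :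
    fderiv 𝕜 (fderiv 𝕜 F) s V W = fderiv 𝕜 (fderiv 𝕜 F) s W V :=
  (hF.contDiffAt (n := ⊤)).isSymmSndFDerivAt_of_omega V W

theorem rot_symm (hb : ∀ ξ η, b ξ η = b η ξ) (hF : AnalyticAt 𝕜 F s) (ξ η : Y) :
    rot b F (s, ξ, η) = rot b F (s, η, ξ) := by
  simp only [rot]
  rw [fderiv_fderiv_symm hF, hb]

/-- `rot` is the rate at which `ξ` must move along `η` to stay isotropic while the base point moves
along `quad b η`. This is that condition, free of division. -/
theorem rot_mul (ξ η : Y) (h : fderiv 𝕜 F s (b ξ η) ≠ 0) :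
    fderiv 𝕜 (fderiv 𝕜 F) s (quad b η) (quad b ξ) + rot b F (s, ξ, η) * fderiv 𝕜 F s (b ξ η)
      = 0 := by
  simp only [rot]
  rw [div_mul_cancel₀ _ h]
  ring

theorem analyticAt_rot {p : E × Y × Y} (hF : AnalyticAt 𝕜 F p.1)
    (hp : fderiv 𝕜 F p.1 (b p.2.1 p.2.2) ≠ 0) : AnalyticAt 𝕜 (rot b F) p := by
  have h1 : AnalyticAt 𝕜 (fun p : E × Y × Y => quad b p.2.1) p :=
    (analyticAt_quad _).comp (analyticAt_fst.comp analyticAt_snd)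
  have h2 : AnalyticAt 𝕜 (fun p : E × Y × Y => quad b p.2.2) p :=
    (analyticAt_quad _).comp (analyticAt_snd.comp analyticAt_snd)
  have h3 : AnalyticAt 𝕜 (fun p : E × Y × Y => b p.2.1 p.2.2) p :=
    (b.analyticAt_bilinear _).comp analyticAt_snd
  have h4 : AnalyticAt 𝕜 (fun p : E × Y × Y => fderiv 𝕜 F p.1) p :=
    hF.fderiv.comp_of_eq analyticAt_fst rfl
  have h5 : AnalyticAt 𝕜 (fun p : E × Y × Y => fderiv 𝕜 (fderiv 𝕜 F) p.1) p :=
    hF.fderiv.fderiv.comp_of_eq analyticAt_fst rfl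
  exact ((analyticAt_clm_apply (analyticAt_clm_apply h5 h2) h1).neg).div
    (analyticAt_clm_apply h4 h3) hp

/-- The germ at `0` of a map `Φ` to the hypersurface `F = 0` with `∂_i Φ = ½ b(η^i, η^i)`. -/
structure IsNet (b : Y →L[𝕜] Y →L[𝕜] E) (F : E → 𝕜) (Φ : (Fin n → 𝕜) → E)
    (η : Fin n → (Fin n → 𝕜) → Y) : Prop where
  analytic_map : AnalyticAt 𝕜 Φ 0
  analytic_vec : ∀ i, AnalyticAt 𝕜 (η i) 0
  pd_eq : ∀ᶠ R in 𝓝 0, ∀ i, pd i Φ R = quad b (η i R)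
  mem : ∀ᶠ R in 𝓝 0, F (Φ R) = 0

variable {Φ : (Fin n → 𝕜) → E} {η : Fin n → (Fin n → 𝕜) → Y}

theorem pd_quad_comp (hb : ∀ ξ η, b ξ η = b η ξ) {f : (Fin n → 𝕜) → Y} {R : Fin n → 𝕜} (j : Fin n)
    (hf : DifferentiableAt 𝕜 f R) : pd j (fun R => quad b (f R)) R = b (f R) (pd j f R) := by
  rw [pd_comp j (hasFDerivAt_quad hb _).differentiableAt hf, fderiv_quad hb]

/-- The derivative of the isotropy condition. -/
theorem pd_isotropic (hb : ∀ ξ η, b ξ η = b η ξ) [CompleteSpace E] {f : (Fin n → 𝕜) → Y}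
    {R : Fin n → 𝕜} (j : Fin n) (hF : AnalyticAt 𝕜 F (Φ R)) (hΦ : DifferentiableAt 𝕜 Φ R)
    (hf : DifferentiableAt 𝕜 f R) : pd j (fun R => fderiv 𝕜 F (Φ R) (quad b (f R))) R =
      fderiv 𝕜 (fderiv 𝕜 F) (Φ R) (pd j Φ R) (quad b (f R)) +
        fderiv 𝕜 F (Φ R) (b (f R) (pd j f R)) := by
  have h1 : DifferentiableAt 𝕜 (fun R => fderiv 𝕜 F (Φ R)) R :=
    hF.fderiv.differentiableAt.comp R hΦ
  have h2 : DifferentiableAt 𝕜 (fun R => quad b (f R)) R :=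
    ((hasFDerivAt_quad hb _).differentiableAt).comp R hf
  rw [pd_clm_apply j h1 h2, pd_quad_comp hb j hf, pd_comp j hF.fderiv.differentiableAt hΦ]
  ring

/-- The derivative of `β η^k`. -/
theorem pd_rot_smul {R : Fin n → 𝕜} (j : Fin n) {f g : (Fin n → 𝕜) → Y}
    (hrot : DifferentiableAt 𝕜 (rot b F) (Φ R, f R, g R)) (hΦ : DifferentiableAt 𝕜 Φ R)
    (hf : DifferentiableAt 𝕜 f R) (hg : DifferentiableAt 𝕜 g R) :
    pd j (fun R => rot b F (Φ R, f R, g R) • g R) R =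
      rot b F (Φ R, f R, g R) • pd j g R +
        fderiv 𝕜 (rot b F) (Φ R, f R, g R) (pd j Φ R, pd j f R, pd j g R) • g R := by
  have h1 : DifferentiableAt 𝕜 (fun R => (Φ R, f R, g R)) R := hΦ.prodMk (hf.prodMk hg)
  have h2 : DifferentiableAt 𝕜 (fun R => rot b F (Φ R, f R, g R)) R :=
    DifferentiableAt.comp (g := rot b F) R hrot h1
  rw [pd_smul j h2 hg, pd_comp j hrot h1, pd_prodMk j hΦ (hf.prodMk hg),
    pd_prodMk j hf hg]

namespace IsNet

variable [CompleteSpace E]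

/-- The coordinate lines stay in the hypersurface, so their velocities are annihilated by `dF`. -/
theorem isotropic (h : IsNet b F Φ η) (hF : AnalyticAt 𝕜 F (Φ 0)) :
    ∀ᶠ R in 𝓝 0, ∀ i, fderiv 𝕜 F (Φ R) (quad b (η i R)) = 0 := by
  have hΦt := h.analytic_map.continuousAt.tendsto
  filter_upwards [h.pd_eq, h.mem.eventually_nhds, hΦt.eventually hF.eventually_analyticAt,
    h.analytic_map.eventually_analyticAt] with R h1 h2 h3 h4 i
  rw [← h1 i, ← pd_comp i h3.differentiableAt h4.differentiableAt]
  have h5 : (fun R => F (Φ R)) =ᶠ[𝓝 R] fun _ => 0 := h2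
  rw [pd_congr i h5]
  simp [pd]

variable [CompleteSpace Y]

/-- Equality of the mixed derivatives of `Φ` reads `b(η_i, ∂_jη_i) = b(η_j, ∂_iη_j)`. By `hcancel`,
the derivative `∂_jη_i` is a multiple of `η_j`, and the derivative of the isotropy condition along
`R^j` determines the factor, since `dF(b(η_i, η_j))` is not zero. -/
theorem rotation (hb : ∀ ξ η, b ξ η = b η ξ) (h : IsNet b F Φ η) (hF : AnalyticAt 𝕜 F (Φ 0))
    (hcancel : ∀ ξ ζ v w, LinearIndependent 𝕜 ![ξ, ζ] → b ξ v = b ζ w →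
      ∃ c : 𝕜, v = c • ζ ∧ w = c • ξ)
    (hind : ∀ i j, i ≠ j → LinearIndependent 𝕜 ![η i 0, η j 0])
    (hne : ∀ i j, i ≠ j → fderiv 𝕜 F (Φ 0) (b (η i 0) (η j 0)) ≠ 0) :
    ∀ᶠ R in 𝓝 0, ∀ i j, i ≠ j → pd j (η i) R = rot b F (Φ R, η i R, η j R) • η j R := by
  refine eventually_all.2 fun i => eventually_all.2 fun j => ?_
  by_cases hij : i = j
  · exact Eventually.of_forall fun _ h => absurd hij h
  have hΦt := h.analytic_map.continuousAt.tendsto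
  have hηi := h.analytic_vec i
  have hηj := h.analytic_vec j
  have hne' : ∀ᶠ R in 𝓝 0, fderiv 𝕜 F (Φ R) (b (η i R) (η j R)) ≠ 0 := by
    have h1 : AnalyticAt 𝕜 (fun R => fderiv 𝕜 F (Φ R)) 0 :=
      hF.fderiv.comp_of_eq h.analytic_map rfl
    have h2 : AnalyticAt 𝕜 (fun R => b (η i R) (η j R)) 0 :=
      (b.analyticAt_bilinear _).comp_of_eq (hηi.prod hηj) rfl
    exact (analyticAt_clm_apply h1 h2).continuousAt.eventually_ne (hne i j hij)
  have hind' : ∀ᶠ R in 𝓝 0, LinearIndependent 𝕜 ![η i R, η j R] := by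
    have hc : ContinuousAt (fun R => ![η i R, η j R]) 0 := by
      rw [continuousAt_pi]
      intro k
      fin_cases k
      · exact hηi.continuousAt
      · exact hηj.continuousAt
    exact hc.eventually (isOpen_setOfPred_linearIndependent.mem_nhds (hind i j hij))
  filter_upwards [h.pd_eq.eventually_nhds, (h.isotropic hF).eventually_nhds, hne', hind',
    hΦt.eventually hF.eventually_analyticAt, h.analytic_map.eventually_analyticAt,
    hηi.eventually_analyticAt, hηj.eventually_analyticAt] with R h1 h2 h3 h4 h5 h6 h7 h8 _
  have e1 : pd j (pd i Φ) R = b (η i R) (pd j (η i) R) := by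
    rw [← pd_quad_comp hb j h7.differentiableAt]
    exact pd_congr j (h1.mono fun S hS => hS i)
  have e2 : pd i (pd j Φ) R = b (η j R) (pd i (η j) R) := by
    rw [← pd_quad_comp hb i h8.differentiableAt]
    exact pd_congr i (h1.mono fun S hS => hS j)
  rw [pd_pd_comm j i h6, e2] at e1
  obtain ⟨c, hc, -⟩ := hcancel _ _ _ _ h4 e1.symm
  have e3 := pd_isotropic hb j h5 h6.differentiableAt h7.differentiableAt
  have e4 : (fun R => fderiv 𝕜 F (Φ R) (quad b (η i R))) =ᶠ[𝓝 R] fun _ => 0 :=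
    h2.mono fun S hS => hS i
  rw [pd_congr j e4, h1.self_of_nhds j, hc, map_smul, map_smul] at e3
  have e5 := rot_mul _ _ h3
  have e6 : pd j (fun _ : Fin n → 𝕜 => (0 : 𝕜)) R = 0 := by simp [pd]
  rw [e6] at e3
  rw [hc]
  congr 1
  have e7 : (c - rot b F (Φ R, η i R, η j R)) * fderiv 𝕜 F (Φ R) (b (η i R) (η j R)) = 0 := by
    rw [smul_eq_mul] at e3
    linear_combination -e3 - e5
  exact sub_eq_zero.1 ((mul_eq_zero.1 e7).resolve_right h3)

/-- The rotation equations give two expressions for `∂_k∂_jη_i`, both combinations of the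
independent vectors `η_j` and `η_k`. Comparing the coefficients of `η_j` yields `∂_kβ_ij = β_ik
β_jk`, with the left side expanded by the chain rule. -/
theorem obstruction_eq_zero (hb : ∀ ξ η, b ξ η = b η ξ) (h : IsNet b F Φ η)
    (hF : AnalyticAt 𝕜 F (Φ 0))
    (hcancel : ∀ ξ ζ v w, LinearIndependent 𝕜 ![ξ, ζ] → b ξ v = b ζ w →
      ∃ c : 𝕜, v = c • ζ ∧ w = c • ξ)
    (hind : ∀ i j, i ≠ j → LinearIndependent 𝕜 ![η i 0, η j 0])
    (hne : ∀ i j, i ≠ j → fderiv 𝕜 F (Φ 0) (b (η i 0) (η j 0)) ≠ 0) {i j k : Fin n} (hij : i ≠ j)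
    (hik : i ≠ k) (hjk : j ≠ k) : obstruction b F (Φ 0) (η i 0) (η j 0) (η k 0) = 0 := by
  have hrot := h.rotation hb hF hcancel hind hne
  have key : ∀ {j k : Fin n}, i ≠ j → i ≠ k → j ≠ k → pd k (pd j (η i)) 0 =
      (obstruction b F (Φ 0) (η i 0) (η j 0) (η k 0) +
        rot b F (Φ 0, η i 0, η k 0) * rot b F (Φ 0, η j 0, η k 0)) • η j 0 +
      (rot b F (Φ 0, η i 0, η j 0) * rot b F (Φ 0, η j 0, η k 0)) • η k 0 := by
    intro j k hij hik hjk
    have e1 : pd j (η i) =ᶠ[𝓝 0] fun R => rot b F (Φ R, η i R, η j R) • η j R :=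
      hrot.mono fun R hR => hR i j hij
    rw [pd_congr k e1, pd_rot_smul k
      (analyticAt_rot (p := (Φ 0, η i 0, η j 0)) hF (hne i j hij)).differentiableAt
      h.analytic_map.differentiableAt (h.analytic_vec i).differentiableAt
      (h.analytic_vec j).differentiableAt, hrot.self_of_nhds i k hik,
      hrot.self_of_nhds j k hjk, h.pd_eq.self_of_nhds k, smul_smul, obstruction, sub_add_cancel,
      add_comm]
  have e := pd_pd_comm j k (h.analytic_vec i)
  rw [key hij hik hjk, key hik hij hjk.symm, rot_symm hb hF (η k 0) (η j 0)] at e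
  have hli := LinearIndependent.pair_iff.1 (hind j k hjk)
    (obstruction b F (Φ 0) (η i 0) (η j 0) (η k 0))
    (-obstruction b F (Φ 0) (η i 0) (η k 0) (η j 0)) (by
      linear_combination (norm := module) -e)
  exact hli.1

end IsNet

end Net

/-! ### Goursat data of nets -/

section Uniqueness

variable {E Y : Type*} [NormedAddCommGroup E] [NormedSpace 𝕜 E] [FiniteDimensional 𝕜 E]
  [NormedAddCommGroup Y] [NormedSpace 𝕜 Y] [FiniteDimensional 𝕜 Y] {n : ℕ}
  {b : Y →L[𝕜] Y →L[𝕜] E} {F : E → 𝕜} {s : E}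

theorem scaleOn_univ_zero (R : Fin n → 𝕜) : scaleOn Finset.univ 0 R = 0 := by
  funext k; simp [scaleOn]

theorem scaleOn_compl_zero (i : Fin n) (R : Fin n → 𝕜) :
    scaleOn {i}ᶜ 0 R = Pi.single i (R i) := by
  funext k
  by_cases h : k = i
  · subst h; simp [scaleOn]
  · simp [scaleOn, h]

theorem tendsto_single (i : Fin n) :
    Tendsto (fun t : 𝕜 => (Pi.single i t : Fin n → 𝕜)) (𝓝 0) (𝓝 0) := by
  have h : Continuous fun t : 𝕜 => (Pi.single i t : Fin n → 𝕜) :=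
    continuous_single (A := fun _ : Fin n => 𝕜) i
  simpa using h.tendsto 0

theorem tendsto_coord (i : Fin n) : Tendsto (fun R : Fin n → 𝕜 => R i) (𝓝 0) (𝓝 0) := by
  simpa using (continuous_apply i).tendsto (0 : Fin n → 𝕜)

/-- On the cone `dF_U(b(η, η)) = 0`, a vector `η` near `ξ` is an analytic function of `U` and of the
values of `θ` and `ψ`. -/
theorem exists_cone_coordinates (hY : Module.finrank 𝕜 Y = 3) (hb : ∀ ξ η, b ξ η = b η ξ)
    (hF : AnalyticAt 𝕜 F s) {ξ : Y} {θ ψ : Y →L[𝕜] 𝕜}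
    (hξ : fderiv 𝕜 F s (quad b ξ) = 0)
    (hloc : ∀ v, θ v = 0 → ψ v = 0 → fderiv 𝕜 F s (b ξ v) = 0 → v = 0) :
    ∃ g : E × 𝕜 × 𝕜 → Y, AnalyticAt 𝕜 g (s, θ ξ, ψ ξ) ∧ g (s, θ ξ, ψ ξ) = ξ ∧
      (∀ᶠ q in 𝓝 (s, θ ξ, ψ ξ), fderiv 𝕜 F q.1 (quad b (g q)) = 0 ∧ θ (g q) = q.2.1 ∧
        ψ (g q) = q.2.2) ∧
      ∀ᶠ q in 𝓝 (s, ξ), fderiv 𝕜 F q.1 (quad b q.2) = 0 → g (q.1, θ q.2, ψ q.2) = q.2 := by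
  have : CompleteSpace E := FiniteDimensional.complete 𝕜 E
  -- The vector `η` is traded for three scalars, the value of the quadratic form and those of `θ`
  -- and `ψ`. The hypothesis `hloc` is exactly injectivity of the derivative in `η`, and `dim Y = 3`
  -- makes the dimensions match. The cone is the slice where the first scalar is zero.
  set Q : E × Y → E × 𝕜 × 𝕜 × 𝕜 := fun q =>
    (q.1, fderiv 𝕜 F q.1 (quad b q.2), θ q.2, ψ q.2) with hQ
  have h1 : HasFDerivAt (fun q : E × Y => fderiv 𝕜 F q.1) _ (s, ξ) :=
    HasFDerivAt.comp (s, ξ) hF.fderiv.differentiableAt.hasFDerivAt hasFDerivAt_fst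
  have h2 : HasFDerivAt (fun q : E × Y => quad b q.2) _ (s, ξ) :=
    HasFDerivAt.comp (g := quad b) (f := Prod.snd) (s, ξ) (hasFDerivAt_quad hb ξ) hasFDerivAt_snd
  have hQd : HasFDerivAt Q _ (s, ξ) :=
    hasFDerivAt_fst.prodMk ((h1.clm_apply h2).prodMk
      ((θ.hasFDerivAt.comp (s, ξ) hasFDerivAt_snd).prodMk
        (ψ.hasFDerivAt.comp (s, ξ) hasFDerivAt_snd)))
  have hQa : AnalyticAt 𝕜 Q (s, ξ) :=
    analyticAt_fst.prod ((analyticAt_clm_apply (hF.fderiv.comp_of_eq analyticAt_fst rfl)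
      ((analyticAt_quad ξ).comp_of_eq analyticAt_snd rfl)).prod
      (((θ.analyticAt _).comp analyticAt_snd).prod ((ψ.analyticAt _).comp analyticAt_snd)))
  have hdim : Module.finrank 𝕜 (E × Y) = Module.finrank 𝕜 (E × 𝕜 × 𝕜 × 𝕜) := by
    simp [Module.finrank_prod, hY]
  obtain ⟨G, hG, hG0, hr, hl⟩ := exists_analytic_inverse_of_injective hQa hdim (by
    intro v hv
    rw [hQd.fderiv] at hv
    have e1 : v.1 = 0 := congrArg Prod.fst hv
    have e2 : fderiv 𝕜 F s (b ξ v.2) + fderiv 𝕜 (fderiv 𝕜 F) s v.1 (quad b ξ) = 0 :=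
      congrArg (fun q => q.2.1) hv
    have e3 : θ v.2 = 0 := congrArg (fun q => q.2.2.1) hv
    have e4 : ψ v.2 = 0 := congrArg (fun q => q.2.2.2) hv
    rw [e1, map_zero] at e2
    exact Prod.ext e1 (hloc _ e3 e4 (by simpa using e2)))
  have hQ0 : Q (s, ξ) = (s, 0, θ ξ, ψ ξ) := by simp only [Q, hξ]
  rw [hQ0] at hG hG0 hr
  have hin : AnalyticAt 𝕜 (fun q : E × 𝕜 × 𝕜 => (q.1, (0 : 𝕜), q.2.1, q.2.2)) (s, θ ξ, ψ ξ) :=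
    analyticAt_fst.prod (analyticAt_const.prod ((analyticAt_fst.comp analyticAt_snd).prod
      (analyticAt_snd.comp analyticAt_snd)))
  refine ⟨fun q => (G (q.1, 0, q.2.1, q.2.2)).2, ?_, by simp [hG0], ?_, ?_⟩
  · exact analyticAt_snd.comp (hG.comp_of_eq hin rfl)
  · filter_upwards [hin.continuousAt.tendsto.eventually hr] with q hq
    have e1 : (G (q.1, 0, q.2.1, q.2.2)).1 = q.1 := congrArg Prod.fst hq
    have e2 := congrArg (fun q => q.2.1) hq
    simp only [Q, e1] at e2
    exact ⟨e2, congrArg (fun q => q.2.2.1) hq, congrArg (fun q => q.2.2.2) hq⟩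
  · filter_upwards [hl] with q hq h0
    simp only [Q, h0] at hq
    simp [hq]

/-- The total difference `N` of the two nets is small relative to itself. The partial derivatives of
`Φ`, and those of `η i` transversal to the `i`-th axis, are analytic functions of the unknowns, so
their differences are `O(N)`, and integration along rays gains a factor of the radius. On the `i`-th
axis itself there is no equation for `η i`. There it is a function of `Φ` and of the common data. -/
theorem IsNet.eq_of_goursat (hY : Module.finrank 𝕜 Y = 3) (hb : ∀ ξ η, b ξ η = b η ξ)
    (hcancel : ∀ ξ ζ v w, LinearIndependent 𝕜 ![ξ, ζ] → b ξ v = b ζ w →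
      ∃ c : 𝕜, v = c • ζ ∧ w = c • ξ)
    (hF : AnalyticAt 𝕜 F s) {ξ : Fin n → Y} {θ ψ : Fin n → Y →L[𝕜] 𝕜}
    (hloc : ∀ i v, θ i v = 0 → ψ i v = 0 → fderiv 𝕜 F s (b (ξ i) v) = 0 → v = 0)
    (hind : ∀ i j, i ≠ j → LinearIndependent 𝕜 ![ξ i, ξ j])
    (hne : ∀ i j, i ≠ j → fderiv 𝕜 F s (b (ξ i) (ξ j)) ≠ 0)
    {Φ Φ' : (Fin n → 𝕜) → E} {η η' : Fin n → (Fin n → 𝕜) → Y}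
    (h : IsNet b F Φ η) (h' : IsNet b F Φ' η') (h0 : Φ 0 = s) (h0' : Φ' 0 = s)
    (hη0 : ∀ i, η i 0 = ξ i) (hη0' : ∀ i, η' i 0 = ξ i)
    (hax : ∀ i, ∀ᶠ t in 𝓝 (0 : 𝕜), θ i (η i (Pi.single i t)) = θ i (η' i (Pi.single i t)) ∧
      ψ i (η i (Pi.single i t)) = ψ i (η' i (Pi.single i t))) :
    ∀ᶠ R in 𝓝 0, Φ R = Φ' R ∧ ∀ i, η i R = η' i R := by
  have : CompleteSpace E := FiniteDimensional.complete 𝕜 E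
  have : CompleteSpace Y := FiniteDimensional.complete 𝕜 Y
  have hrot := h.rotation hb (h0 ▸ hF) hcancel (by simpa only [hη0] using hind)
    (by simpa only [hη0, h0] using hne)
  have hrot' := h'.rotation hb (h0' ▸ hF) hcancel (by simpa only [hη0'] using hind)
    (by simpa only [hη0', h0'] using hne)
  have tΦ := tendsto_of_analyticAt h.analytic_map h0
  have tΦ' := tendsto_of_analyticAt h'.analytic_map h0'
  have tη := fun i => tendsto_of_analyticAt (h.analytic_vec i) (hη0 i)
  have tη' := fun i => tendsto_of_analyticAt (h'.analytic_vec i) (hη0' i)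
  set N : (Fin n → 𝕜) → ℝ := fun R => ‖Φ R - Φ' R‖ + ∑ i, ‖η i R - η' i R‖ with hN
  have hN0 : ∀ R, 0 ≤ N R := fun R => by positivity
  have hΦN : (fun R => Φ R - Φ' R) =O[𝓝 0] N := Asymptotics.isBigO_of_le _ fun R => by
    rw [Real.norm_of_nonneg (hN0 R)]
    exact le_add_of_nonneg_right (by positivity)
  have hηN : ∀ i, (fun R => η i R - η' i R) =O[𝓝 0] N := fun i =>
    Asymptotics.isBigO_of_le _ fun R => by
      rw [Real.norm_of_nonneg (hN0 R)]
      exact (Finset.single_le_sum (f := fun i => ‖η i R - η' i R‖) (fun _ _ => norm_nonneg _)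
        (Finset.mem_univ i)).trans (le_add_of_nonneg_left (norm_nonneg _))
  have hd : ∀ᶠ R in 𝓝 0, DifferentiableAt 𝕜 (fun R => Φ R - Φ' R) R :=
    (h.analytic_map.sub h'.analytic_map).eventually_analyticAt.mono fun R hR => hR.differentiableAt
  have hdη : ∀ i, ∀ᶠ R in 𝓝 0, DifferentiableAt 𝕜 (fun R => η i R - η' i R) R := fun i =>
    ((h.analytic_vec i).sub (h'.analytic_vec i)).eventually_analyticAt.mono
      fun R hR => hR.differentiableAt
  have sΦ : SmallRel N (fun R => Φ R - Φ' R) := by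
    refine smallRel_of_pd hN0 Finset.univ hd (fun k _ => ?_)
      (Eventually.of_forall fun R => by rw [scaleOn_univ_zero, h0, h0', sub_self])
    have e : pd k (fun R => Φ R - Φ' R) =ᶠ[𝓝 0] fun R => quad b (η k R) - quad b (η' k R) := by
      filter_upwards [h.pd_eq, h'.pd_eq, h.analytic_map.eventually_analyticAt,
        h'.analytic_map.eventually_analyticAt] with R h1 h2 h3 h4
      rw [pd_sub k h3.differentiableAt h4.differentiableAt, h1, h2]
    exact e.trans_isBigO ((isBigO_comp_sub (analyticAt_quad (ξ k)) (tη k) (tη' k)).trans (hηN k))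
  have sη : ∀ i, SmallRel N (fun R => η i R - η' i R) := by
    intro i
    have s1 : SmallRel N (fun R => (η i R - η' i R) -
        (η i (scaleOn {i}ᶜ 0 R) - η' i (scaleOn {i}ᶜ 0 R))) := by
      refine smallRel_sub_scaleOn hN0 {i}ᶜ (hdη i) fun k hk => ?_
      have hik : i ≠ k := fun h => by simp [h] at hk
      have e : pd k (fun R => η i R - η' i R) =ᶠ[𝓝 0] fun R =>
          (fun p : E × Y × Y => rot b F p • p.2.2) (Φ R, η i R, η k R) -
          (fun p : E × Y × Y => rot b F p • p.2.2) (Φ' R, η' i R, η' k R) := by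
        filter_upwards [hrot, hrot', (h.analytic_vec i).eventually_analyticAt,
          (h'.analytic_vec i).eventually_analyticAt] with R h1 h2 h3 h4
        rw [pd_sub k h3.differentiableAt h4.differentiableAt, h1 i k hik, h2 i k hik]
      have ha : AnalyticAt 𝕜 (fun p : E × Y × Y => rot b F p • p.2.2) (s, ξ i, ξ k) :=
        (analyticAt_rot (p := (s, ξ i, ξ k)) hF (hne i k hik)).smul
          (analyticAt_snd.comp analyticAt_snd)
      refine e.trans_isBigO ((isBigO_comp_sub ha (tΦ.prodMk_nhds ((tη i).prodMk_nhds (tη k)))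
        (tΦ'.prodMk_nhds ((tη' i).prodMk_nhds (tη' k)))).trans ?_)
      exact hΦN.prod_left ((hηN i).prod_left (hηN k))
    -- On the axis both vectors come from the same cone coordinates `g` with equal values of `θ` and
    -- `ψ`. They can differ only through the base points, whose difference is already known to be
    -- small.
    have s2 : SmallRel N (fun R => η i (scaleOn {i}ᶜ 0 R) - η' i (scaleOn {i}ᶜ 0 R)) := by
      refine (sΦ.comp_scaleOn {i}ᶜ (c := (0 : 𝕜)) (by simp)).of_isBigO ?_
      have hiso : fderiv 𝕜 F s (quad b (ξ i)) = 0 := by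
        have := (h.isotropic (h0 ▸ hF)).self_of_nhds i
        rwa [h0, hη0] at this
      obtain ⟨g, hg, hg0, -, hgl⟩ := exists_cone_coordinates hY hb hF hiso (hloc i)
      have ax : ∀ t : 𝕜, scaleOn {i}ᶜ 0 (Pi.single i t) = (Pi.single i t : Fin n → 𝕜) := fun t => by
        rw [scaleOn_compl_zero, Pi.single_eq_same]
      have tt : Tendsto (fun R : Fin n → 𝕜 => scaleOn {i}ᶜ (0 : 𝕜) R) (𝓝 0) (𝓝 0) := by
        simp only [scaleOn_compl_zero]
        exact (tendsto_single i).comp (tendsto_coord i)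
      have e1 : ∀ᶠ R in 𝓝 (0 : Fin n → 𝕜),
          g (Φ (scaleOn {i}ᶜ 0 R), θ i (η i (scaleOn {i}ᶜ 0 R)), ψ i (η i (scaleOn {i}ᶜ 0 R))) =
            η i (scaleOn {i}ᶜ 0 R) := by
        have := (tΦ.prodMk_nhds (tη i)).eventually hgl
        filter_upwards [tt.eventually this, tt.eventually (h.isotropic (h0 ▸ hF))] with R h1 h2
        exact h1 (h2 i)
      have e2 : ∀ᶠ R in 𝓝 (0 : Fin n → 𝕜),
          g (Φ' (scaleOn {i}ᶜ 0 R), θ i (η i (scaleOn {i}ᶜ 0 R)), ψ i (η i (scaleOn {i}ᶜ 0 R))) =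
            η' i (scaleOn {i}ᶜ 0 R) := by
        have := (tΦ'.prodMk_nhds (tη' i)).eventually hgl
        filter_upwards [tt.eventually this, tt.eventually (h'.isotropic (h0' ▸ hF)),
          (tendsto_coord i).eventually (hax i)] with R h1 h2 h3
        rw [← scaleOn_compl_zero] at h3
        rw [h3.1, h3.2]
        exact h1 (h2 i)
      have tq : Tendsto (fun R => (θ i (η i R), ψ i (η i R))) (𝓝 0) (𝓝 (θ i (ξ i), ψ i (ξ i))) :=
        (((θ i).continuous.tendsto _).comp (tη i)).prodMk_nhds
          (((ψ i).continuous.tendsto _).comp (tη i))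
      have e3 : (fun R : Fin n → 𝕜 => η i (scaleOn {i}ᶜ 0 R) - η' i (scaleOn {i}ᶜ 0 R)) =ᶠ[𝓝 0]
          fun R => g (Φ (scaleOn {i}ᶜ 0 R), θ i (η i (scaleOn {i}ᶜ 0 R)),
            ψ i (η i (scaleOn {i}ᶜ 0 R))) - g (Φ' (scaleOn {i}ᶜ 0 R),
            θ i (η i (scaleOn {i}ᶜ 0 R)), ψ i (η i (scaleOn {i}ᶜ 0 R))) := by
        filter_upwards [e1, e2] with R h1 h2
        rw [h1, h2]
      refine e3.trans_isBigO ((isBigO_comp_sub hg ((tΦ.prodMk_nhds tq).comp tt)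
        ((tΦ'.prodMk_nhds tq).comp tt)).trans ?_)
      exact Asymptotics.isBigO_of_le _ fun R => by simp [Prod.norm_def]
    simpa using s1.add s2
  have sN : SmallRel N N := sΦ.norm.add (SmallRel.sum Finset.univ fun i _ => (sη i).norm)
  have hbd : ∃ B, ∀ᶠ R in 𝓝 0, N R ≤ B := by
    have hc : ContinuousAt N 0 :=
      ((h.analytic_map.continuousAt.sub h'.analytic_map.continuousAt).norm).add
        (tendsto_finsetSum _ fun i _ =>
          ((h.analytic_vec i).continuousAt.sub (h'.analytic_vec i).continuousAt).norm)
    exact ⟨N 0 + 1, hc.eventually_le_const (lt_add_one _)⟩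
  filter_upwards [SmallRel.eventually_eq_zero hN0 hbd sN] with R hR
  have h1 : ‖Φ R - Φ' R‖ = 0 ∧ ∑ i, ‖η i R - η' i R‖ = 0 :=
    (add_eq_zero_iff_of_nonneg (norm_nonneg _) (by positivity)).1 hR
  refine ⟨sub_eq_zero.1 (norm_eq_zero.1 h1.1), fun i => ?_⟩
  exact sub_eq_zero.1 (norm_eq_zero.1
    ((Finset.sum_eq_zero_iff_of_nonneg fun _ _ => norm_nonneg _).1 h1.2 i (Finset.mem_univ i)))

end Uniqueness

/-! ### The Goursat problem for nets -/

section Estimates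

variable {V W : Type*} [NormedAddCommGroup V] [NormedSpace 𝕜 V] [NormedAddCommGroup W]
  [NormedSpace 𝕜 W] {X : Type*} [TopologicalSpace X] {x : X} {N : X → ℝ}

theorem isBigO_clm_apply {A : X → V →L[𝕜] W} {f : X → V} (hA : ContinuousAt A x)
    (hf : f =O[𝓝 x] N) : (fun R => A R (f R)) =O[𝓝 x] N := by
  have h1 : (fun R => A R (f R)) =O[𝓝 x] fun R => ‖A R‖ * ‖f R‖ :=
    Asymptotics.IsBigO.of_bound 1 (Eventually.of_forall fun R => by
      simpa using (A R).le_opNorm (f R))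
  have h2 : (fun R => ‖A R‖) =O[𝓝 x] fun _ => (1 : ℝ) := hA.norm.tendsto.isBigO_one ℝ
  simpa using h1.trans (h2.mul hf.norm_left)

theorem isBigO_smul_left {c : X → 𝕜} {f : X → V} (hc : ContinuousAt c x)
    (hf : f =O[𝓝 x] N) : (fun R => c R • f R) =O[𝓝 x] N := by
  have h2 : c =O[𝓝 x] fun _ => (1 : ℝ) := hc.tendsto.isBigO_one ℝ
  simpa using h2.smul hf

theorem isBigO_smul_right {c : X → 𝕜} {f : X → V} (hf : ContinuousAt f x)
    (hc : c =O[𝓝 x] N) : (fun R => c R • f R) =O[𝓝 x] N := by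
  have h2 : f =O[𝓝 x] fun _ => (1 : ℝ) := hf.tendsto.isBigO_one ℝ
  simpa using hc.smul h2

end Estimates

theorem analyticAt_obstruction {E Y : Type*} [NormedAddCommGroup E] [NormedSpace 𝕜 E]
    [CompleteSpace E] [NormedAddCommGroup Y] [NormedSpace 𝕜 Y] {b : Y →L[𝕜] Y →L[𝕜] E} {F : E → 𝕜}
    {X : Type*} [NormedAddCommGroup X]
    [NormedSpace 𝕜 X] {x : X} {u : X → E} {f g k : X → Y} (hF : AnalyticAt 𝕜 F (u x))
    (hu : AnalyticAt 𝕜 u x) (hf : AnalyticAt 𝕜 f x) (hg : AnalyticAt 𝕜 g x)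
    (hk : AnalyticAt 𝕜 k x) (hfg : fderiv 𝕜 F (u x) (b (f x) (g x)) ≠ 0)
    (hfk : fderiv 𝕜 F (u x) (b (f x) (k x)) ≠ 0) (hgk : fderiv 𝕜 F (u x) (b (g x) (k x)) ≠ 0) :
    AnalyticAt 𝕜 (fun y => obstruction b F (u y) (f y) (g y) (k y)) x := by
  have h1 : AnalyticAt 𝕜 (fun y => rot b F (u y, f y, g y)) x :=
    (analyticAt_rot (p := (u x, f x, g x)) hF hfg).comp_of_eq (hu.prod (hf.prod hg)) rfl
  have h2 : AnalyticAt 𝕜 (fun y => rot b F (u y, f y, k y)) x :=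
    (analyticAt_rot (p := (u x, f x, k x)) hF hfk).comp_of_eq (hu.prod (hf.prod hk)) rfl
  have h3 : AnalyticAt 𝕜 (fun y => rot b F (u y, g y, k y)) x :=
    (analyticAt_rot (p := (u x, g x, k x)) hF hgk).comp_of_eq (hu.prod (hg.prod hk)) rfl
  have h4 : AnalyticAt 𝕜 (fun y => fderiv 𝕜 (rot b F) (u y, f y, g y)) x :=
    ((analyticAt_rot (p := (u x, f x, g x)) hF hfg).fderiv).comp_of_eq (hu.prod (hf.prod hg)) rfl
  have h5 : AnalyticAt 𝕜 (fun y => quad b (k y)) x := (analyticAt_quad _).comp_of_eq hk rfl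
  exact (analyticAt_clm_apply h4 (h5.prod ((h2.fun_smul hk).prod (h3.fun_smul hk)))).sub
    (h2.mul h3)

/-! ### The obstruction off the hypersurface -/

section Existence

variable {E Y : Type*} [NormedAddCommGroup E] [NormedSpace 𝕜 E] [FiniteDimensional 𝕜 E]
  [NormedAddCommGroup Y] [NormedSpace 𝕜 Y] [FiniteDimensional 𝕜 Y] {n : ℕ}
  {b : Y →L[𝕜] Y →L[𝕜] E} {F : E → 𝕜} {s : E}

/-- On the hypersurface, with isotropic `η^i`, the obstruction vanishes; elsewhere it is estimated
by the equations. -/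
theorem obstruction_isBigO (hb : ∀ ξ η, b ξ η = b η ξ) (hF : AnalyticAt 𝕜 F s) (hFs : F s = 0)
    {ξ : Fin n → Y} (hξ : ∀ i, fderiv 𝕜 F s (quad b (ξ i)) = 0)
    (hne : ∀ i j, i ≠ j → fderiv 𝕜 F s (b (ξ i) (ξ j)) ≠ 0)
    (hsub : ∃ V, fderiv 𝕜 F s V ≠ 0) (hpol : ∀ i, ∃ v, fderiv 𝕜 F s (b (ξ i) v) ≠ 0)
    (hobs : ∀ᶠ p : E × (Fin n → Y) in 𝓝 (s, ξ), F p.1 = 0 →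
      (∀ i, fderiv 𝕜 F p.1 (quad b (p.2 i)) = 0) → ∀ i j k, i ≠ j → i ≠ k → j ≠ k →
        obstruction b F p.1 (p.2 i) (p.2 j) (p.2 k) = 0)
    {i j k : Fin n} (hij : i ≠ j) (hik : i ≠ k) (hjk : j ≠ k) :
    (fun p : E × (Fin n → Y) => obstruction b F p.1 (p.2 i) (p.2 j) (p.2 k)) =O[𝓝 (s, ξ)]
      fun p => (F p.1, fun i => fderiv 𝕜 F p.1 (quad b (p.2 i))) := by
  have : CompleteSpace E := FiniteDimensional.complete 𝕜 E
  have hproj : ∀ i, AnalyticAt 𝕜 (fun p : E × (Fin n → Y) => p.2 i) (s, ξ) := fun i =>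
    ((ContinuousLinearMap.proj (R := 𝕜) (φ := fun _ : Fin n => Y) i).analyticAt _).comp
      analyticAt_snd
  have hq : ∀ i, AnalyticAt 𝕜 (fun p : E × (Fin n → Y) => fderiv 𝕜 F p.1 (quad b (p.2 i)))
      (s, ξ) := fun i =>
    analyticAt_clm_apply (hF.fderiv.comp_of_eq analyticAt_fst rfl)
      ((analyticAt_quad _).comp_of_eq (hproj i) rfl)
  refine isBigO_of_eq_zero ((hF.comp_of_eq analyticAt_fst rfl).prod
    (analyticAt_pi_iff.2 hq)) (analyticAt_obstruction hF analyticAt_fst (hproj i) (hproj j)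
      (hproj k) (hne i j hij) (hne i k hik) (hne j k hjk)) ?_ ?_ ?_
  · exact Prod.ext hFs (funext hξ)
  · rintro ⟨z, y⟩
    have d0 : HasFDerivAt (fun p : E × (Fin n → Y) => F p.1) _ (s, ξ) :=
      HasFDerivAt.comp (g := F) (f := Prod.fst) (s, ξ) hF.differentiableAt.hasFDerivAt
        hasFDerivAt_fst
    have d1 : HasFDerivAt (fun p : E × (Fin n → Y) => fderiv 𝕜 F p.1) _ (s, ξ) :=
      HasFDerivAt.comp (g := fderiv 𝕜 F) (f := Prod.fst) (s, ξ)
        hF.fderiv.differentiableAt.hasFDerivAt hasFDerivAt_fst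
    have d2 : ∀ i, HasFDerivAt (fun p : E × (Fin n → Y) => quad b (p.2 i))
        ((b (ξ i)).comp ((ContinuousLinearMap.proj i).comp (ContinuousLinearMap.snd 𝕜 E _)))
        (s, ξ) := fun i =>
      HasFDerivAt.comp (g := quad b) (f := fun p : E × (Fin n → Y) => p.2 i) (s, ξ)
        (hasFDerivAt_quad hb (ξ i))
        ((ContinuousLinearMap.proj (R := 𝕜) (φ := fun _ : Fin n => Y) i).hasFDerivAt.comp (s, ξ)
          hasFDerivAt_snd)
    have d3 : HasFDerivAt (fun p : E × (Fin n → Y) =>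
        fun i => fderiv 𝕜 F p.1 (quad b (p.2 i))) _ (s, ξ) :=
      hasFDerivAt_pi.2 fun i => d1.clm_apply (d2 i)
    rw [(d0.prodMk d3).fderiv]
    obtain ⟨V, hV⟩ := hsub
    choose v hv using hpol
    -- The equations have maximal rank: `V'` adjusts the value of `F`, and then each isotropy
    -- condition is corrected separately by moving its own vector along `v i`.
    set V' := (z / fderiv 𝕜 F s V) • V
    refine ⟨(V', fun i => ((y i - fderiv 𝕜 (fderiv 𝕜 F) s V' (quad b (ξ i))) /
      fderiv 𝕜 F s (b (ξ i) (v i))) • v i), Prod.ext ?_ (funext fun i => ?_)⟩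
    · change fderiv 𝕜 F s V' = z
      rw [map_smul, smul_eq_mul, div_mul_cancel₀ _ hV]
    · change fderiv 𝕜 F s (b (ξ i) ((_ : 𝕜) • v i)) +
        fderiv 𝕜 (fderiv 𝕜 F) s V' (quad b (ξ i)) = y i
      rw [map_smul, map_smul, smul_eq_mul, div_mul_cancel₀ _ (hv i)]
      ring
  · filter_upwards [hobs] with p hp h0
    exact hp (congrArg Prod.fst h0) (fun i => congrFun (congrArg Prod.snd h0) i) i j k hij hik hjk

end Existence

/-! ### From the radial equations to the full system -/

section Existence

variable {E Y : Type*} [NormedAddCommGroup E] [NormedSpace 𝕜 E] [FiniteDimensional 𝕜 E]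
  [NormedAddCommGroup Y] [NormedSpace 𝕜 Y] [FiniteDimensional 𝕜 Y] {n : ℕ}
  {b : Y →L[𝕜] Y →L[𝕜] E} {F : E → 𝕜} {s : E}

/-- A solution of the radial equations with isotropic data on the coordinate axes is a net. -/
theorem isNet_of_radial (hb : ∀ ξ η, b ξ η = b η ξ) (hF : AnalyticAt 𝕜 F s) (hFs : F s = 0)
    {ξ : Fin n → Y} (hξ : ∀ i, fderiv 𝕜 F s (quad b (ξ i)) = 0)
    (hne : ∀ i j, i ≠ j → fderiv 𝕜 F s (b (ξ i) (ξ j)) ≠ 0)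
    (hsub : ∃ V, fderiv 𝕜 F s V ≠ 0) (hpol : ∀ i, ∃ v, fderiv 𝕜 F s (b (ξ i) v) ≠ 0)
    (hobs : ∀ᶠ p : E × (Fin n → Y) in 𝓝 (s, ξ), F p.1 = 0 →
      (∀ i, fderiv 𝕜 F p.1 (quad b (p.2 i)) = 0) → ∀ i j k, i ≠ j → i ≠ k → j ≠ k →
        obstruction b F p.1 (p.2 i) (p.2 j) (p.2 k) = 0)
    {Φ : (Fin n → 𝕜) → E} {η : Fin n → (Fin n → 𝕜) → Y} (hΦ : AnalyticAt 𝕜 Φ 0)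
    (hη : ∀ i, AnalyticAt 𝕜 (η i) 0) (hΦ0 : Φ 0 = s) (hη0 : ∀ i, η i 0 = ξ i)
    (hradΦ : ∀ᶠ R in 𝓝 0, ∑ k, R k • (pd k Φ R - quad b (η k R)) = 0)
    (hradη : ∀ᶠ R in 𝓝 0, ∀ i, ∑ k ∈ {i}ᶜ,
      R k • (pd k (η i) R - rot b F (Φ R, η i R, η k R) • η k R) = 0)
    (hax : ∀ i, ∀ᶠ t in 𝓝 (0 : 𝕜),
      fderiv 𝕜 F (Φ (Pi.single i t)) (quad b (η i (Pi.single i t))) = 0) :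
    IsNet b F Φ η := by
  have : CompleteSpace E := FiniteDimensional.complete 𝕜 E
  have : CompleteSpace Y := FiniteDimensional.complete 𝕜 Y
  subst hΦ0
  obtain rfl : (fun i => η i 0) = ξ := funext hη0
  have hDF : AnalyticAt 𝕜 (fun R => fderiv 𝕜 F (Φ R)) 0 := hF.fderiv.comp_of_eq hΦ rfl
  have hq : ∀ i, AnalyticAt 𝕜 (fun R => quad b (η i R)) 0 := fun i =>
    (analyticAt_quad _).comp_of_eq (hη i) rfl
  have hrotp : ∀ i j, i ≠ j → AnalyticAt 𝕜 (rot b F) (Φ 0, η i 0, η j 0) := fun i j hij =>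
    analyticAt_rot (p := (Φ 0, η i 0, η j 0)) hF (hne i j hij)
  have hpt : ∀ i j, AnalyticAt 𝕜 (fun R => (Φ R, η i R, η j R)) 0 := fun i j =>
    hΦ.prod ((hη i).prod (hη j))
  have hrot : ∀ i j, i ≠ j → AnalyticAt 𝕜 (fun R => rot b F (Φ R, η i R, η j R)) 0 :=
    fun i j hij => (hrotp i j hij).comp_of_eq (hpt i j) rfl
  -- the error terms
  set e : Fin n → (Fin n → 𝕜) → E := fun k R => pd k Φ R - quad b (η k R) with he
  set d : Fin n → Fin n → (Fin n → 𝕜) → Y := fun i k R =>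
    if i = k then 0 else pd k (η i) R - rot b F (Φ R, η i R, η k R) • η k R with hd
  set q : Fin n → (Fin n → 𝕜) → 𝕜 := fun i R => fderiv 𝕜 F (Φ R) (quad b (η i R)) with hqdef
  have hdne : ∀ i k, i ≠ k → d i k = fun R =>
      pd k (η i) R - rot b F (Φ R, η i R, η k R) • η k R := fun i k hik => by
    funext R; simp only [hd, hik, if_false]
  have ae : ∀ k, AnalyticAt 𝕜 (e k) 0 := fun k => (analyticAt_pd k hΦ).sub (hq k)
  have ad : ∀ i k, AnalyticAt 𝕜 (d i k) 0 := fun i k => by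
    by_cases hik : i = k
    · have : d i k = fun _ => 0 := by funext R; simp only [hd, hik, if_true]
      rw [this]; exact analyticAt_const
    · rw [hdne i k hik]
      exact (analyticAt_pd k (hη i)).sub ((hrot i k hik).fun_smul (hη k))
  have aF : AnalyticAt 𝕜 (fun R => F (Φ R)) 0 := hF.comp_of_eq hΦ rfl
  have aq : ∀ i, AnalyticAt 𝕜 (q i) 0 := fun i => analyticAt_clm_apply hDF (hq i)
  -- Each error is to be small relative to their total `N`. For `e` and `d` this follows from the
  -- radial equations and bounds on curls; for `F ∘ Φ` and `q` from partial derivatives together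
  -- with vanishing at the origin or on an axis. The obstruction is controlled only through `F ∘ Φ`
  -- and `q`, so all the errors have to be treated at once.
  set N : (Fin n → 𝕜) → ℝ := fun R => (∑ k, ‖e k R‖) + (∑ i, ∑ k, ‖d i k R‖) + ‖F (Φ R)‖ +
    ∑ i, ‖q i R‖ with hN
  have hN0 : ∀ R, 0 ≤ N R := fun R => by positivity
  have p1 : ∀ R, 0 ≤ ∑ k, ‖e k R‖ := fun R => by positivity
  have p2 : ∀ R, 0 ≤ ∑ i, ∑ k, ‖d i k R‖ := fun R => by positivity
  have p3 : ∀ R, 0 ≤ ∑ i, ‖q i R‖ := fun R => by positivity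
  have eN : ∀ k, e k =O[𝓝 0] N := fun k => Asymptotics.isBigO_of_le _ fun R => by
    rw [Real.norm_of_nonneg (hN0 R)]
    have := Finset.single_le_sum (f := fun k => ‖e k R‖) (fun _ _ => norm_nonneg _)
      (Finset.mem_univ k)
    simp only [hN]
    linarith [p2 R, p3 R, norm_nonneg (F (Φ R))]
  have dN : ∀ i k, d i k =O[𝓝 0] N := fun i k => Asymptotics.isBigO_of_le _ fun R => by
    rw [Real.norm_of_nonneg (hN0 R)]
    have h1 := Finset.single_le_sum (f := fun k => ‖d i k R‖) (fun _ _ => norm_nonneg _)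
      (Finset.mem_univ k)
    have h2 := Finset.single_le_sum (f := fun i => ∑ k, ‖d i k R‖)
      (fun _ _ => Finset.sum_nonneg fun _ _ => norm_nonneg _) (Finset.mem_univ i)
    simp only [hN]
    linarith [p1 R, p3 R, norm_nonneg (F (Φ R))]
  have qN : ∀ i, q i =O[𝓝 0] N := fun i => Asymptotics.isBigO_of_le _ fun R => by
    rw [Real.norm_of_nonneg (hN0 R)]
    have := Finset.single_le_sum (f := fun k => ‖q k R‖) (fun _ _ => norm_nonneg _)
      (Finset.mem_univ i)
    simp only [hN]
    linarith [p1 R, p2 R, norm_nonneg (F (Φ R))]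
  have FN : (fun R => F (Φ R)) =O[𝓝 0] N := Asymptotics.isBigO_of_le _ fun R => by
    rw [Real.norm_of_nonneg (hN0 R)]
    simp only [hN]
    linarith [p1 R, p2 R, p3 R]
  have tp : Tendsto (fun R => (Φ R, fun i => η i R)) (𝓝 0) (𝓝 (Φ 0, fun i => η i 0)) :=
    hΦ.continuousAt.tendsto.prodMk_nhds (tendsto_pi_nhds.2 fun i => (hη i).continuousAt.tendsto)
  have oN : ∀ i j k, i ≠ j → i ≠ k → j ≠ k →
      (fun R => obstruction b F (Φ R) (η i R) (η j R) (η k R)) =O[𝓝 0] N := by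
    intro i j k hij hik hjk
    refine ((obstruction_isBigO hb hF hFs hξ hne hsub hpol hobs hij hik hjk).comp_tendsto tp).trans
      ?_
    exact FN.prod_left (Asymptotics.isBigO_pi.2 qN)
  -- differential equations, up to the error terms
  have pdΦ : ∀ k R, pd k Φ R = quad b (η k R) + e k R := fun k R => by simp only [he]; abel
  have pdη : ∀ i k R, i ≠ k → pd k (η i) R = rot b F (Φ R, η i R, η k R) • η k R + d i k R :=
    fun i k R hik => by rw [hdne i k hik]; module
  have evan : ∀ᶠ R in 𝓝 0, AnalyticAt 𝕜 F (Φ R) ∧ AnalyticAt 𝕜 Φ R ∧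
      (∀ i, AnalyticAt 𝕜 (η i) R) ∧
      (∀ i j, i ≠ j → AnalyticAt 𝕜 (rot b F) (Φ R, η i R, η j R)) ∧
      ∀ i j, i ≠ j → fderiv 𝕜 F (Φ R) (b (η i R) (η j R)) ≠ 0 := by
    refine (hΦ.continuousAt.tendsto.eventually hF.eventually_analyticAt).and
      (hΦ.eventually_analyticAt.and ((eventually_all.2 fun i => (hη i).eventually_analyticAt).and
      ((eventually_all.2 fun i => eventually_all.2 fun j => ?_).and
      (eventually_all.2 fun i => eventually_all.2 fun j => ?_))))
    · by_cases hij : i = j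
      · exact Eventually.of_forall fun _ h => absurd hij h
      · exact ((hpt i j).continuousAt.tendsto.eventually
          (hrotp i j hij).eventually_analyticAt).mono fun R h _ => h
    · by_cases hij : i = j
      · exact Eventually.of_forall fun _ h => absurd hij h
      · have h2 : AnalyticAt 𝕜 (fun R => b (η i R) (η j R)) 0 :=
          (b.analyticAt_bilinear _).comp_of_eq ((hη i).prod (hη j)) rfl
        exact ((analyticAt_clm_apply hDF h2).continuousAt.eventually_ne (hne i j hij)).mono
          fun R h _ => h
  have evd : ∀ {f : (Fin n → 𝕜) → 𝕜},
      AnalyticAt 𝕜 f 0 → ∀ᶠ R in 𝓝 0, DifferentiableAt 𝕜 f R := fun hf =>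
    hf.eventually_analyticAt.mono fun R h => h.differentiableAt
  have cb : ∀ i, ContinuousAt (fun R => b (η i R)) 0 := fun i =>
    b.continuous.continuousAt.comp (hη i).continuousAt
  have se : ∀ k, SmallRel N (e k) := by
    intro k
    refine smallRel_of_curl hN0 Finset.univ (fun k _ => ?_) hradΦ (fun j _ k _ hjk => ?_)
      (Finset.mem_univ k)
    · exact (ae k).eventually_analyticAt.mono fun R h => h.differentiableAt
    -- The second derivatives of `Φ` cancel, and so do the terms with `rot`, by its symmetry and
    -- that of `b`. Only the errors `d` survive.
    have h1 : (fun R => pd k (e j) R - pd j (e k) R) =ᶠ[𝓝 0]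
        fun R => b (η k R) (d k j R) - b (η j R) (d j k R) := by
      filter_upwards [evan] with R ⟨hF', hΦ', hη', _, _⟩
      have h2 : ∀ k, DifferentiableAt 𝕜 (fun R => quad b (η k R)) R := fun k =>
        (hasFDerivAt_quad hb _).differentiableAt.comp R (hη' k).differentiableAt
      have h3 : ∀ j k : Fin n, pd k (e j) R = pd k (pd j Φ) R - b (η j R) (pd k (η j) R) :=
        fun j k => by
          rw [← pd_quad_comp hb k (hη' j).differentiableAt]
          exact pd_sub k (analyticAt_pd j hΦ').differentiableAt (h2 j)
      rw [h3, h3, pd_pd_comm k j hΦ', pdη j k R hjk, pdη k j R hjk.symm, map_add, map_add, map_smul,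
        map_smul, rot_symm hb hF', hb (η j R)]
      abel
    refine h1.trans_isBigO ?_
    exact (isBigO_clm_apply (cb k) (dN k j)).sub (isBigO_clm_apply (cb j) (dN j k))
  have sd : ∀ i k, SmallRel N (d i k) := by
    intro i k
    by_cases hik : i = k
    · have : d i k = fun _ => 0 := by funext R; simp only [hd, hik, if_true]
      rw [this]; exact SmallRel.zero
    have hmem : ∀ {k : Fin n}, k ∈ ({i}ᶜ : Finset (Fin n)) ↔ i ≠ k := by
      intro k; simp [eq_comm]
    refine smallRel_of_curl hN0 {i}ᶜ (fun k _ => ?_) ?_ (fun j hj k hk hjk => ?_) (hmem.2 hik)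
    · exact (ad i k).eventually_analyticAt.mono fun R h => h.differentiableAt
    · filter_upwards [hradη] with R hR
      rw [← hR i]
      exact Finset.sum_congr rfl fun k hk => by rw [hdne i k (hmem.1 hk)]
    have hij := hmem.1 hj
    have hik := hmem.1 hk
    -- `A j k` is what remains of `∂_k(β_ij η_j)` after removal of the terms symmetric in `j` and
    -- `k`: the obstruction and terms linear in `e` and `d`.
    set A : Fin n → Fin n → (Fin n → 𝕜) → Y := fun j k R =>
      rot b F (Φ R, η i R, η j R) • d j k R +
        (obstruction b F (Φ R) (η i R) (η j R) (η k R) +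
          fderiv 𝕜 (rot b F) (Φ R, η i R, η j R) (e k R, d i k R, d j k R)) • η j R with hA
    have h1 : (fun R => pd k (d i j) R - pd j (d i k) R) =ᶠ[𝓝 0] fun R => A k j R - A j k R := by
      filter_upwards [evan] with R ⟨hF', hΦ', hη', hr', hne'⟩
      have h3 : ∀ j k : Fin n, i ≠ j → i ≠ k → j ≠ k → pd k (d i j) R = pd k (pd j (η i)) R -
          (A j k R + (rot b F (Φ R, η i R, η j R) * rot b F (Φ R, η j R, η k R)) • η k R +
            (rot b F (Φ R, η i R, η k R) * rot b F (Φ R, η j R, η k R)) • η j R) := by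
        intro j k hij hik hjk
        have hr : DifferentiableAt 𝕜 (fun R => rot b F (Φ R, η i R, η j R) • η j R) R :=
          (((hr' i j hij).comp_of_eq (hΦ'.prod ((hη' i).prod (hη' j))) rfl).fun_smul
            (hη' j)).differentiableAt
        rw [hdne i j hij, pd_sub k (analyticAt_pd j (hη' i)).differentiableAt hr,
          pd_rot_smul k (hr' i j hij).differentiableAt hΦ'.differentiableAt
            (hη' i).differentiableAt (hη' j).differentiableAt, pdη i k R hik, pdη j k R hjk, pdΦ]
        have h4 : (quad b (η k R) + e k R, rot b F (Φ R, η i R, η k R) • η k R + d i k R,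
            rot b F (Φ R, η j R, η k R) • η k R + d j k R) =
            (quad b (η k R), rot b F (Φ R, η i R, η k R) • η k R,
              rot b F (Φ R, η j R, η k R) • η k R) + (e k R, d i k R, d j k R) := rfl
        rw [h4, map_add]
        simp only [hA, obstruction]
        module
      rw [h3 j k hij hik hjk, h3 k j hik hij hjk.symm, pd_pd_comm k j (hη' i),
        rot_symm hb hF' (η k R) (η j R)]
      module
    have hAO : ∀ j k, i ≠ j → i ≠ k → j ≠ k → A j k =O[𝓝 0] N := by
      intro j k hij hik hjk
      have hDr : ContinuousAt (fun R => fderiv 𝕜 (rot b F) (Φ R, η i R, η j R)) 0 :=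
        ((hrotp i j hij).fderiv.comp_of_eq (hpt i j) rfl).continuousAt
      exact (isBigO_smul_left (hrot i j hij).continuousAt (dN j k)).add
        (isBigO_smul_right (hη j).continuousAt ((oN i j k hij hik hjk).add
          (isBigO_clm_apply hDr ((eN k).prod_left ((dN i k).prod_left (dN j k))))))
    exact h1.trans_isBigO ((hAO k j hik hij hjk.symm).sub (hAO j k hij hik hjk))
  have sF : SmallRel N (fun R => F (Φ R)) := by
    refine smallRel_of_pd hN0 Finset.univ (evd aF) (fun k _ => ?_)
      (Eventually.of_forall fun R => by rw [scaleOn_univ_zero, hFs])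
    have h1 : pd k (fun R => F (Φ R)) =ᶠ[𝓝 0] fun R => q k R + fderiv 𝕜 F (Φ R) (e k R) := by
      filter_upwards [evan] with R ⟨hF', hΦ', _⟩
      rw [pd_comp k hF'.differentiableAt hΦ'.differentiableAt, pdΦ, map_add]
    exact h1.trans_isBigO ((qN k).add (isBigO_clm_apply hDF.continuousAt (eN k)))
  have sq : ∀ i, SmallRel N (q i) := by
    intro i
    refine smallRel_of_pd hN0 {i}ᶜ (evd (aq i)) (fun k hk => ?_) ?_
    · have hik : i ≠ k := fun h => by simp [h] at hk
      -- For an exact solution `q i` would be constant in the directions `k ≠ i`, by the choice of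
      -- `rot` expressed in `rot_mul`. The derivative is therefore linear in the errors.
      have h1 : pd k (q i) =ᶠ[𝓝 0] fun R =>
          fderiv 𝕜 (fderiv 𝕜 F) (Φ R) (e k R) (quad b (η i R)) +
            fderiv 𝕜 F (Φ R) (b (η i R) (d i k R)) := by
        filter_upwards [evan] with R ⟨hF', hΦ', hη', hr', hne'⟩
        have h2 := rot_mul _ _ (hne' i k hik)
        rw [pd_isotropic hb k hF' hΦ'.differentiableAt (hη' i).differentiableAt, pdΦ,
          pdη i k R hik]
        simp only [map_add, map_smul, add_apply, smul_eq_mul]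
        linear_combination h2
      have hD2 : ContinuousAt (fun R => (fderiv 𝕜 (fderiv 𝕜 F) (Φ R)).flip (quad b (η i R))) 0 := by
        have hD := (hF.fderiv.fderiv.comp_of_eq hΦ rfl : AnalyticAt 𝕜
          (fun R => fderiv 𝕜 (fderiv 𝕜 F) (Φ R)) 0).continuousAt
        have hfl : ContinuousAt (fun R => (fderiv 𝕜 (fderiv 𝕜 F) (Φ R)).flip) 0 :=
          (ContinuousLinearMap.flipₗᵢ 𝕜 E E 𝕜).continuous.continuousAt.comp hD
        exact hfl.clm_apply (hq i).continuousAt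
      exact h1.trans_isBigO ((isBigO_clm_apply hD2 (eN k)).add
        (isBigO_clm_apply hDF.continuousAt (isBigO_clm_apply (cb i) (dN i k))))
    · filter_upwards [(tendsto_coord i).eventually (hax i)] with R hR
      simpa only [scaleOn_compl_zero] using hR
  have sN : SmallRel N N := ((((SmallRel.sum Finset.univ fun k _ => (se k).norm).add
    (SmallRel.sum Finset.univ fun i _ => SmallRel.sum Finset.univ fun k _ => (sd i k).norm)).add
    sF.norm).add (SmallRel.sum Finset.univ fun i _ => (sq i).norm))
  have hbd : ∃ B, ∀ᶠ R in 𝓝 0, N R ≤ B := by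
    have hc : ContinuousAt N 0 :=
      (((tendsto_finsetSum _ fun k _ => (ae k).continuousAt.norm).add
        (tendsto_finsetSum _ fun i _ => tendsto_finsetSum _ fun k _ =>
          (ad i k).continuousAt.norm)).add aF.continuousAt.norm).add
        (tendsto_finsetSum _ fun i _ => (aq i).continuousAt.norm)
    exact ⟨N 0 + 1, hc.eventually_le_const (lt_add_one _)⟩
  have key := SmallRel.eventually_eq_zero hN0 hbd sN
  refine ⟨hΦ, hη, ?_, ?_⟩
  · filter_upwards [key] with R hR i
    have h1 := Finset.single_le_sum (f := fun k => ‖e k R‖) (fun _ _ => norm_nonneg _)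
      (Finset.mem_univ i)
    have h2 : ‖e i R‖ ≤ 0 := by
      simp only [hN] at hR
      linarith [p2 R, p3 R, norm_nonneg (F (Φ R))]
    rw [pdΦ, norm_le_zero_iff.1 h2, add_zero]
  · filter_upwards [key] with R hR
    have h2 : ‖F (Φ R)‖ ≤ 0 := by
      simp only [hN] at hR
      linarith [p1 R, p2 R, p3 R]
    exact norm_le_zero_iff.1 h2

end Existence

/-! ### Existence of nets -/

section Existence

variable {E Y : Type*} [NormedAddCommGroup E] [NormedSpace 𝕜 E] [FiniteDimensional 𝕜 E]
  [NormedAddCommGroup Y] [NormedSpace 𝕜 Y] [FiniteDimensional 𝕜 Y] {n : ℕ}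
  {b : Y →L[𝕜] Y →L[𝕜] E} {F : E → 𝕜} {s : E}

/-- The curve on the hypersurface with characteristic velocities prescribed by a function `h`. -/
theorem exists_characteristic_curve (hY : Module.finrank 𝕜 Y = 3) (hb : ∀ ξ η, b ξ η = b η ξ)
    (hF : AnalyticAt 𝕜 F s) {ξ : Y} {θ ψ : Y →L[𝕜] 𝕜} (hξ : fderiv 𝕜 F s (quad b ξ) = 0)
    (hloc : ∀ v, θ v = 0 → ψ v = 0 → fderiv 𝕜 F s (b ξ v) = 0 → v = 0) (hθ : θ ξ = 1)
    {h : 𝕜 → 𝕜} (hh : AnalyticAt 𝕜 h 0) (h0 : h 0 = ψ ξ) :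
    ∃ (c : 𝕜 → E) (ζ : 𝕜 → Y), AnalyticAt 𝕜 ζ 0 ∧ c 0 = s ∧ ζ 0 = ξ ∧
      ∀ᶠ t in 𝓝 (0 : 𝕜), HasDerivAt c (quad b (ζ t)) t ∧ θ (ζ t) = 1 ∧ ψ (ζ t) = h t ∧
        fderiv 𝕜 F (c t) (quad b (ζ t)) = 0 := by
  have : CompleteSpace E := FiniteDimensional.complete 𝕜 E
  obtain ⟨g, hg, hg0, hgr, -⟩ := exists_cone_coordinates hY hb hF hξ hloc
  rw [hθ, ← h0] at hg hg0 hgr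
  have hX : AnalyticAt 𝕜 (fun p : 𝕜 × E => quad b (g (p.2, 1, h p.1))) (0, s) :=
    (analyticAt_quad _).comp_of_eq (hg.comp_of_eq (analyticAt_snd.prod (analyticAt_const.prod
      (hh.comp_of_eq analyticAt_fst rfl))) rfl) rfl
  obtain ⟨c, hc, hc0, hode⟩ := exists_analytic_ode_one hX
  have hin : AnalyticAt 𝕜 (fun t => (c t, (1 : 𝕜), h t)) 0 := hc.prod (analyticAt_const.prod hh)
  refine ⟨c, fun t => g (c t, 1, h t), hg.comp_of_eq hin (by rw [hc0]), hc0, by simp [hc0, hg0], ?_⟩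
  filter_upwards [hode, (tendsto_of_analyticAt hin (by rw [hc0])).eventually hgr] with t h1 h2
  exact ⟨h1, h2.2.1, h2.2.2, h2.1⟩

/-- Existence of a net with given Goursat data. -/
theorem exists_isNet (hY : Module.finrank 𝕜 Y = 3) (hb : ∀ ξ η, b ξ η = b η ξ)
    (hF : AnalyticAt 𝕜 F s) (hFs : F s = 0) {ξ : Fin n → Y} {θ ψ : Fin n → Y →L[𝕜] 𝕜}
    (hξ : ∀ i, fderiv 𝕜 F s (quad b (ξ i)) = 0)
    (hne : ∀ i j, i ≠ j → fderiv 𝕜 F s (b (ξ i) (ξ j)) ≠ 0)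
    (hsub : ∃ V, fderiv 𝕜 F s V ≠ 0) (hpol : ∀ i, ∃ v, fderiv 𝕜 F s (b (ξ i) v) ≠ 0)
    (hloc : ∀ i v, θ i v = 0 → ψ i v = 0 → fderiv 𝕜 F s (b (ξ i) v) = 0 → v = 0)
    (hθ : ∀ i, θ i (ξ i) = 1)
    (hobs : ∀ᶠ p : E × (Fin n → Y) in 𝓝 (s, ξ), F p.1 = 0 →
      (∀ i, fderiv 𝕜 F p.1 (quad b (p.2 i)) = 0) → ∀ i j k, i ≠ j → i ≠ k → j ≠ k →
        obstruction b F p.1 (p.2 i) (p.2 j) (p.2 k) = 0)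
    {h : Fin n → 𝕜 → 𝕜} (hh : ∀ i, AnalyticAt 𝕜 (h i) 0) (h0 : ∀ i, h i 0 = ψ i (ξ i)) :
    ∃ (Φ : (Fin n → 𝕜) → E) (η : Fin n → (Fin n → 𝕜) → Y), IsNet b F Φ η ∧ Φ 0 = s ∧
      (∀ i, η i 0 = ξ i) ∧ ∀ i, ∀ᶠ t in 𝓝 (0 : 𝕜), θ i (η i (Pi.single i t)) = 1 ∧
        ψ i (η i (Pi.single i t)) = h i t := by
  have : CompleteSpace E := FiniteDimensional.complete 𝕜 E
  have : CompleteSpace Y := FiniteDimensional.complete 𝕜 Y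
  choose c ζ hζ hc0 hζ0 hcurve using fun i =>
    exists_characteristic_curve hY hb hF (hξ i) (hloc i) (hθ i) (hh i) (h0 i)
  -- The index `none` stands for `Φ`, integrated from the origin in all coordinates. The index `some
  -- i` stands for `η i`, integrated from the `i`-th axis in the other coordinates. To have one
  -- common value space, both take values in `E × Y`, with the idle component zero.
  set T : Option (Fin n) → Finset (Fin n) := fun o => o.elim Finset.univ fun i => {i}ᶜ with hT
  set G : Option (Fin n) → Fin n → (Fin n → 𝕜) × (Option (Fin n) → E × Y) → E × Y := fun o k p =>
    o.elim (quad b (p.2 (some k)).2, 0)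
      fun i => (0, rot b F ((p.2 none).1, (p.2 (some i)).2, (p.2 (some k)).2) • (p.2 (some k)).2)
    with hG
  set a : Option (Fin n) → (Fin n → 𝕜) → E × Y := fun o R =>
    o.elim (s, 0) fun i => (0, ζ i (R i)) with ha
  have hcoord : ∀ (o : Option (Fin n)) (p : (Fin n → 𝕜) × (Option (Fin n) → E × Y)),
      AnalyticAt 𝕜 (fun p : (Fin n → 𝕜) × (Option (Fin n) → E × Y) => p.2 o) p := fun o p =>
    ((ContinuousLinearMap.proj (R := 𝕜) (φ := fun _ : Option (Fin n) => E × Y) o).analyticAt _).comp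
      analyticAt_snd
  have hE : ∀ (o : Option (Fin n)) (p : (Fin n → 𝕜) × (Option (Fin n) → E × Y)),
      AnalyticAt 𝕜 (fun p : (Fin n → 𝕜) × (Option (Fin n) → E × Y) => (p.2 o).1) p := fun o p =>
    analyticAt_fst.comp (hcoord o p)
  have hV : ∀ (o : Option (Fin n)) (p : (Fin n → 𝕜) × (Option (Fin n) → E × Y)),
      AnalyticAt 𝕜 (fun p : (Fin n → 𝕜) × (Option (Fin n) → E × Y) => (p.2 o).2) p := fun o p =>
    analyticAt_snd.comp (hcoord o p)
  have hproj : ∀ i : Fin n, AnalyticAt 𝕜 (fun R : Fin n → 𝕜 => R i) 0 := fun i =>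
    (ContinuousLinearMap.proj (R := 𝕜) (φ := fun _ : Fin n => 𝕜) i).analyticAt _
  obtain ⟨w, hw, hw0, hev⟩ := exists_goursat T G a
    (by
      rintro (_ | i)
      · exact analyticAt_const
      · exact analyticAt_const.prod ((hζ i).comp_of_eq (hproj i) rfl))
    (by
      rintro (_ | i) c R
      · rfl
      · simp [ha, hT, scaleOn])
    (by
      rintro (_ | i) k hk
      · exact ((analyticAt_quad _).comp_of_eq (hV _ _) rfl).prod analyticAt_const
      · have hik : i ≠ k := fun h => by simp [hT, h] at hk
        refine analyticAt_const.prod (AnalyticAt.fun_smul ?_ (hV _ _))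
        refine (analyticAt_rot (b := b) (F := F) (p := (s, ξ i, ξ k)) hF (hne i k hik)).comp_of_eq
          ((hE _ _).prod ((hV _ _).prod (hV _ _))) ?_
        simp [ha, hζ0])
  set Φ : (Fin n → 𝕜) → E := fun R => (w R none).1
  set η : Fin n → (Fin n → 𝕜) → Y := fun i R => (w R (some i)).2
  have hwo : ∀ o, AnalyticAt 𝕜 (fun R => w R o) 0 := fun o => analyticAt_pi_iff.1 hw o
  have hΦ : AnalyticAt 𝕜 Φ 0 := analyticAt_fst.comp (hwo none)
  have hη : ∀ i, AnalyticAt 𝕜 (η i) 0 := fun i => analyticAt_snd.comp (hwo (some i))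
  have hΦ0 : Φ 0 = s := by simp [Φ, hw0, ha]
  have hη0 : ∀ i, η i 0 = ξ i := fun i => by simp [η, hw0, ha, hζ0]
  have hfst : ∀ᶠ R in 𝓝 0, ∀ v, fderiv 𝕜 Φ R v = (fderiv 𝕜 (fun R => w R none) R v).1 := by
    filter_upwards [(hwo none).eventually_analyticAt] with R hR v
    have h1 : HasFDerivAt Φ _ R := hR.differentiableAt.hasFDerivAt.fst
    rw [h1.fderiv]; rfl
  have hsnd : ∀ᶠ R in 𝓝 0, ∀ i v,
      fderiv 𝕜 (η i) R v = (fderiv 𝕜 (fun R => w R (some i)) R v).2 := by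
    refine eventually_all.2 fun i => ?_
    filter_upwards [(hwo (some i)).eventually_analyticAt] with R hR v
    have h1 : HasFDerivAt (η i) _ R := hR.differentiableAt.hasFDerivAt.snd
    rw [h1.fderiv]; rfl
  have hradΦ : ∀ᶠ R in 𝓝 0, ∑ k, R k • (pd k Φ R - quad b (η k R)) = 0 := by
    filter_upwards [hev, hfst] with R h1 h2
    have h3 := congrArg Prod.fst (h1 none).2
    rw [← h2] at h3
    change fderiv 𝕜 Φ R (coordsOn Finset.univ R) = _ at h3
    rw [fderiv_coordsOn, Prod.fst_sum] at h3
    simp only [smul_sub, Finset.sum_sub_distrib, h3]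
    exact sub_self _
  have hradη : ∀ᶠ R in 𝓝 0, ∀ i, ∑ k ∈ {i}ᶜ,
      R k • (pd k (η i) R - rot b F (Φ R, η i R, η k R) • η k R) = 0 := by
    filter_upwards [hev, hsnd] with R h1 h2 i
    have h3 := congrArg Prod.snd (h1 (some i)).2
    rw [← h2] at h3
    change fderiv 𝕜 (η i) R (coordsOn {i}ᶜ R) = _ at h3
    rw [fderiv_coordsOn, Prod.snd_sum] at h3
    simp only [smul_sub, Finset.sum_sub_distrib, h3]
    exact sub_self _
  have hηax : ∀ i, ∀ᶠ t in 𝓝 (0 : 𝕜), η i (Pi.single i t) = ζ i t := by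
    intro i
    filter_upwards [(tendsto_single i).eventually hev] with t ht
    have h1 := congrArg Prod.snd (ht (some i)).1
    have h2 : scaleOn (T (some i)) 0 (Pi.single i t) = (Pi.single i t : Fin n → 𝕜) := by
      change scaleOn {i}ᶜ 0 _ = _
      rw [scaleOn_compl_zero, Pi.single_eq_same]
    rw [h2] at h1
    simpa [ha] using h1
  -- On the `i`-th axis the radial equation for `Φ` has the single term with factor `t`. Dividing by
  -- it gives the derivative of `Φ`, which agrees with that of the prescribed curve `c i`. So `Φ`
  -- equals `c i` there, and the isotropy of `ζ i` along `c i` becomes the axis condition required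
  -- of the net.
  have hdax : ∀ i, ∀ᶠ t in 𝓝 (0 : 𝕜), pd i Φ (Pi.single i t) = quad b (ζ i t) := by
    intro i
    have hsa : AnalyticAt 𝕜 (fun t : 𝕜 => (Pi.single i t : Fin n → 𝕜)) 0 :=
      (ContinuousLinearMap.single 𝕜 (fun _ : Fin n => 𝕜) i).analyticAt 0
    refine eventually_eq_of_smul
      (((analyticAt_pd i hΦ).comp_of_eq hsa (by simp)).continuousAt)
      ((analyticAt_quad _).comp_of_eq (hζ i) rfl).continuousAt ?_
    filter_upwards [(tendsto_single i).eventually hradΦ, hηax i] with t h1 h2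
    rw [Finset.sum_eq_single i (fun k _ hk => by simp [Pi.single_eq_of_ne hk]) (by simp), h2] at h1
    rw [← sub_eq_zero, ← smul_sub]
    simpa using h1
  have hΦax : ∀ i, ∀ᶠ t in 𝓝 (0 : 𝕜), Φ (Pi.single i t) = c i t := by
    intro i
    refine eventually_eq_of_deriv_eq (f' := fun t => quad b (ζ i t))
      (by simp [hΦ0, hc0]) ?_ ((hcurve i).mono fun t h => h.1)
    filter_upwards [hdax i, (tendsto_single i).eventually hΦ.eventually_analyticAt] with t h1 h2
    rw [← h1]
    have h3 : HasDerivAt (fun t : 𝕜 => (Pi.single i t : Fin n → 𝕜)) (Pi.single i 1) t := by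
      simpa using (ContinuousLinearMap.single 𝕜 (fun _ : Fin n => 𝕜) i).hasDerivAt (x := t)
    exact h2.differentiableAt.hasFDerivAt.comp_hasDerivAt t h3
  refine ⟨Φ, η, isNet_of_radial hb hF hFs hξ hne hsub hpol hobs hΦ hη hΦ0 hη0 hradΦ hradη
    fun i => ?_, hΦ0, hη0, fun i => ?_⟩
  · filter_upwards [hΦax i, hηax i, hcurve i] with t h1 h2 h3
    rw [h1, h2, h3.2.2.2]
  · filter_upwards [hηax i, hcurve i] with t h2 h3
    rw [h2]
    exact ⟨h3.2.1, h3.2.2.1⟩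

end Existence

/-! ### Parametrizations of submanifolds -/

section Submanifold

variable {n : ℕ} {S : Set (SymMat 𝕜)} {D : Set (Fin n → 𝕜)} {φ χ : (Fin n → 𝕜) → SymMat 𝕜}
  {R₀ R₁ : Fin n → 𝕜} {s : SymMat 𝕜}

/-- An immersion has an analytic left inverse. -/
theorem exists_analytic_leftInverse {E : Type*} [NormedAddCommGroup E] [NormedSpace 𝕜 E]
    [FiniteDimensional 𝕜 E] {φ : (Fin n → 𝕜) → E} (hφ : AnalyticAt 𝕜 φ R₀)
    (hinj : Function.Injective (fderiv 𝕜 φ R₀)) :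
    ∃ ρ : E → Fin n → 𝕜, AnalyticAt 𝕜 ρ (φ R₀) ∧ ∀ᶠ R in 𝓝 R₀, ρ (φ R) = R := by
  obtain ⟨L₀, hL₀⟩ := LinearMap.exists_leftInverse_of_injective (fderiv 𝕜 φ R₀).toLinearMap
    (LinearMap.ker_eq_bot.2 hinj)
  set L : E →L[𝕜] (Fin n → 𝕜) := LinearMap.toContinuousLinearMap L₀
  have hL : ∀ v, L (fderiv 𝕜 φ R₀ v) = v := fun v => LinearMap.congr_fun hL₀ v
  have hd : HasFDerivAt (fun R => L (φ R)) (L.comp (fderiv 𝕜 φ R₀)) R₀ :=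
    L.hasFDerivAt.comp R₀ hφ.differentiableAt.hasFDerivAt
  obtain ⟨g, hg, -, -, hgl⟩ := exists_analytic_inverse_of_injective (f := fun R => L (φ R))
    ((L.analyticAt _).comp hφ) rfl (fun v hv => by
      rw [hd.fderiv] at hv
      rw [← hL v]; exact hv)
  exact ⟨fun U => g (L U), hg.comp (L.analyticAt _), hgl⟩

/-- A left inverse continuous at the points of the image gives both injectivity and the comparison
of the two topologies. -/
theorem isLocalParam_of_leftInverse (hD : IsOpen D) (hφ : AnalyticOnNhd 𝕜 φ D)
    (himm : ∀ R ∈ D, Function.Injective (fderiv 𝕜 φ R)) {σ : SymMat 𝕜 → Fin n → 𝕜}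
    (hσ : ∀ R ∈ D, ContinuousAt σ (φ R) ∧ σ (φ R) = R)
    (himg : ∃ W : Set (SymMat 𝕜), IsOpen W ∧ φ '' D = S ∩ W) : IsLocalParam n S D φ := by
  refine ⟨hD, hφ, himm, ⟨?_, ?_⟩, himg⟩
  · rw [isInducing_iff_nhds]
    intro x
    refine le_antisymm ?_ ?_
    · rw [← tendsto_iff_comap]
      exact (hφ x x.2).continuousAt.tendsto.comp continuous_subtype_val.continuousAt.tendsto
    · refine le_of_le_of_eq ?_ (nhds_subtype D x).symm
      rw [← tendsto_iff_comap]
      have h1 : Tendsto (fun y : D => σ (φ y)) (comap (D.domRestrict φ) (𝓝 (φ x))) (𝓝 (x : _)) := by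
        have h2 := (hσ x x.2).1.tendsto
        rw [(hσ x x.2).2] at h2
        exact h2.comp tendsto_comap
      refine h1.congr fun y => (hσ y y.2).2
  · intro x y hxy
    have h : φ x = φ y := hxy
    exact Subtype.ext (by rw [← (hσ x x.2).2, ← (hσ y y.2).2, h])

/-- Injectivity of the derivative is an open condition. -/
theorem eventually_injective_fderiv {E : Type*} [NormedAddCommGroup E] [NormedSpace 𝕜 E]
    [FiniteDimensional 𝕜 E] {φ : (Fin n → 𝕜) → E} (hφ : AnalyticAt 𝕜 φ R₀)
    (hinj : Function.Injective (fderiv 𝕜 φ R₀)) :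
    ∀ᶠ R in 𝓝 R₀, Function.Injective (fderiv 𝕜 φ R) := by
  have : CompleteSpace E := FiniteDimensional.complete 𝕜 E
  obtain ⟨ρ, hρ, hl⟩ := exists_analytic_leftInverse hφ hinj
  filter_upwards [hl.eventually_nhds, hφ.eventually_analyticAt,
    hφ.continuousAt.tendsto.eventually hρ.eventually_analyticAt] with R h1 h2 h3
  have h4 : HasFDerivAt (fun R => ρ (φ R)) _ R :=
    h3.differentiableAt.hasFDerivAt.comp R h2.differentiableAt.hasFDerivAt
  have h5 : HasFDerivAt (fun R => ρ (φ R)) (ContinuousLinearMap.id 𝕜 _) R :=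
    (hasFDerivAt_id R).congr_of_eventuallyEq h1
  have h6 := h4.unique h5
  intro v w hvw
  have h7 : ∀ v, fderiv 𝕜 ρ (φ R) (fderiv 𝕜 φ R v) = v := fun v =>
    congrArg (fun L => L v) h6
  rw [← h7 v, hvw, h7]

/-- An immersion is locally a parametrization of its image. -/
theorem exists_isLocalParam_image (hφ : AnalyticAt 𝕜 φ R₀)
    (hinj : Function.Injective (fderiv 𝕜 φ R₀)) {A : Set (Fin n → 𝕜)} (hA : A ∈ 𝓝 R₀) :
    ∃ D ⊆ A, R₀ ∈ D ∧ IsLocalParam n (φ '' D) D φ := by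
  obtain ⟨ρ, hρ, hl⟩ := exists_analytic_leftInverse hφ hinj
  have himm := eventually_injective_fderiv hφ hinj
  have hev : ∀ᶠ R in 𝓝 R₀, (R ∈ A ∧ AnalyticAt 𝕜 φ R ∧ Function.Injective (fderiv 𝕜 φ R)) ∧
      AnalyticAt 𝕜 ρ (φ R) ∧ ρ (φ R) = R :=
    (Eventually.and (show ∀ᶠ R in 𝓝 R₀, R ∈ A from hA) (hφ.eventually_analyticAt.and himm)).and
      ((hφ.continuousAt.tendsto.eventually hρ.eventually_analyticAt).and hl)
  obtain ⟨D, hD, hDo, hR⟩ := eventually_nhds_iff.1 hev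
  refine ⟨D, fun R h => (hD R h).1.1, hR, isLocalParam_of_leftInverse hDo
    (fun R h => (hD R h).1.2.1) (fun R h => (hD R h).1.2.2)
    (fun R h => ⟨(hD R h).2.1.continuousAt, (hD R h).2.2⟩) ⟨univ, isOpen_univ, (inter_univ _).symm⟩⟩

/-- The local coordinates of a parametrization. -/
theorem IsLocalParam.exists_coordinates (h : IsLocalParam n S D χ) (hR : R₁ ∈ D) :
    ∃ ρ : SymMat 𝕜 → Fin n → 𝕜, AnalyticAt 𝕜 ρ (χ R₁) ∧ ρ (χ R₁) = R₁ ∧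
      (∀ᶠ U in 𝓝 (χ R₁), U ∈ S → ρ U ∈ D ∧ χ (ρ U) = U) ∧ ∀ᶠ R in 𝓝 R₁, ρ (χ R) = R := by
  obtain ⟨ρ, hρ, hl⟩ := exists_analytic_leftInverse (h.analytic R₁ hR) (h.immersion R₁ hR)
  refine ⟨ρ, hρ, hl.self_of_nhds, ?_, hl⟩
  obtain ⟨W, hW, hSW⟩ := h.image
  -- The left inverse is valid only near `R₁`. Because `χ` is an embedding, points of its image
  -- close to `χ R₁` come from parameters close to `R₁`, so distant parts of `D` cannot interfere.
  have h1 : ∀ᶠ x : D in 𝓝 ⟨R₁, hR⟩, ρ (χ x) = x := by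
    rw [nhds_subtype]
    exact tendsto_comap.eventually hl
  rw [h.embedding.isInducing.nhds_eq_comap, eventually_comap] at h1
  have hmem : W ∈ 𝓝 (χ R₁) := hW.mem_nhds (by
    have : χ R₁ ∈ S ∩ W := hSW ▸ mem_image_of_mem χ hR
    exact this.2)
  filter_upwards [h1, hmem] with U hU hUW hUS
  have : U ∈ χ '' D := hSW ▸ ⟨hUS, hUW⟩
  obtain ⟨R, hRD, rfl⟩ := this
  have := hU ⟨R, hRD⟩ rfl
  simp only at this
  rw [this]
  exact ⟨hRD, rfl⟩

theorem IsLocalParam.mem (h : IsLocalParam n S D χ) (hR : R₁ ∈ D) : χ R₁ ∈ S := by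
  obtain ⟨W, -, hSW⟩ := h.image
  have : χ R₁ ∈ S ∩ W := hSW ▸ mem_image_of_mem χ hR
  exact this.1

theorem IsLocalParam.eventually_mem (h : IsLocalParam n S D χ) (hR : R₁ ∈ D) :
    ∀ᶠ R in 𝓝 R₁, R ∈ D :=
  h.isOpen.mem_nhds hR

/-- An immersion into `S` has local coordinates on `S` as an inverse. -/
theorem IsLocalParam.exists_inverse (h : IsLocalParam n S D χ) (hR : R₁ ∈ D)
    (hφ : AnalyticAt 𝕜 φ R₀) (hinj : Function.Injective (fderiv 𝕜 φ R₀)) (h0 : φ R₀ = χ R₁)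
    (hS : ∀ᶠ R in 𝓝 R₀, φ R ∈ S) :
    ∃ σ : SymMat 𝕜 → Fin n → 𝕜, AnalyticAt 𝕜 σ (χ R₁) ∧ σ (χ R₁) = R₀ ∧
      (∀ᶠ U in 𝓝 (χ R₁), U ∈ S → φ (σ U) = U) ∧ ∀ᶠ R in 𝓝 R₀, σ (φ R) = R := by
  obtain ⟨ρ, hρ, hρ0, hρS, hρl⟩ := h.exists_coordinates hR
  rw [← h0] at hρ hρS
  have hT : AnalyticAt 𝕜 (fun R => ρ (φ R)) R₀ := hρ.comp hφ
  have hφT : ∀ᶠ R in 𝓝 R₀, χ (ρ (φ R)) = φ R := by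
    filter_upwards [hφ.continuousAt.tendsto.eventually hρS, hS] with R h1 h2
    exact (h1 h2).2
  have hχ : AnalyticAt 𝕜 χ (ρ (φ R₀)) := by
    rw [h0, hρ0]; exact h.analytic R₁ hR
  obtain ⟨g, hg, hg0, hgr, hgl⟩ := exists_analytic_inverse_of_injective hT rfl (fun v hv => by
    have h1 : HasFDerivAt (fun R => χ (ρ (φ R))) _ R₀ :=
      hχ.differentiableAt.hasFDerivAt.comp R₀ hT.differentiableAt.hasFDerivAt
    have h2 : fderiv 𝕜 (fun R => χ (ρ (φ R))) R₀ = fderiv 𝕜 φ R₀ :=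
      Filter.EventuallyEq.fderiv_eq hφT
    apply hinj
    rw [map_zero, ← h2, h1.fderiv]
    change fderiv 𝕜 χ _ (fderiv 𝕜 (fun R => ρ (φ R)) R₀ v) = 0
    rw [hv, map_zero])
  rw [← h0]
  refine ⟨fun U => g (ρ U), hg.comp hρ, hg0, ?_, hgl⟩
  have t1 : Tendsto ρ (𝓝 (φ R₀)) (𝓝 (ρ (φ R₀))) := hρ.continuousAt.tendsto
  have t2 : Tendsto (fun U => g (ρ U)) (𝓝 (φ R₀)) (𝓝 R₀) :=
    tendsto_of_analyticAt (hg.comp hρ) hg0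
  filter_upwards [t1.eventually hgr, hρS, t2.eventually hφT] with U h1 h2 h3 hU
  rw [← h3, h1]
  exact (h2 hU).2

/-- Shrinking must be done on both sides: parameters whose image lies where `σ` inverts `φ` on `S`,
and points of `S` whose coordinate `σ` lies in the admissible set. The second condition provides the
open set `W` that cuts out the image. -/
theorem exists_isLocalParam_of_inverse (hφ : AnalyticAt 𝕜 φ R₀)
    (himm : ∀ᶠ R in 𝓝 R₀, Function.Injective (fderiv 𝕜 φ R))
    (hS : ∀ᶠ R in 𝓝 R₀, φ R ∈ S) {σ : SymMat 𝕜 → Fin n → 𝕜} (hσ : AnalyticAt 𝕜 σ (φ R₀))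
    (hr : ∀ᶠ U in 𝓝 (φ R₀), U ∈ S → φ (σ U) = U) (hl : ∀ᶠ R in 𝓝 R₀, σ (φ R) = R)
    {A : Set (Fin n → 𝕜)} (hA : A ∈ 𝓝 R₀) :
    ∃ D ⊆ A, R₀ ∈ D ∧ IsLocalParam n S D φ := by
  have hev : ∀ᶠ R in 𝓝 R₀, R ∈ A ∧ AnalyticAt 𝕜 φ R ∧ Function.Injective (fderiv 𝕜 φ R) ∧
      φ R ∈ S ∧ σ (φ R) = R := Eventually.and (show ∀ᶠ R in 𝓝 R₀, R ∈ A from hA)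
    (hφ.eventually_analyticAt.and (himm.and (hS.and hl)))
  obtain ⟨A', hA', hAo, hRA⟩ := eventually_nhds_iff.1 hev
  obtain ⟨O, hO, hOo, hRO⟩ := eventually_nhds_iff.1 (hσ.eventually_analyticAt.and hr)
  have hφc : ContinuousOn φ A' := fun R hR => (hA' R hR).2.1.continuousAt.continuousWithinAt
  have hσc : ContinuousOn σ O := fun U hU => (hO U hU).1.continuousAt.continuousWithinAt
  refine ⟨A' ∩ φ ⁻¹' O, fun R h => (hA' R h.1).1, ⟨hRA, hRO⟩, isLocalParam_of_leftInverse
    (hφc.isOpen_inter_preimage hAo hOo) (fun R h => (hA' R h.1).2.1)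
    (fun R h => (hA' R h.1).2.2.1)
    (fun R h => ⟨(hO _ h.2).1.continuousAt, (hA' R h.1).2.2.2.2⟩)
    ⟨O ∩ σ ⁻¹' A', hσc.isOpen_inter_preimage hOo hAo, ?_⟩⟩
  ext U
  constructor
  · rintro ⟨R, ⟨h1, h2⟩, rfl⟩
    refine ⟨(hA' R h1).2.2.2.1, h2, ?_⟩
    change σ (φ R) ∈ A'
    rwa [(hA' R h1).2.2.2.2]
  · rintro ⟨h1, h2, h3⟩
    have h4 := (hO U h2).2 h1
    refine ⟨σ U, ⟨h3, ?_⟩, h4⟩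
    change φ (σ U) ∈ O
    rwa [h4]

/-- Every immersion into `S` of the right dimension is a parametrization of `S`. -/
theorem IsLocalParam.exists_isLocalParam (h : IsLocalParam n S D χ) (hR : R₁ ∈ D)
    (hφ : AnalyticAt 𝕜 φ R₀) (hinj : Function.Injective (fderiv 𝕜 φ R₀)) (h0 : φ R₀ = χ R₁)
    (hS : ∀ᶠ R in 𝓝 R₀, φ R ∈ S) {A : Set (Fin n → 𝕜)} (hA : A ∈ 𝓝 R₀) :
    ∃ D ⊆ A, R₀ ∈ D ∧ IsLocalParam n S D φ := by
  obtain ⟨σ, hσ, -, hr, hl⟩ := h.exists_inverse hR hφ hinj h0 hS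
  rw [← h0] at hσ hr
  exact exists_isLocalParam_of_inverse hφ (eventually_injective_fderiv hφ hinj) hS hσ hr hl hA

/-- Velocities of maps into `S` are tangent to `S`. -/
theorem IsLocalParam.fderiv_mem_range (h : IsLocalParam n S D χ) (hR : R₁ ∈ D) {V : Type*}
    [NormedAddCommGroup V] [NormedSpace 𝕜 V] {f : V → SymMat 𝕜} {v : V}
    (hf : DifferentiableAt 𝕜 f v) (h0 : f v = χ R₁) (hS : ∀ᶠ w in 𝓝 v, f w ∈ S) (x : V) :
    fderiv 𝕜 f v x ∈ range (fderiv 𝕜 χ R₁) := by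
  obtain ⟨ρ, hρ, hρ0, hρS, -⟩ := h.exists_coordinates hR
  rw [← h0] at hρ hρ0 hρS
  have h1 : ∀ᶠ w in 𝓝 v, χ (ρ (f w)) = f w := by
    filter_upwards [hf.continuousAt.tendsto.eventually hρS, hS] with w h1 h2
    exact (h1 h2).2
  have hχ : DifferentiableAt 𝕜 χ (ρ (f v)) := by
    rw [hρ0]; exact (h.analytic R₁ hR).differentiableAt
  have h2 : HasFDerivAt (fun w => χ (ρ (f w))) _ v :=
    hχ.hasFDerivAt.comp v (hρ.differentiableAt.hasFDerivAt.comp v hf.hasFDerivAt)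
  have h3 : fderiv 𝕜 (fun w => χ (ρ (f w))) v = fderiv 𝕜 f v :=
    Filter.EventuallyEq.fderiv_eq h1
  rw [← h3, h2.fderiv, hρ0]
  exact ⟨_, rfl⟩

theorem IsLocalParam.tangentVectors_eq (h : IsLocalParam n S D χ) (hR : R₁ ∈ D) :
    tangentVectors n S (χ R₁) = range (fderiv 𝕜 χ R₁) := by
  ext V
  constructor
  · rintro ⟨D', φ, hφ, R, hRD, h0, v, rfl⟩
    exact h.fderiv_mem_range hR (hφ.analytic R hRD).differentiableAt h0
      ((hφ.eventually_mem hRD).mono fun R' h' => hφ.mem h') v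
  · exact fun hV => ⟨D, χ, h, R₁, hR, rfl, hV⟩

end Submanifold

/-! ### Hydrodynamic reductions -/

section Reduction

variable {n : ℕ} {M : Set (SymMat 𝕜)} {D : Set (Fin n → 𝕜)} {U : (Fin n → 𝕜) → SymMat 𝕜}
  {lam mu : Fin n → (Fin n → 𝕜) → 𝕜}

/-- The entries of a symmetric matrix, as continuous linear functions. -/
def entryL (a b : Fin 3) : SymMat 𝕜 →L[𝕜] 𝕜 :=
  LinearMap.toContinuousLinearMap
    { toFun := fun V => V.1 a b
      map_add' := fun _ _ => rfl
      map_smul' := fun _ _ => rfl }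

theorem entryL_apply (a b : Fin 3) (V : SymMat 𝕜) : entryL a b V = V.1 a b := rfl

theorem pd_entry {m : ℕ} {f : (Fin m → 𝕜) → SymMat 𝕜} {z : Fin m → 𝕜} (k : Fin m) (a b : Fin 3)
    (hf : DifferentiableAt 𝕜 f z) : pd k (fun w => (f w).1 a b) z = (pd k f z).1 a b := by
  have h := pd_comp (g := entryL (𝕜 := 𝕜) a b) k (entryL (𝕜 := 𝕜) a b).differentiableAt hf
  rwa [ContinuousLinearMap.fderiv] at h

/-- The direction of propagation with the speeds `(μ, λ)`. -/
def speedVec (mu lam : 𝕜) : Fin 3 → 𝕜 := ![1, mu, lam]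

theorem analyticAt_speedVec {X : Type*} [NormedAddCommGroup X] [NormedSpace 𝕜 X] {f g : X → 𝕜}
    {x : X} (hf : AnalyticAt 𝕜 f x) (hg : AnalyticAt 𝕜 g x) :
    AnalyticAt 𝕜 (fun y => speedVec (f y) (g y)) x := by
  refine analyticAt_pi_iff.2 fun k => ?_
  fin_cases k
  · exact analyticAt_const
  · exact hf
  · exact hg

theorem linearIndependent_of_ne {ξ ζ : Fin 3 → 𝕜} (h1 : ξ 0 = 1) (h2 : ζ 0 = 1) (h : ξ ≠ ζ) :
    LinearIndependent 𝕜 ![ξ, ζ] := by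
  rw [LinearIndependent.pair_iff]
  intro a c hac
  have h0 : a + c = 0 := by
    have := congrFun hac 0
    simpa [h1, h2] using this
  have hc : c = -a := by linear_combination h0
  have h3 : a • (ξ - ζ) = 0 := by
    rw [← hac, hc]; module
  have ha : a = 0 := (smul_eq_zero.1 h3).resolve_right (sub_ne_zero.2 h)
  exact ⟨ha, by rw [hc, ha, neg_zero]⟩

/-- The simple wave in which only the `i`-th phase changes. -/
theorem exists_simple_wave {R₀ : Fin n → 𝕜} (i : Fin n) (hl : AnalyticAt 𝕜 (lam i) R₀)
    (hm : AnalyticAt 𝕜 (mu i) R₀) :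
    ∃ g : (Fin 3 → 𝕜) → 𝕜, AnalyticAt 𝕜 g 0 ∧ g 0 = 0 ∧
      (∀ k, pd k g 0 = speedVec (mu i R₀) (lam i R₀) k) ∧
      ∀ᶠ z in 𝓝 0, ∀ k, pd k g z =
        speedVec (mu i (R₀ + g z • Pi.single i 1)) (lam i (R₀ + g z • Pi.single i 1)) k *
          pd 0 g z := by
  set P : 𝕜 → Fin 3 → 𝕜 := fun ρ =>
    speedVec (mu i (R₀ + ρ • Pi.single i 1)) (lam i (R₀ + ρ • Pi.single i 1)) with hP
  have hline : AnalyticAt 𝕜 (fun ρ : 𝕜 => R₀ + ρ • (Pi.single i (1 : 𝕜) : Fin n → 𝕜)) 0 :=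
    analyticAt_const.add (analyticAt_id.fun_smul analyticAt_const)
  have hPa : AnalyticAt 𝕜 P 0 :=
    analyticAt_speedVec (hm.comp_of_eq hline (by simp)) (hl.comp_of_eq hline (by simp))
  have hPk : ∀ k, AnalyticAt 𝕜 (fun ρ => P ρ k) 0 := fun k => analyticAt_pi_iff.1 hPa k
  have hpr : ∀ k : Fin 3, ∀ z, AnalyticAt 𝕜 (fun z : Fin 3 → 𝕜 => z k) z := fun k z =>
    (ContinuousLinearMap.proj (R := 𝕜) (φ := fun _ : Fin 3 => 𝕜) k).analyticAt z
  -- The simple wave is given implicitly by `g = x + μ(g) y + λ(g) t`, whose right-hand side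
  -- vanishes identically at the origin.
  have hf : AnalyticAt 𝕜 (fun p : (Fin 3 → 𝕜) × 𝕜 => ∑ k, P p.2 k * p.1 k) (0, 0) :=
    Finset.analyticAt_fun_sum _ fun k _ => ((hPk k).comp_of_eq analyticAt_snd rfl).mul
      ((hpr k _).comp analyticAt_fst)
  obtain ⟨g, hg, hg0, hgeq, -⟩ := exists_analytic_fixedPoint (x₀ := (0 : 𝕜)) hf
    (Eventually.of_forall fun x => by simp)
  have hder : ∀ᶠ z in 𝓝 (0 : Fin 3 → 𝕜), ∀ k, pd k g z =
      P (g z) k + (∑ j, deriv (fun ρ => P ρ j) (g z) * z j) * pd k g z := by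
    have hPe : ∀ᶠ z in 𝓝 (0 : Fin 3 → 𝕜), ∀ k, AnalyticAt 𝕜 (fun ρ => P ρ k) (g z) :=
      eventually_all.2 fun k =>
        (tendsto_of_analyticAt hg hg0).eventually (hPk k).eventually_analyticAt
    filter_upwards [hgeq.eventually_nhds, hg.eventually_analyticAt, hPe] with z h1 h2 h3 k
    have hterm : ∀ j, HasFDerivAt (fun z => P (g z) j * z j) _ z := fun j =>
      HasFDerivAt.fun_mul
        ((h3 j).differentiableAt.hasDerivAt.comp_hasFDerivAt z h2.differentiableAt.hasFDerivAt)
        (ContinuousLinearMap.proj (R := 𝕜) (φ := fun _ : Fin 3 => 𝕜) j).hasFDerivAt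
    have h4 : HasFDerivAt (fun z => ∑ j, P (g z) j * z j) _ z := HasFDerivAt.fun_sum
      fun j _ => hterm j
    have h5 : fderiv 𝕜 g z = _ := (Filter.EventuallyEq.fderiv_eq h1).trans h4.fderiv
    have h6 := congrArg (fun L => L (Pi.single k 1)) h5
    simp only [sum_apply, add_apply, smul_apply,
      ContinuousLinearMap.proj_apply, smul_eq_mul, Pi.single_apply, mul_ite, mul_one, mul_zero,
      Finset.sum_add_distrib, Finset.sum_ite_eq', Finset.mem_univ,
      if_true] at h6
    refine Eq.trans h6 ?_
    rw [Finset.sum_mul]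
    congr 1
    exact Finset.sum_congr rfl fun j _ => by unfold pd; ring
  have hK : ∀ᶠ z in 𝓝 (0 : Fin 3 → 𝕜), ∑ j, deriv (fun ρ => P ρ j) (g z) * z j ≠ 1 := by
    have hc : ContinuousAt (fun z : Fin 3 → 𝕜 => ∑ j, deriv (fun ρ => P ρ j) (g z) * z j) 0 := by
      refine tendsto_finsetSum _ fun j _ => ContinuousAt.mul (f := fun z : Fin 3 → 𝕜 => _) ?_
        (continuous_apply j).continuousAt
      exact ((hPk j).deriv.comp_of_eq hg hg0).continuousAt
    exact hc.eventually_ne (by simp)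
  have hP0 : P 0 = speedVec (mu i R₀) (lam i R₀) := by simp [hP]
  refine ⟨g, hg, hg0, fun k => ?_, ?_⟩
  · have := hder.self_of_nhds k
    rw [hg0, hP0] at this
    simpa using this
  · filter_upwards [hder, hK] with z h1 h2 k
    have e0 := h1 0
    have ek := h1 k
    have hp0 : P (g z) 0 = 1 := rfl
    rw [hp0] at e0
    change pd k g z = P (g z) k * pd 0 g z
    set K := ∑ j, deriv (fun ρ => P ρ j) (g z) * z j
    -- Implicit differentiation gives `(1 - K) ∂_k g = P_k(g)`. Since `P_0 = 1` and `K ≠ 1` near the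
    -- origin, the derivatives are proportional to the `P_k`.
    have h3 : (1 - K) * (pd k g z - P (g z) k * pd 0 g z) = 0 := by
      linear_combination ek - P (g z) k * e0
    exact sub_eq_zero.1 ((mul_eq_zero.1 h3).resolve_left (sub_ne_zero.2 h2.symm))

theorem eq_smul_sqMat_of_symm {V : SymMat 𝕜} {ξ : Fin 3 → 𝕜} (h0 : ξ 0 = 1)
    (h : ∀ a c k, V.1 a c * ξ k = V.1 a k * ξ c) : V = V.1 0 0 • sqMat ξ := by
  have h1 : ∀ a k, V.1 a k = V.1 a 0 * ξ k := fun a k => by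
    have := h a k 0
    rw [h0, mul_one] at this
    exact this
  refine symMat_ext fun a k => ?_
  change _ = V.1 0 0 * (ξ a * ξ k)
  rw [h1 a k, symMat_symm V a 0, h1 0 a, mul_assoc]

/-- The derivatives of `U` along the phases of a reduction. -/
theorem IsReduction.pd_eq (h : IsReduction M n D U lam mu) {R : Fin n → 𝕜} (hR : R ∈ D) :
    U R ∈ M ∧ ∀ i, (pd i U R).1 0 0 ≠ 0 ∧
      pd i U R = (pd i U R).1 0 0 • sqMat (speedVec (mu i R) (lam i R)) := by
  have key : ∀ i, U R ∈ M ∧ pd i U R = (pd i U R).1 0 0 • sqMat (speedVec (mu i R) (lam i R)) := by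
    intro i
    obtain ⟨g, hg, hg0, hgd, hge⟩ := exists_simple_wave i (h.analytic_lam i R hR)
      (h.analytic_mu i R hR)
    set r : (Fin 3 → 𝕜) → Fin n → 𝕜 := fun z => R + g z • Pi.single i 1 with hr
    have hr0 : r 0 = R := by simp [hr, hg0]
    have hra : ∀ {z}, AnalyticAt 𝕜 g z → AnalyticAt 𝕜 r z := fun hz =>
      analyticAt_const.add (hz.fun_smul analyticAt_const)
    have hrd : ∀ {z}, AnalyticAt 𝕜 g z → ∀ k j, pd k (fun w => r w j) z =
        pd k g z * (Pi.single i (1 : 𝕜) : Fin n → 𝕜) j := by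
      intro z hz k j
      have h1 : HasFDerivAt (fun w => r w j) _ z :=
        (hz.differentiableAt.hasFDerivAt.mul_const' ((Pi.single i (1 : 𝕜) : Fin n → 𝕜) j)).const_add
          (R j)
      unfold pd
      rw [h1.fderiv]
      rfl
    have hX : ∀ᶠ z in 𝓝 (0 : Fin 3 → 𝕜), AnalyticAt 𝕜 g z ∧ r z ∈ D ∧ ∀ k, pd k g z =
        speedVec (mu i (r z)) (lam i (r z)) k * pd 0 g z :=
      hg.eventually_analyticAt.and
        (((tendsto_of_analyticAt (hra hg) hr0).eventually (h.isOpen.mem_nhds hR)).and hge)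
    obtain ⟨X, hX, hXo, hX0⟩ := eventually_nhds_iff.1 hX
    have hsol : IsHydroSolution n D lam mu X r := by
      refine ⟨hXo, fun z hz => hra (hX z hz).1, fun z hz => (hX z hz).2.1, ?_, ?_⟩
      · intro z hz j
        rw [hrd (hX z hz).1, hrd (hX z hz).1]
        by_cases hj : j = i
        · subst hj; rw [(hX z hz).2.2 2]; simp [speedVec]
        · simp [hj]
      · intro z hz j
        rw [hrd (hX z hz).1, hrd (hX z hz).1]
        by_cases hj : j = i
        · subst hj; rw [(hX z hz).2.2 1]; simp [speedVec]
        · simp [hj]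
    obtain ⟨hM, hsym⟩ := h.solves X r hsol 0 hX0
    rw [hr0] at hM
    refine ⟨hM, eq_smul_sqMat_of_symm rfl fun a c k => ?_⟩
    have hUa : AnalyticAt 𝕜 U (r 0) := by rw [hr0]; exact h.analytic_U R hR
    have hUr : DifferentiableAt 𝕜 (fun w => U (r w)) 0 :=
      (hUa.comp (hra hg)).differentiableAt
    have hpr : ∀ k, pd k r 0 = speedVec (mu i R) (lam i R) k • Pi.single i 1 := by
      intro k
      have h1 : HasFDerivAt r _ 0 :=
        (hg.differentiableAt.hasFDerivAt.smul_const (Pi.single i (1 : 𝕜) : Fin n → 𝕜)).const_add R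
      rw [← hgd k]
      unfold pd
      rw [h1.fderiv]
      rfl
    have hpd : ∀ a c k, pd k (fun w => (U (r w)).1 a c) 0 =
        (pd i U R).1 a c * speedVec (mu i R) (lam i R) k := by
      intro a c k
      rw [pd_entry k a c hUr, pd_comp k hUa.differentiableAt (hra hg).differentiableAt, hpr, map_smul,
        hr0]
      exact mul_comm _ _
    have := hsym a c k
    rwa [hpd, hpd] at this
  -- Without phases there is no simple wave, and membership in `M` comes from the constant solution.
  by_cases hn : Nonempty (Fin n)
  · refine ⟨(key hn.some).1, fun i => ⟨fun h0 => h.effective R hR i ?_, (key i).2⟩⟩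
    rw [(key i).2, h0, zero_smul]
  · rw [not_nonempty_iff] at hn
    refine ⟨?_, fun i => hn.elim i⟩
    have hsol : IsHydroSolution n D lam mu univ fun _ => R :=
      ⟨isOpen_univ, fun _ _ => analyticAt_const, fun _ _ => hR, fun _ _ i => hn.elim i,
        fun _ _ i => hn.elim i⟩
    exact (h.solves _ _ hsol 0 (mem_univ _)).1

/-- A map with characteristic derivatives of finite speeds is a reduction. -/
theorem isReduction_of_pd_eq (hD : IsOpen D) (hU : AnalyticOnNhd 𝕜 U D)
    (hl : ∀ i, AnalyticOnNhd 𝕜 (lam i) D) (hm : ∀ i, AnalyticOnNhd 𝕜 (mu i) D)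
    (hdist : ∀ R ∈ D, ∀ i j, i ≠ j → (lam i R, mu i R) ≠ (lam j R, mu j R))
    (hM : ∀ R ∈ D, U R ∈ M) (h0 : ∀ R ∈ D, ∀ i, (pd i U R).1 0 0 ≠ 0)
    (hpd : ∀ R ∈ D, ∀ i, pd i U R = (pd i U R).1 0 0 • sqMat (speedVec (mu i R) (lam i R))) :
    IsReduction M n D U lam mu := by
  refine ⟨hD, hU, hl, hm, hdist, ?_, fun R hR i h => h0 R hR i (by rw [h]; rfl), ?_⟩
  · intro R hR i j hij
    set f : Fin n → (Fin n → 𝕜) → 𝕜 := fun i R => (pd i U R).1 0 0 with hf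
    have ha : ∀ i, AnalyticAt 𝕜 (f i) R := fun i =>
      ((entryL (𝕜 := 𝕜) 0 0).analyticAt _).comp (analyticAt_pd i (hU R hR))
    have hen : ∀ (i j : Fin n) (a c : Fin 3), pd j (fun R => (pd i U R).1 a c) R =
        pd i (fun R => (pd j U R).1 a c) R := by
      intro i j a c
      rw [pd_entry j a c (analyticAt_pd i (hU R hR)).differentiableAt,
        pd_entry i a c (analyticAt_pd j (hU R hR)).differentiableAt, pd_pd_comm j i (hU R hR)]
    have hev : ∀ (i : Fin n) (a c : Fin 3), (fun R => (pd i U R).1 a c) =ᶠ[𝓝 R] fun R =>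
        f i R • (speedVec (mu i R) (lam i R) a * speedVec (mu i R) (lam i R) c) := by
      intro i a c
      filter_upwards [hD.mem_nhds hR] with R hR
      exact congrArg (fun V : SymMat 𝕜 => V.1 a c) (hpd R hR i)
    have hmul : ∀ {u v : (Fin n → 𝕜) → 𝕜} (j : Fin n), AnalyticAt 𝕜 u R → AnalyticAt 𝕜 v R →
        pd j (fun R => u R * v R) R = u R * pd j v R + pd j u R * v R := fun j hu hv =>
      pd_smul j hu.differentiableAt hv.differentiableAt
    have hsa : ∀ i a, AnalyticAt 𝕜 (fun R => speedVec (mu i R) (lam i R) a) R := fun i =>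
      analyticAt_pi_iff.1 (analyticAt_speedVec (hm i R hR) (hl i R hR))
    have hexp : ∀ (i j : Fin n) (a c : Fin 3), pd j (fun R => (pd i U R).1 a c) R =
        f i R * (speedVec (mu i R) (lam i R) a * pd j (fun R => speedVec (mu i R) (lam i R) c) R +
          pd j (fun R => speedVec (mu i R) (lam i R) a) R * speedVec (mu i R) (lam i R) c) +
        pd j (f i) R * (speedVec (mu i R) (lam i R) a * speedVec (mu i R) (lam i R) c) := by
      intro i j a c
      rw [pd_congr j (hev i a c), ← hmul j (hsa i a) (hsa i c)]
      exact hmul j (ha i) ((hsa i a).mul (hsa i c))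
    have s0 : ∀ i j, pd j (fun R => speedVec (mu i R) (lam i R) 0) R = 0 := fun i j => by
      change pd j (fun _ => (1 : 𝕜)) R = 0
      simp [pd]
    have s1 : ∀ i j, pd j (fun R => speedVec (mu i R) (lam i R) 1) R = pd j (mu i) R :=
      fun i j => rfl
    have s2 : ∀ i j, pd j (fun R => speedVec (mu i R) (lam i R) 2) R = pd j (lam i) R :=
      fun i j => rfl
    have v0 : ∀ i, speedVec (mu i R) (lam i R) 0 = 1 := fun i => rfl
    have v1 : ∀ i, speedVec (mu i R) (lam i R) 1 = mu i R := fun i => rfl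
    have v2 : ∀ i, speedVec (mu i R) (lam i R) 2 = lam i R := fun i => rfl
    have E : ∀ a c, _ := fun a c => (hexp i j a c).symm.trans ((hen i j a c).trans (hexp j i a c))
    have e00 := E 0 0
    have e01 := E 0 1
    have e02 := E 0 2
    have e11 := E 1 1
    have e12 := E 1 2
    have e22 := E 2 2
    simp only [s0, s1, s2, v0, v1, v2] at e00 e01 e02 e11 e12 e22
    set m := mu i R - mu j R with hmdef
    set l := lam i R - lam j R with hldef
    set A := f i R * pd j (mu i) R
    set B := f i R * pd j (lam i) R
    set h := pd j (f i) R
    -- Put `A' = f_j ∂_iμ_j` and `B' = f_j ∂_iλ_j`. The entries 00, 01, 02 give `A - A' = -h m` and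
    -- `B - B' = -h l`. The entries 11, 22, 12 then become `m(A + A') = 0`, `l(B + B') = 0` and `m(B
    -- + B') + l(A + A') = 0`. Hence `2(l A - m B) = l(A + A') - m(B + B')` is annihilated by both
    -- `m` and `l`, which are not both zero since the speeds are distinct.
    have k1 : m * (l * A - m * B) = 0 := by grind
    have k2 : l * (l * A - m * B) = 0 := by grind
    have k3 : l * A - m * B = 0 := by
      rcases mul_eq_zero.1 k1 with h | h
      · rcases mul_eq_zero.1 k2 with h' | h'
        · exact absurd (by rw [sub_eq_zero.1 h, sub_eq_zero.1 h']) (hdist R hR i j hij)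
        · exact h'
      · exact h
    apply mul_left_cancel₀ (h0 R hR i)
    change f i R * _ = f i R * _
    linear_combination k3
  · intro X r hr z hz
    refine ⟨hM _ (hr.mapsTo hz), fun a c k => ?_⟩
    have hrD := hr.mapsTo hz
    have hra := hr.analytic z hz
    have hUr : DifferentiableAt 𝕜 (fun w => U (r w)) z :=
      ((hU _ hrD).comp hra).differentiableAt
    have hpr : ∀ i (k : Fin 3), pd k r z i =
        speedVec (mu i (r z)) (lam i (r z)) k * pd 0 r z i := by
      intro i k
      have hc : ∀ k : Fin 3, pd k r z i = pd k (fun w => r w i) z := fun k => by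
        have h1 := pd_comp (g := ContinuousLinearMap.proj (R := 𝕜) (φ := fun _ : Fin n => 𝕜) i) k
          (ContinuousLinearMap.differentiableAt _) hra.differentiableAt
        rw [ContinuousLinearMap.fderiv] at h1
        exact h1.symm
      rw [hc, hc]
      fin_cases k
      · exact (one_mul _).symm
      · exact hr.eq_y z hz i
      · exact hr.eq_t z hz i
    -- Along a solution the derivative is a sum of cubes of the directions `ξ_i` with weights `R^i_x
    -- f_i`. Its symmetry in all three indices is the closure condition.
    have hpd' : ∀ a c k : Fin 3, pd k (fun w => (U (r w)).1 a c) z =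
        ∑ i, pd 0 r z i * (pd i U (r z)).1 0 0 * (speedVec (mu i (r z)) (lam i (r z)) a *
          speedVec (mu i (r z)) (lam i (r z)) c * speedVec (mu i (r z)) (lam i (r z)) k) := by
      intro a c k
      rw [pd_entry k a c hUr, pd_comp k (hU _ hrD).differentiableAt hra.differentiableAt,
        fderiv_eq_sum_pd, ← entryL_apply, map_sum]
      refine Finset.sum_congr rfl fun i _ => ?_
      rw [map_smul, hpd _ hrD i, hpr i k, entryL_apply]
      have : (pd i U (r z)).1 0 0 = ((pd i U (r z)).1 0 0 • sqMat (speedVec (mu i (r z))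
        (lam i (r z)))).1 0 0 := by rw [← hpd _ hrD i]
      change _ * pd 0 r z i * ((pd i U (r z)).1 0 0 * (_ * _)) = _
      rw [← this]
      ring
    rw [hpd', hpd']
    exact Finset.sum_congr rfl fun i _ => by ring

end Reduction

/-! ### Coordinate nets of line fields in the plane -/

section FlowBox

/-- A direction field in the plane which is nowhere vertical. -/
theorem exists_first_integral {i j : Fin 2} (hij : i ≠ j) {τ : (Fin 2 → 𝕜) → 𝕜}
    (hτ : AnalyticAt 𝕜 τ 0) :
    ∃ p : (Fin 2 → 𝕜) → 𝕜, AnalyticAt 𝕜 p 0 ∧ p 0 = 0 ∧ pd j p 0 = 1 ∧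
      ∀ᶠ R in 𝓝 0, fderiv 𝕜 p R (Pi.single i 1 + τ R • Pi.single j 1) = 0 := by
  have huniv : ∀ k : Fin 2, k = i ∨ k = j := by
    intro k; fin_cases i <;> fin_cases j <;> fin_cases k <;> simp_all
  set Ei : Fin 2 → 𝕜 := Pi.single i 1 with hEi
  set Ej : Fin 2 → 𝕜 := Pi.single j 1 with hEj
  have hEii : Ei i = 1 := by simp [hEi]
  have hEij : Ei j = 0 := by simp [hEi, hij.symm]
  have hEji : Ej i = 0 := by simp [hEj, hij]
  have hEjj : Ej j = 1 := by simp [hEj]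
  have hpr : ∀ (k : Fin 2) (R : Fin 2 → 𝕜), AnalyticAt 𝕜 (fun R : Fin 2 → 𝕜 => R k) R :=
    fun k R => (ContinuousLinearMap.proj (R := 𝕜) (φ := fun _ : Fin 2 => 𝕜) k).analyticAt R
  have hin : AnalyticAt 𝕜 (fun p : (Fin 2 → 𝕜) × 𝕜 => p.1 i • Ei + p.2 • Ej) (0, 0) :=
    (((hpr i _).comp_of_eq analyticAt_fst rfl).fun_smul analyticAt_const).add
      (analyticAt_snd.fun_smul analyticAt_const)
  -- `w` is the height reached along the direction field from the height `R j` on the axis. Thus `H`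
  -- carries the lines `R j = const` to integral curves, and the first integral is the `j`-th
  -- component of the inverse of `H`.
  obtain ⟨w, hw, hev⟩ := exists_analytic_ode i
    (fun p : (Fin 2 → 𝕜) × 𝕜 => τ (p.1 i • Ei + p.2 • Ej)) (fun R => R j) (hpr j 0)
    (fun c R => by simp [scaleOn, hij.symm]) (hτ.comp_of_eq hin (by simp))
  set H : (Fin 2 → 𝕜) → Fin 2 → 𝕜 := fun R => R i • Ei + w R • Ej with hH
  have hHd : ∀ {R}, AnalyticAt 𝕜 w R → ∀ v, fderiv 𝕜 H R v = v i • Ei + fderiv 𝕜 w R v • Ej := by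
    intro R hR v
    have h1 : HasFDerivAt H _ R :=
      ((ContinuousLinearMap.proj (R := 𝕜) (φ := fun _ : Fin 2 => 𝕜) i).hasFDerivAt.smul_const
        Ei).add (hR.differentiableAt.hasFDerivAt.smul_const Ej)
    rw [h1.fderiv]
    rfl
  have hHa : AnalyticAt 𝕜 H 0 :=
    ((hpr i 0).fun_smul analyticAt_const).add (hw.fun_smul analyticAt_const)
  have hax : ∀ᶠ t in 𝓝 (0 : 𝕜), w (t • Ej) = t := by
    have ht : Tendsto (fun t : 𝕜 => t • Ej) (𝓝 0) (𝓝 0) := by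
      have : Continuous fun t : 𝕜 => t • Ej := by fun_prop
      simpa using this.tendsto 0
    filter_upwards [ht.eventually hev] with t h1
    have h2 : scaleOn {i} 0 (t • Ej) = t • Ej := by
      funext k
      rcases huniv k with rfl | rfl
      · simp [scaleOn, hEji]
      · simp [scaleOn, hij.symm]
    have := h1.1
    rw [h2] at this
    simpa [hEjj] using this
  have hw0 : w 0 = 0 := by simpa using hax.self_of_nhds
  have hH0 : H 0 = 0 := by simp [hH, hw0]
  have hpj : fderiv 𝕜 w 0 Ej = 1 := by
    have h1 : HasDerivAt (fun t : 𝕜 => t • Ej) Ej 0 := by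
      simpa using (hasDerivAt_id (0 : 𝕜)).smul_const Ej
    have h2 : HasFDerivAt w (fderiv 𝕜 w 0) ((0 : 𝕜) • Ej) := by
      rw [zero_smul]; exact hw.differentiableAt.hasFDerivAt
    have h3 := h2.comp_hasDerivAt 0 h1
    exact (h3.congr_of_eventuallyEq (hax.mono fun t h => h.symm)).unique (hasDerivAt_id 0)
  have hdec : ∀ v : Fin 2 → 𝕜, v = v i • Ei + v j • Ej := by
    intro v
    funext k
    rcases huniv k with rfl | rfl
    · simp [hEii, hEji]
    · simp [hEij, hEjj]
  obtain ⟨g, hg, hg0, hgr, hgl⟩ := exists_analytic_inverse_of_injective hHa rfl (fun v hv => by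
    rw [hHd hw] at hv
    have h1 : v i = 0 := by
      have := congrFun hv i
      simpa [hEii, hEji] using this
    have h2 : fderiv 𝕜 w 0 v = 0 := by
      have := congrFun hv j
      simpa [hEij, hEjj] using this
    rw [hdec v, h1, zero_smul, zero_add, map_smul, hpj] at h2
    have h3 : v j = 0 := by simpa using h2
    rw [hdec v, h1, h3]
    simp)
  rw [hH0] at hg hg0 hgr
  have hpa : AnalyticAt 𝕜 (fun R => g R j) 0 := (hpr j _).comp_of_eq hg rfl
  have key : ∀ᶠ R in 𝓝 0, ∀ v, fderiv 𝕜 (fun R => g R j) (H R)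
      (v i • Ei + fderiv 𝕜 w R v • Ej) = v j := by
    filter_upwards [hgl.eventually_nhds, hw.eventually_analyticAt, hHa.eventually_analyticAt,
      (tendsto_of_analyticAt hHa hH0).eventually hpa.eventually_analyticAt] with R h1 h2 h3 h4 v
    have h5 : HasFDerivAt (fun R => g (H R) j) _ R :=
      h4.differentiableAt.hasFDerivAt.comp R h3.differentiableAt.hasFDerivAt
    have h6 : (fun R => g (H R) j) =ᶠ[𝓝 R] fun R => R j := h1.mono fun R h => congrFun h j
    have h7 := Filter.EventuallyEq.fderiv_eq (𝕜 := 𝕜) h6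
    rw [h5.fderiv] at h7
    have h8 := DFunLike.congr_fun h7 v
    have h9 : fderiv 𝕜 (fun R : Fin 2 → 𝕜 => R j) R v = v j := by
      have h10 : HasFDerivAt (fun R : Fin 2 → 𝕜 => R j) _ R :=
        (ContinuousLinearMap.proj (R := 𝕜) (φ := fun _ : Fin 2 => 𝕜) j).hasFDerivAt
      rw [h10.fderiv]
      rfl
    rw [h9] at h8
    rw [← hHd h2]
    exact h8
  refine ⟨fun R => g R j, hpa, by simp [hg0], ?_, ?_⟩
  · have h1 := key.self_of_nhds Ej
    rw [hH0, hEji, zero_smul, zero_add, hpj, one_smul, hEjj] at h1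
    exact h1
  · filter_upwards [(tendsto_of_analyticAt hg hg0).eventually key,
      (tendsto_of_analyticAt hg hg0).eventually hev, hgr] with R h1 h2 h3
    have h4 := h1 Ei
    have h5 := h2.2
    have h6 : fderiv 𝕜 w (g R) Ei = τ (H (g R)) := h5
    rw [h6, h3, hEii, one_smul, hEij] at h4
    exact h4

/-- Two transversal direction fields in the plane are the coordinate directions in suitable
coordinates. -/
theorem exists_net_coordinates {τ : Fin 2 → (Fin 2 → 𝕜) → 𝕜} (hτ : ∀ i, AnalyticAt 𝕜 (τ i) 0)
    (hτ0 : ∀ i, τ i 0 = 0) :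
    ∃ T : (Fin 2 → 𝕜) → Fin 2 → 𝕜, AnalyticAt 𝕜 T 0 ∧ T 0 = 0 ∧
      Function.Injective (fderiv 𝕜 T 0) ∧ ∀ᶠ R in 𝓝 0, ∀ i, ∃ k : 𝕜, k ≠ 0 ∧
        pd i T R = k • (Pi.single i 1 + τ i (T R) • Pi.single (1 - i) 1) := by
  have hne : ∀ i : Fin 2, i ≠ 1 - i := by decide
  have hinv : ∀ i : Fin 2, 1 - (1 - i) = i := by decide
  -- `p i` is a first integral of the field with index `1 - i`. In the coordinates `P = (p 0, p 1)`
  -- the `i`-th coordinate line keeps `p (1 - i)` constant, so it is an integral curve of the `i`-th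
  -- field.
  choose p hp hp0 hp1 hpe using fun i => exists_first_integral (hne i).symm (hτ (1 - i))
  set P : (Fin 2 → 𝕜) → Fin 2 → 𝕜 := fun R i => p i R with hP
  have hPa : AnalyticAt 𝕜 P 0 := analyticAt_pi_iff.2 hp
  have hP0 : P 0 = 0 := funext hp0
  have hPd : ∀ {R}, (∀ i, AnalyticAt 𝕜 (p i) R) → ∀ v i, fderiv 𝕜 P R v i = fderiv 𝕜 (p i) R v := by
    intro R hR v i
    have h1 : HasFDerivAt P _ R := hasFDerivAt_pi.2 fun i => (hR i).differentiableAt.hasFDerivAt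
    rw [h1.fderiv]; rfl
  have hd0 : ∀ v i, fderiv 𝕜 (p i) 0 v = v i := by
    intro v i
    have h1 := (hpe i).self_of_nhds
    rw [hτ0, zero_smul, add_zero] at h1
    have h2 := fderiv_eq_sum_pd (p i) 0 v
    have h3 : ∑ k, v k • pd k (p i) 0 = v i • pd i (p i) 0 + v (1 - i) • pd (1 - i) (p i) 0 := by
      rw [Fin.sum_univ_two]
      fin_cases i
      · rfl
      · exact add_comm _ _
    rw [h2, h3, hp1]
    change _ + _ • fderiv 𝕜 (p i) 0 _ = _
    rw [h1]
    simp
  have hPinj : ∀ v, fderiv 𝕜 P 0 v = 0 → v = 0 := fun v hv => by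
    funext i
    rw [← hd0 v i, ← hPd hp, hv]
  obtain ⟨T, hT, hT0, hTr, hTl⟩ := exists_analytic_inverse_of_injective hPa rfl hPinj
  rw [hP0] at hT hT0 hTr
  have tT := tendsto_of_analyticAt hT hT0
  have hPi : ∀ᶠ R in 𝓝 0, Function.Injective (fderiv 𝕜 P R) :=
    eventually_injective_fderiv hPa ((injective_iff_map_eq_zero _).2 hPinj)
  have hPT : ∀ᶠ R in 𝓝 0, ∀ v, fderiv 𝕜 P (T R) (fderiv 𝕜 T R v) = v := by
    filter_upwards [hTr.eventually_nhds, hT.eventually_analyticAt,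
      tT.eventually hPa.eventually_analyticAt] with R h1 h2 h3 v
    have h4 : HasFDerivAt (fun R => P (T R)) _ R :=
      h3.differentiableAt.hasFDerivAt.comp R h2.differentiableAt.hasFDerivAt
    have h5 : HasFDerivAt (fun R => P (T R)) (ContinuousLinearMap.id 𝕜 _) R :=
      (hasFDerivAt_id R).congr_of_eventuallyEq h1
    exact congrArg (fun L => L v) (h4.unique h5)
  refine ⟨T, hT, hT0, ?_, ?_⟩
  · intro v w hvw
    have h1 := hPT.self_of_nhds
    rw [← h1 v, hvw, h1]
  · have hk : ∀ᶠ R in 𝓝 (0 : Fin 2 → 𝕜), ∀ i,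
        fderiv 𝕜 (p i) R (Pi.single i 1 + τ i R • Pi.single (1 - i) 1) ≠ 0 := by
      refine eventually_all.2 fun i => ContinuousAt.eventually_ne ?_ ?_
      · exact (analyticAt_clm_apply (hp i).fderiv (analyticAt_const.add
          ((hτ i).fun_smul analyticAt_const))).continuousAt
      · rw [hd0, hτ0]; simp
    have hpall : ∀ᶠ R in 𝓝 (0 : Fin 2 → 𝕜), ∀ i, AnalyticAt 𝕜 (p i) R :=
      eventually_all.2 fun i => (hp i).eventually_analyticAt
    have hpe' : ∀ᶠ R in 𝓝 (0 : Fin 2 → 𝕜), ∀ i, fderiv 𝕜 (p i) R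
        (Pi.single (1 - i) 1 + τ (1 - i) R • Pi.single i 1) = 0 := eventually_all.2 hpe
    filter_upwards [hPT, tT.eventually hk, tT.eventually hpall, tT.eventually hPi,
      tT.eventually hpe'] with R h1 h2 h3 h4 h5 i
    set v : Fin 2 → 𝕜 := Pi.single i 1 + τ i (T R) • Pi.single (1 - i) 1
    refine ⟨(fderiv 𝕜 (p i) (T R) v)⁻¹, inv_ne_zero (h2 i), ?_⟩
    apply h4
    rw [map_smul]
    change fderiv 𝕜 P (T R) (fderiv 𝕜 T R (Pi.single i 1)) = _
    rw [h1]
    funext k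
    rw [Pi.smul_apply, hPd h3]
    by_cases hki : k = i
    · subst hki
      rw [Pi.single_eq_same, smul_eq_mul, inv_mul_cancel₀ (h2 k)]
    · obtain rfl : k = 1 - i := by
        clear_value v; revert hki; revert k i; decide
      have := h5 (1 - i)
      rw [hinv] at this
      rw [this, Pi.single_eq_of_ne hki, smul_zero]

end FlowBox

/-! ### Bisecant surfaces are holonomic -/

section Bisecant

variable {n : ℕ} {S : Set (SymMat 𝕜)} {D : Set (Fin n → 𝕜)} {χ : (Fin n → 𝕜) → SymMat 𝕜}
  {R₁ : Fin n → 𝕜} {F : SymMat 𝕜 → 𝕜} {s : SymMat 𝕜} {Ω : Set (SymMat 𝕜)}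

theorem IsCharacteristic.smul {V : SymMat 𝕜} (h : IsCharacteristic F s V) {k : 𝕜} (hk : k ≠ 0) :
    IsCharacteristic F s (k • V) := by
  refine ⟨by rw [map_smul, h.1, smul_zero], ?_⟩
  obtain ⟨a, ζ, ha, hζ, rfl⟩ := exists_eq_smul_sqMat h.2
  rw [smul_smul]
  exact rank_smul_sqMat (mul_ne_zero hk ha) hζ

theorem IsCharacteristic.exists_vec {V : SymMat 𝕜} (h : IsCharacteristic F s V) :
    ∃ (a : 𝕜) (ζ : Fin 3 → 𝕜), a ≠ 0 ∧ ζ ≠ 0 ∧ V = a • sqMat ζ ∧ fderiv 𝕜 F s (sqMat ζ) = 0 := by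
  obtain ⟨a, ζ, ha, hζ, rfl⟩ := exists_eq_smul_sqMat h.2
  have h1 := h.1
  rw [map_smul] at h1
  exact ⟨a, ζ, ha, hζ, rfl, (smul_eq_zero.1 h1).resolve_left ha⟩

theorem linearIndependent_pair {X : Type*} [AddCommGroup X] [Module 𝕜 X] {V : Fin n → X}
    (hV : LinearIndependent 𝕜 V) {i j : Fin n} (hij : i ≠ j) : LinearIndependent 𝕜 ![V i, V j] := by
  have := hV.comp ![i, j] (by
    intro p q hpq
    fin_cases p <;> fin_cases q <;> simp_all)
  convert this using 1
  funext p
  fin_cases p <;> rfl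

theorem linearIndependent_pair_of_sqMat {V : Fin n → SymMat 𝕜} {a : Fin n → 𝕜}
    {ξ : Fin n → Fin 3 → 𝕜} (hV : LinearIndependent 𝕜 V) (ha : ∀ i, a i ≠ 0)
    (hVa : ∀ i, V i = a i • sqMat (ξ i)) {i j : Fin n} (hij : i ≠ j) :
    LinearIndependent 𝕜 ![ξ i, ξ j] := by
  have hi : ξ i ≠ 0 := by
    intro h
    apply hV.ne_zero i
    rw [hVa, h]
    exact symMat_ext fun p q => by
      change a i * (0 * 0) = 0
      ring
  rw [LinearIndependent.pair_iff' hi]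
  intro c hc
  have h1 := linearIndependent_pair hV hij
  rw [LinearIndependent.pair_iff' (hV.ne_zero i)] at h1
  apply h1 (a j * c ^ 2 / a i)
  rw [hVa, hVa, ← hc, sqMat_smul, smul_smul, smul_smul, div_mul_cancel₀ _ (ha i)]

/-- Linear changes of parameters. -/
theorem IsLocalParam.exists_of_tangent (h : IsLocalParam n S D χ) (hR : R₁ ∈ D)
    {W : Fin n → SymMat 𝕜} (hW : LinearIndependent 𝕜 W) (hWr : ∀ i, W i ∈ range (fderiv 𝕜 χ R₁)) :
    ∃ (D' : Set (Fin n → 𝕜)) (φ : (Fin n → 𝕜) → SymMat 𝕜), IsLocalParam n S D' φ ∧ 0 ∈ D' ∧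
      φ 0 = χ R₁ ∧ ∀ i, pd i φ 0 = W i := by
  choose v hv using hWr
  set L : (Fin n → 𝕜) →L[𝕜] (Fin n → 𝕜) :=
    LinearMap.toContinuousLinearMap (Fintype.linearCombination 𝕜 v)
  have hL : ∀ x, L x = ∑ i, x i • v i := fun x => Fintype.linearCombination_apply 𝕜 v x
  set φ : (Fin n → 𝕜) → SymMat 𝕜 := fun x => χ (R₁ + L x) with hφ
  have hin : AnalyticAt 𝕜 (fun x => R₁ + L x) 0 := analyticAt_const.add (L.analyticAt 0)
  have hin0 : R₁ + L 0 = R₁ := by simp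
  have hφa : AnalyticAt 𝕜 φ 0 := (h.analytic R₁ hR).comp_of_eq hin hin0
  have hd : ∀ x, fderiv 𝕜 φ 0 x = ∑ i, x i • W i := by
    intro x
    have h1 : HasFDerivAt (fun x => R₁ + L x) L 0 := L.hasFDerivAt.const_add R₁
    have h2 : HasFDerivAt χ (fderiv 𝕜 χ R₁) (R₁ + L 0) := by
      rw [hin0]; exact (h.analytic R₁ hR).differentiableAt.hasFDerivAt
    have h3 : HasFDerivAt φ _ 0 := h2.comp 0 h1
    rw [h3.fderiv]
    change fderiv 𝕜 χ R₁ (L x) = _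
    rw [hL, map_sum]
    exact Finset.sum_congr rfl fun i _ => by rw [map_smul, hv]
  have hinj : Function.Injective (fderiv 𝕜 φ 0) := (injective_iff_map_eq_zero _).2 fun x hx => by
    rw [hd] at hx
    exact funext (Fintype.linearIndependent_iff.1 hW x hx)
  have hφ0 : φ 0 = χ R₁ := by simp only [hφ, hin0]
  have hS : ∀ᶠ x in 𝓝 0, φ x ∈ S :=
    (tendsto_of_analyticAt hin hin0).eventually
      ((h.eventually_mem hR).mono fun R hR => h.mem hR)
  obtain ⟨D', -, h0, hD'⟩ := h.exists_isLocalParam hR hφa hinj hφ0 hS univ_mem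
  refine ⟨D', φ, hD', h0, hφ0, fun i => ?_⟩
  unfold pd
  rw [hd, Finset.sum_eq_single i (fun j _ hj => by simp [Pi.single_eq_of_ne hj]) (by simp)]
  simp

/-- Reparametrization of a submanifold. -/
theorem IsLocalParam.exists_comp (h : IsLocalParam n S D χ) (hR : R₁ ∈ D)
    {T : (Fin n → 𝕜) → Fin n → 𝕜} {R₀ : Fin n → 𝕜} (hT : AnalyticAt 𝕜 T R₀) (hT0 : T R₀ = R₁)
    (hinj : Function.Injective (fderiv 𝕜 T R₀)) {A : Set (Fin n → 𝕜)} (hA : A ∈ 𝓝 R₀) :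
    ∃ D' ⊆ A, R₀ ∈ D' ∧ IsLocalParam n S D' (fun R => χ (T R)) := by
  subst hT0
  refine h.exists_isLocalParam (φ := fun R => χ (T R)) hR ((h.analytic _ hR).comp hT) ?_ rfl
    (hT.continuousAt.tendsto.eventually ((h.eventually_mem hR).mono fun R hR => h.mem hR)) hA
  have h1 : HasFDerivAt (fun R => χ (T R)) _ R₀ :=
    (h.analytic _ hR).differentiableAt.hasFDerivAt.comp R₀ hT.differentiableAt.hasFDerivAt
  rw [h1.fderiv]
  exact (h.immersion _ hR).comp hinj

/-- A rank-one matrix has zero 2×2 minors. One such minor, restricted to the tangent planes, is a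
binary quadratic form with two simple zeros at the given point, and these continue analytically to
two transversal direction fields. At nearby points the two characteristic lines guaranteed by the
secant condition must be these zeros, so the fields are characteristic, and `exists_net_coordinates`
straightens them. -/
theorem IsSecant.isHolonomic_two (h : IsSecant 2 Ω F S) : IsHolonomic 2 F S := by
  obtain ⟨hsub, -, hsec⟩ := h
  intro s hs
  obtain ⟨V, hV, hVs⟩ := hsec s hs
  obtain ⟨D₀, χ, hχ, R₁, hR₁, rfl⟩ := hsub s hs
  obtain ⟨D, φ, hφ, h0, hφ0, hφd⟩ := hχ.exists_of_tangent hR₁ hV fun i => by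
    rw [← hχ.tangentVectors_eq hR₁]; exact (hVs i).1
  choose a ξ ha hξ hVa hFξ using fun i => (hVs i).2.exists_vec
  have hξi : LinearIndependent 𝕜 ξ := by
    have := linearIndependent_pair_of_sqMat hV ha hVa (i := 0) (j := 1) (by decide)
    convert this using 1
    funext p
    fin_cases p <;> rfl
  obtain ⟨l, hl⟩ := exists_dual hξi
  set m : Fin 2 → Fin 2 → SymMat 𝕜 →L[𝕜] 𝕜 := fun p q => (dotL (l p)).comp (contract (l q))
  -- The polarization of twice the 2×2 minor in the frame dual to the two directions at the point.
  -- Its mixed value there is nonzero, so the minor does not vanish identically on the tangent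
  -- plane.
  set Q : SymMat 𝕜 → SymMat 𝕜 → 𝕜 := fun V W =>
    m 0 0 V * m 1 1 W + m 0 0 W * m 1 1 V - 2 * (m 0 1 V * m 0 1 W) with hQ
  have hms : ∀ p q (c : 𝕜) (ζ : Fin 3 → 𝕜), m p q (c • sqMat ζ) =
      c * (dotL (l q) ζ * dotL (l p) ζ) := by
    intro p q c ζ
    change dotL (l p) (contract (l q) (c • sqMat ζ)) = _
    rw [map_smul, map_smul, contract_sqMat, map_smul]
    rfl
  have hQchar : ∀ W : SymMat 𝕜, W.1.rank = 1 → Q W W = 0 := by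
    intro W hW
    obtain ⟨c, ζ, -, -, rfl⟩ := exists_eq_smul_sqMat hW
    simp only [hQ, hms]
    ring
  have hQexp : ∀ (V W : SymMat 𝕜) (x y : 𝕜), Q (x • V + y • W) (x • V + y • W) =
      x ^ 2 * Q V V + 2 * (x * y) * Q V W + y ^ 2 * Q W W := by
    intro V W x y
    simp only [hQ, map_add, map_smul, smul_eq_mul]
    ring
  set E : Fin 2 → (Fin 2 → 𝕜) → SymMat 𝕜 := fun i R => pd i φ R with hE
  have hφa : AnalyticAt 𝕜 φ 0 := hφ.analytic 0 h0
  have hEa : ∀ i, AnalyticAt 𝕜 (E i) 0 := fun i => analyticAt_pd i hφa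
  have hma : ∀ {X : Type _} [NormedAddCommGroup X] [NormedSpace 𝕜 X] {x : X} {f : X → SymMat 𝕜} p q,
      AnalyticAt 𝕜 f x → AnalyticAt 𝕜 (fun y => m p q (f y)) x := fun p q hf =>
    ((m p q).analyticAt _).comp hf
  have hQa : ∀ {f g : (Fin 2 → 𝕜) → SymMat 𝕜}, AnalyticAt 𝕜 f 0 → AnalyticAt 𝕜 g 0 →
      AnalyticAt 𝕜 (fun R => Q (f R) (g R)) 0 := fun hf hg =>
    ((((hma 0 0 hf).mul (hma 1 1 hg)).add ((hma 0 0 hg).mul (hma 1 1 hf))).sub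
      (analyticAt_const.mul ((hma 0 1 hf).mul (hma 0 1 hg))))
  have hne : ∀ i : Fin 2, i ≠ 1 - i := by decide
  have hE0 : ∀ i, E i 0 = a i • sqMat (ξ i) := fun i => by rw [hE, ← hVa, ← hφd]
  have hQ0 : ∀ i, Q (E i 0) (E i 0) = 0 := fun i => by
    rw [hE0]; exact hQchar _ (rank_smul_sqMat (ha i) (hξ i))
  have hQ1 : ∀ i, Q (E i 0) (E (1 - i) 0) ≠ 0 := by
    intro i
    fin_cases i <;> simp [hE0, hQ, hms, hl, ha]
  have htau : ∀ i, ∃ τ : (Fin 2 → 𝕜) → 𝕜, AnalyticAt 𝕜 τ 0 ∧ τ 0 = 0 ∧ ∀ᶠ R in 𝓝 0,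
      Q (E i R + τ R • E (1 - i) R) (E i R + τ R • E (1 - i) R) = 0 := by
    intro i
    -- The quadratic equation for `τ`, solved for its linear term. At `R = 0` both square
    -- coefficients vanish, so the right-hand side is constant there.
    set f : (Fin 2 → 𝕜) × 𝕜 → 𝕜 := fun p => -(Q (E i p.1) (E i p.1) +
      p.2 ^ 2 * Q (E (1 - i) p.1) (E (1 - i) p.1)) / (2 * Q (E i p.1) (E (1 - i) p.1)) with hf
    have hc : ∀ j k, AnalyticAt 𝕜 (fun p : (Fin 2 → 𝕜) × 𝕜 => Q (E j p.1) (E k p.1)) (0, 0) :=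
      fun j k => (hQa (hEa j) (hEa k)).comp_of_eq analyticAt_fst rfl
    have hfa : AnalyticAt 𝕜 f (0, 0) := by
      refine (((hc i i).add ((analyticAt_snd.pow 2).mul (hc _ _))).neg).div
        (analyticAt_const.mul (hc _ _)) ?_
      exact mul_ne_zero two_ne_zero (hQ1 i)
    obtain ⟨τ, hτ, hτ0, hτe, -⟩ := exists_analytic_fixedPoint (x₀ := (0 : 𝕜)) hfa
      (Eventually.of_forall fun x => by simp only [hf, hQ0]; simp)
    refine ⟨τ, hτ, hτ0, ?_⟩
    filter_upwards [hτe, (hQa (hEa i) (hEa (1 - i))).continuousAt.eventually_ne (hQ1 i)] with R h1 h2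
    have h3 := hQexp (E i R) (E (1 - i) R) 1 (τ R)
    rw [one_smul] at h3
    rw [h3]
    simp only [hf] at h1
    rw [eq_div_iff (mul_ne_zero two_ne_zero h2)] at h1
    linear_combination h1
  choose τ hτ hτ0 hτe using htau
  set w : Fin 2 → (Fin 2 → 𝕜) → SymMat 𝕜 := fun i R => E i R + τ i R • E (1 - i) R with hw
  have hwa : ∀ i, AnalyticAt 𝕜 (w i) 0 := fun i => (hEa i).add ((hτ i).fun_smul (hEa _))
  have hw0 : ∀ i, w i 0 = E i 0 := fun i => by simp [hw, hτ0]
  have hdet : ∀ᶠ R in 𝓝 (0 : Fin 2 → 𝕜), 1 - τ 0 R * τ 1 R ≠ 0 :=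
    (continuousAt_const.sub ((hτ 0).continuousAt.mul (hτ 1).continuousAt)).eventually_ne
      (by simp [hτ0])
  have hQw : ∀ᶠ R in 𝓝 (0 : Fin 2 → 𝕜), Q (w 0 R) (w 1 R) ≠ 0 :=
    (hQa (hwa 0) (hwa 1)).continuousAt.eventually_ne (by rw [hw0, hw0]; exact hQ1 0)
  have hchar : ∀ᶠ R in 𝓝 (0 : Fin 2 → 𝕜), ∀ i, IsCharacteristic F (φ R) (w i R) := by
    filter_upwards [hdet, hQw, hτe 0, hτe 1, hφ.eventually_mem h0] with R h1 h2 h3 h4 hRD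
    obtain ⟨Z, hZ, hZs⟩ := hsec (φ R) (hφ.mem hRD)
    have hcase : ∀ i, ∃ j, ∃ k : 𝕜, k ≠ 0 ∧ Z i = k • w j R := by
      intro i
      have hmem := (hZs i).1
      rw [hφ.tangentVectors_eq hRD] at hmem
      obtain ⟨v, hv⟩ := hmem
      rw [fderiv_eq_sum_pd, Fin.sum_univ_two] at hv
      set x := (v 0 - τ 1 R * v 1) / (1 - τ 0 R * τ 1 R) with hx
      set y := (v 1 - τ 0 R * v 0) / (1 - τ 0 R * τ 1 R) with hy
      have hxm : x * (1 - τ 0 R * τ 1 R) = v 0 - τ 1 R * v 1 := div_mul_cancel₀ _ h1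
      have hym : y * (1 - τ 0 R * τ 1 R) = v 1 - τ 0 R * v 0 := div_mul_cancel₀ _ h1
      have hv0 : v 0 = x + y * τ 1 R :=
        mul_left_cancel₀ h1 (by linear_combination -hxm - τ 1 R * hym)
      have hv1 : v 1 = y + x * τ 0 R :=
        mul_left_cancel₀ h1 (by linear_combination -hym - τ 0 R * hxm)
      have hZe : Z i = x • w 0 R + y • w 1 R := by
        rw [← hv, hv0, hv1]
        simp only [hw, hE, sub_zero, sub_self]
        module
      have h5 := hQchar _ (hZs i).2.2
      rw [hZe, hQexp, show Q (w 0 R) (w 0 R) = 0 from h3, show Q (w 1 R) (w 1 R) = 0 from h4] at h5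
      have h6 : x * y = 0 := by
        have : (2 * Q (w 0 R) (w 1 R)) * (x * y) = 0 := by linear_combination h5
        exact (mul_eq_zero.1 this).resolve_left (mul_ne_zero two_ne_zero h2)
      have hZ0 := hZ.ne_zero i
      rcases mul_eq_zero.1 h6 with h7 | h7
      · rw [h7, zero_smul, zero_add] at hZe
        exact ⟨1, y, fun h => hZ0 (by rw [hZe, h, zero_smul]), hZe⟩
      · rw [h7, zero_smul, add_zero] at hZe
        exact ⟨0, x, fun h => hZ0 (by rw [hZe, h, zero_smul]), hZe⟩
    choose j k hk hZk using hcase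
    have hj : Function.Injective j := by
      intro p q hpq
      by_contra hne'
      have h5 : k q • Z p + (-k p) • Z q = 0 := by
        rw [hZk p, hZk q, hpq, smul_smul, smul_smul]; module
      exact hk q (LinearIndependent.pair_iff.1 (linearIndependent_pair hZ hne') _ _ h5).1
    intro i
    obtain ⟨p, rfl⟩ := (Finite.injective_iff_surjective.1 hj) i
    have h5 := (hZs p).2.smul (inv_ne_zero (hk p))
    rwa [hZk p, smul_smul, inv_mul_cancel₀ (hk p), one_smul] at h5
  obtain ⟨T, hT, hT0, hTi, hTe⟩ := exists_net_coordinates hτ hτ0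
  have tT := tendsto_of_analyticAt hT hT0
  have hA : ∀ᶠ R in 𝓝 (0 : Fin 2 → 𝕜), ∀ i, IsCharacteristic F (φ (T R))
      (pd i (fun R => φ (T R)) R) := by
    filter_upwards [hTe, tT.eventually hchar, hT.eventually_analyticAt,
      tT.eventually hφa.eventually_analyticAt] with R h1 h2 h3 h4 i
    obtain ⟨k, hk, hke⟩ := h1 i
    rw [pd_comp i h4.differentiableAt h3.differentiableAt, hke, map_smul, map_add, map_smul]
    exact (h2 i).smul hk
  obtain ⟨D', hD'A, h0', hD'⟩ := hφ.exists_comp h0 hT hT0 hTi hA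
  exact ⟨D', _, hD', ⟨0, h0', by simp only [hT0, hφ0]⟩, hD'A⟩

end Bisecant

/-! ### Nets on submanifolds -/

section NetOnSubmanifold

variable {n : ℕ} {S : Set (SymMat 𝕜)} {D : Set (Fin n → 𝕜)} {φ χ : (Fin n → 𝕜) → SymMat 𝕜}
  {R₁ : Fin n → 𝕜} {F : SymMat 𝕜 → 𝕜} {s : SymMat 𝕜} {Ω : Set (SymMat 𝕜)}

theorem exists_analytic_sqrt :
    ∃ g : 𝕜 → 𝕜, AnalyticAt 𝕜 g 1 ∧ g 1 = 1 ∧ ∀ᶠ q in 𝓝 (1 : 𝕜), g q ^ 2 = q := by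
  have h : HasFDerivAt (fun x : 𝕜 => x ^ 2) _ 1 := (hasDerivAt_pow 2 (1 : 𝕜)).hasFDerivAt
  obtain ⟨g, hg, hg1, hr, -⟩ := exists_analytic_inverse_of_injective
    (f := fun x : 𝕜 => x ^ 2) (x := 1) (analyticAt_id.pow 2) rfl (fun v hv => by
      rw [h.fderiv] at hv
      simpa using hv)
  simp only [one_pow] at hg hg1 hr
  exact ⟨g, hg, hg1, hr⟩

/-- The vectors of a net with normalized characteristic velocities. -/
theorem exists_isNet_of_rank_one (hφ : AnalyticAt 𝕜 φ 0) (hF : ∀ᶠ R in 𝓝 0, F (φ R) = 0)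
    (hrk : ∀ᶠ R in 𝓝 0, ∀ i, (pd i φ R).1.rank = 1) {ξ θ : Fin n → Fin 3 → 𝕜}
    (hξ : ∀ i, pd i φ 0 = sqMat (ξ i)) (hθ : ∀ i, dotL (θ i) (ξ i) = 1) :
    ∃ η : Fin n → (Fin n → 𝕜) → Fin 3 → 𝕜, IsNet (symProdL 𝕜) F φ η ∧ (∀ i, η i 0 = ξ i) ∧
      ∀ i R, dotL (θ i) (contract (θ i) (pd i φ R)) = 1 → dotL (θ i) (η i R) = 1 := by
  obtain ⟨g, hg, hg1, hgs⟩ := exists_analytic_sqrt (𝕜 := 𝕜)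
  -- For a rank-one `V` the vector `V θ` has square `(θᵀ V θ) V`, as in `smul_eq_sqMat_contract`.
  -- Dividing it by the root of `q = θᵀ V θ`, which is near 1, produces an analytic vector whose
  -- square is `V`.
  set q : Fin n → (Fin n → 𝕜) → 𝕜 := fun i R => dotL (θ i) (contract (θ i) (pd i φ R)) with hq
  set η : Fin n → (Fin n → 𝕜) → Fin 3 → 𝕜 := fun i R =>
    (g (q i R))⁻¹ • contract (θ i) (pd i φ R) with hη
  have hca : ∀ i, AnalyticAt 𝕜 (fun R => contract (θ i) (pd i φ R)) 0 := fun i =>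
    ((contract (θ i)).analyticAt _).comp (analyticAt_pd i hφ)
  have hqa : ∀ i, AnalyticAt 𝕜 (q i) 0 := fun i => ((dotL (θ i)).analyticAt _).comp (hca i)
  have hc0 : ∀ i, contract (θ i) (pd i φ 0) = ξ i := fun i => by
    rw [hξ, contract_sqMat, hθ, one_smul]
  have hq0 : ∀ i, q i 0 = 1 := fun i => by simp only [hq, hc0, hθ]
  have hgq : ∀ i, AnalyticAt 𝕜 (fun R => g (q i R)) 0 := fun i => hg.comp_of_eq (hqa i) (hq0 i)
  refine ⟨η, ⟨hφ, fun i => ?_, ?_, hF⟩, fun i => ?_, fun i R h => ?_⟩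
  · refine AnalyticAt.fun_smul ((hgq i).inv ?_) (hca i)
    simp [hq0, hg1]
  · have h1 : ∀ᶠ R in 𝓝 0, ∀ i, g (q i R) ^ 2 = q i R ∧ q i R ≠ 0 := by
      refine eventually_all.2 fun i => ?_
      have ht := tendsto_of_analyticAt (hqa i) (hq0 i)
      exact (ht.eventually hgs).and (ht.eventually_ne one_ne_zero)
    filter_upwards [hrk, h1] with R h2 h3 i
    rw [quad_symProdL]
    simp only [hη]
    rw [sqMat_smul, ← smul_eq_sqMat_contract (h2 i), smul_smul, inv_pow, (h3 i).1]
    rw [inv_mul_cancel₀ (h3 i).2, one_smul]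
  · simp only [hη, hq0, hg1, hc0, inv_one, one_smul]
  · have h' : q i R = 1 := h
    simp only [hη, h', hg1, inv_one, one_smul, h]

/-- A rank-one matrix in the span of the characteristic vectors of a net is a multiple of one of
them. -/
theorem exists_eq_smul_of_mem_span (hn : n = 2 ∨ n = 3) (hs : IsNonsingularConic F s)
    {W : Fin n → SymMat 𝕜} (hW : LinearIndependent 𝕜 W) (hWc : ∀ i, IsCharacteristic F s (W i))
    {V : SymMat 𝕜} (hVr : V.1.rank = 1) (hVW : V ∈ Submodule.span 𝕜 (range W)) :
    ∃ (k : Fin n) (c : 𝕜), c ≠ 0 ∧ V = c • W k := by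
  choose a ζ ha hζ hWa hFζ using fun i => (hWc i).exists_vec
  have hζi : LinearIndependent 𝕜 ζ := linearIndependent_of_conic hs hn hFζ fun i j hij =>
    linearIndependent_pair_of_sqMat hW ha hWa hij
  obtain ⟨d, hd⟩ := (Submodule.mem_span_range_iff_exists_fun 𝕜).1 hVW
  have h1 : V = ∑ k, (d k * a k) • sqMat (ζ k) := by
    rw [← hd]
    exact Finset.sum_congr rfl fun k _ => by rw [hWa, smul_smul]
  have : ∃ k, d k ≠ 0 := by
    by_contra h
    push Not at h
    have hV0 : V = 0 := by
      rw [← hd]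
      exact Finset.sum_eq_zero fun k _ => by rw [h, zero_smul]
    rw [hV0] at hVr
    change (0 : Matrix (Fin 3) (Fin 3) 𝕜).rank = 1 at hVr
    rw [Matrix.rank_zero] at hVr
    exact zero_ne_one hVr
  obtain ⟨k, hk⟩ := this
  refine ⟨k, d k, hk, ?_⟩
  rw [← hd]
  refine Finset.sum_eq_single k (fun j _ hj => ?_) (by simp)
  rw [h1] at hVr
  have h4 : d j = 0 := by
    rcases mul_eq_zero.1 (mul_eq_zero_of_sum_smul_sqMat hζi hVr hj) with h | h
    · exact (mul_eq_zero.1 h).resolve_right (ha j)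
    · exact absurd h (mul_ne_zero hk (ha k))
  rw [h4, zero_smul]

/-- The directions of a net at a point are, up to the order, the given characteristic directions. -/
theorem exists_perm_of_tangent (hn : n = 2 ∨ n = 3) (hs : IsNonsingularConic F s)
    {W : Fin n → SymMat 𝕜} (hW : LinearIndependent 𝕜 W) (hWc : ∀ i, IsCharacteristic F s (W i))
    {V : Fin n → SymMat 𝕜} (hV : LinearIndependent 𝕜 V) (hVr : ∀ i, (V i).1.rank = 1)
    (hVW : ∀ i, V i ∈ Submodule.span 𝕜 (range W)) :
    ∃ (σ : Fin n → Fin n) (c : Fin n → 𝕜), Function.Injective σ ∧ (∀ i, c i ≠ 0) ∧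
      ∀ i, V i = c i • W (σ i) := by
  choose σ c hc hVc using fun i => exists_eq_smul_of_mem_span hn hs hW hWc (hVr i) (hVW i)
  refine ⟨σ, c, fun i j hij => ?_, hc, hVc⟩
  by_contra hne
  have h1 : c j • V i + (-c i) • V j = 0 := by
    rw [hVc i, hVc j, hij]; module
  exact hc j (LinearIndependent.pair_iff.1 (linearIndependent_pair hV hne) _ _ h1).1

/-- Reparametrization of the coordinate lines. -/
theorem pd_axis_comp {τ : Fin n → 𝕜 → 𝕜} {σ : Fin n → Fin n} {R : Fin n → 𝕜}
    (hτ : ∀ i, DifferentiableAt 𝕜 (τ i) (R i)) (v : Fin n → 𝕜) :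
    fderiv 𝕜 (fun R : Fin n → 𝕜 => R₁ + ∑ i, τ i (R i) • (Pi.single (σ i) (1 : 𝕜) : Fin n → 𝕜)) R v
      = ∑ i, (v i * deriv (τ i) (R i)) • (Pi.single (σ i) (1 : 𝕜) : Fin n → 𝕜) := by
  have h1 : ∀ i, HasFDerivAt (fun R : Fin n → 𝕜 => τ i (R i)) _ R := fun i =>
    (hτ i).hasDerivAt.comp_hasFDerivAt R
      (ContinuousLinearMap.proj (R := 𝕜) (φ := fun _ : Fin n => 𝕜) i).hasFDerivAt
  have h2 : HasFDerivAt (fun R : Fin n → 𝕜 =>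
      R₁ + ∑ i, τ i (R i) • (Pi.single (σ i) (1 : 𝕜) : Fin n → 𝕜)) _ R :=
    (HasFDerivAt.fun_sum fun i _ => (h1 i).smul_const _).const_add R₁
  rw [h2.fderiv]
  simp [mul_comm]

theorem linearIndependent_single :
    LinearIndependent 𝕜 fun i : Fin n => (Pi.single i (1 : 𝕜) : Fin n → 𝕜) := by
  have h := (Pi.basisFun 𝕜 (Fin n)).linearIndependent
  have e : (⇑(Pi.basisFun 𝕜 (Fin n)) : Fin n → Fin n → 𝕜) =
      fun i : Fin n => (Pi.single i (1 : 𝕜) : Fin n → 𝕜) := by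
    funext i; simp
  rwa [e] at h

theorem IsLocalParam.linearIndependent_pd (h : IsLocalParam n S D χ) (hR : R₁ ∈ D) :
    LinearIndependent 𝕜 fun i => pd i χ R₁ := by
  rw [Fintype.linearIndependent_iff]
  intro g hg
  rw [← fderiv_eq_sum_pd] at hg
  have h0 : g = 0 := h.immersion _ hR (hg.trans (map_zero (fderiv 𝕜 χ R₁)).symm)
  intro i
  rw [h0, Pi.zero_apply]

theorem IsLocalParam.mem_span_pd (h : IsLocalParam n S D χ) (hR : R₁ ∈ D) {V : SymMat 𝕜}
    (hV : V ∈ tangentVectors n S (χ R₁)) : V ∈ Submodule.span 𝕜 (range fun i => pd i χ R₁) := by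
  rw [h.tangentVectors_eq hR] at hV
  obtain ⟨v, hv⟩ := hV
  rw [← hv, fderiv_eq_sum_pd]
  exact Submodule.sum_mem _ fun k _ =>
    Submodule.smul_mem _ _ (Submodule.subset_span (mem_range_self k))

/-- A holonomic submanifold carries a net with given characteristic directions at a point, which can
be normalized along the coordinate axes. -/
theorem IsHolonomic.exists_isNet (hn : n = 2 ∨ n = 3) (hS : IsHolonomic n F S)
    (hM : S ⊆ hypersurface Ω F) (hsS : s ∈ S) (hs : IsNonsingularConic F s)
    {ξ θ : Fin n → Fin 3 → 𝕜} (hξ : ∀ i, fderiv 𝕜 F s (sqMat (ξ i)) = 0)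
    (hi : ∀ i j, i ≠ j → LinearIndependent 𝕜 ![ξ i, ξ j]) (hθ : ∀ i, dotL (θ i) (ξ i) = 1)
    (hT : ∀ i, sqMat (ξ i) ∈ tangentVectors n S s) :
    ∃ (D : Set (Fin n → 𝕜)) (φ : (Fin n → 𝕜) → SymMat 𝕜) (η : Fin n → (Fin n → 𝕜) → Fin 3 → 𝕜),
      IsLocalParam n S D φ ∧ 0 ∈ D ∧ φ 0 = s ∧ IsNet (symProdL 𝕜) F φ η ∧ (∀ i, η i 0 = ξ i) ∧
      ∀ i, ∀ᶠ t in 𝓝 (0 : 𝕜), dotL (θ i) (η i (Pi.single i t)) = 1 := by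
  obtain ⟨D₀, χ, hχ, ⟨R₁, hR₁, rfl⟩, hchar⟩ := hS s hsS
  have hξi := linearIndependent_of_conic hs hn hξ hi
  have hW := hχ.linearIndependent_pd hR₁
  have hξ0 : ∀ i, ξ i ≠ 0 := hξi.ne_zero
  obtain ⟨σ, c, hσ, hc, hσc⟩ := exists_perm_of_tangent hn hs hW (hchar R₁ hR₁)
    (linearIndependent_sqMat hξi)
    (fun i => by simpa using rank_smul_sqMat (one_ne_zero (α := 𝕜)) (hξ0 i)) fun i => hχ.mem_span_pd hR₁ (hT i)
  -- the parameters on the coordinate lines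
  have hline : ∀ i, AnalyticAt 𝕜
      (fun x : 𝕜 => R₁ + x • (Pi.single (σ i) (1 : 𝕜) : Fin n → 𝕜)) 0 := fun i =>
    analyticAt_const.add (analyticAt_id.fun_smul analyticAt_const)
  set q : Fin n → 𝕜 → 𝕜 := fun i x =>
    dotL (θ i) (contract (θ i) (pd (σ i) χ (R₁ + x • Pi.single (σ i) 1))) with hq
  have hqa : ∀ i, AnalyticAt 𝕜 (q i) 0 := fun i =>
    ((dotL (θ i)).analyticAt _).comp (((contract (θ i)).analyticAt _).comp
      ((analyticAt_pd (σ i) (hχ.analytic R₁ hR₁)).comp_of_eq (hline i) (by simp)))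
  have hq0 : ∀ i, c i * q i 0 = 1 := by
    intro i
    have h := congrArg (fun V => dotL (θ i) (contract (θ i) V)) (hσc i)
    simp only [map_smul, contract_sqMat, hθ, one_smul] at h
    simp only [hq, zero_smul, add_zero]
    exact h.symm
  have hcq : ∀ i, (q i 0)⁻¹ = c i := fun i => inv_eq_of_mul_eq_one_left (hq0 i)
  have hq0' : ∀ i, q i 0 ≠ 0 := fun i h => by
    have := hq0 i
    rw [h, mul_zero] at this
    exact zero_ne_one this
  -- Reparametrizing the line `σ i` at the rate `1 / q` gives its velocity the value 1 under double
  -- contraction with `θ i`, which normalizes the vector of the net along the axis.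
  have hode : ∀ i, ∃ τ : 𝕜 → 𝕜, AnalyticAt 𝕜 τ 0 ∧ τ 0 = 0 ∧
      ∀ᶠ t in 𝓝 (0 : 𝕜), HasDerivAt τ ((q i (τ t))⁻¹) t := fun i =>
    exists_analytic_ode_one (X := fun p : 𝕜 × 𝕜 => (q i p.2)⁻¹)
      (((hqa i).comp_of_eq analyticAt_snd rfl).inv (hq0' i))
  choose τ hτ hτ0 hτe using hode
  have hτd : ∀ i, ∀ᶠ t in 𝓝 (0 : 𝕜), deriv (τ i) t = (q i (τ i t))⁻¹ ∧ q i (τ i t) ≠ 0 := by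
    intro i
    have h1 : ∀ᶠ x in 𝓝 (0 : 𝕜), q i x ≠ 0 := (hqa i).continuousAt.eventually_ne (hq0' i)
    filter_upwards [hτe i, (tendsto_of_analyticAt (hτ i) (hτ0 i)).eventually h1] with t h2 h3
    exact ⟨h2.deriv, h3⟩
  have hτ1 : ∀ i, deriv (τ i) 0 = c i := fun i => by
    rw [(hτd i).self_of_nhds.1, hτ0, hcq]
  set T : (Fin n → 𝕜) → Fin n → 𝕜 := fun R =>
    R₁ + ∑ i, τ i (R i) • (Pi.single (σ i) (1 : 𝕜) : Fin n → 𝕜) with hTdef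
  have hTa : AnalyticAt 𝕜 T 0 := analyticAt_const.add (Finset.analyticAt_fun_sum _ fun i _ =>
    ((hτ i).comp_of_eq ((ContinuousLinearMap.proj (R := 𝕜)
      (φ := fun _ : Fin n => 𝕜) i).analyticAt _) rfl).fun_smul analyticAt_const)
  have hT0 : T 0 = R₁ := by simp [hTdef, hτ0]
  have hTax : ∀ i t, T (Pi.single i t) = R₁ + τ i t • Pi.single (σ i) 1 := by
    intro i t
    simp only [hTdef]
    rw [Finset.sum_eq_single i (fun j _ hj => by simp [Pi.single_eq_of_ne hj, hτ0]) (by simp),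
      Pi.single_eq_same]
  have hσi : LinearIndependent 𝕜 fun i : Fin n => (Pi.single (σ i) (1 : 𝕜) : Fin n → 𝕜) :=
    linearIndependent_single.comp σ hσ
  have hTinj : Function.Injective (fderiv 𝕜 T 0) := (injective_iff_map_eq_zero _).2 fun v hv => by
    rw [hTdef, pd_axis_comp (R := 0) (fun i => (hτ i).differentiableAt)] at hv
    funext i
    have h := Fintype.linearIndependent_iff.1 hσi _ hv i
    rw [Pi.zero_apply, hτ1] at h
    exact (mul_eq_zero.1 h).resolve_right (hc i)
  have hτc : ∀ᶠ R in 𝓝 (0 : Fin n → 𝕜), ∀ i, AnalyticAt 𝕜 (τ i) (R i) ∧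
      deriv (τ i) (R i) = (q i (τ i (R i)))⁻¹ ∧ q i (τ i (R i)) ≠ 0 :=
    eventually_all.2 fun i =>
      (tendsto_coord i).eventually ((hτ i).eventually_analyticAt.and (hτd i))
  have tT := tendsto_of_analyticAt hTa hT0
  have hpd : ∀ᶠ R in 𝓝 (0 : Fin n → 𝕜), T R ∈ D₀ ∧ (∀ i, q i (τ i (R i)) ≠ 0) ∧
      ∀ i, pd i (fun R => χ (T R)) R = (q i (τ i (R i)))⁻¹ • pd (σ i) χ (T R) := by
    filter_upwards [hτc, hTa.eventually_analyticAt, tT.eventually (hχ.eventually_mem hR₁)]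
      with R h1 h2 h3
    refine ⟨h3, fun i => (h1 i).2.2, fun i => ?_⟩
    rw [pd_comp i (hχ.analytic _ h3).differentiableAt h2.differentiableAt]
    have h4 : pd i T R = (q i (τ i (R i)))⁻¹ • Pi.single (σ i) 1 := by
      unfold pd
      rw [hTdef, pd_axis_comp (fun i => (h1 i).1.differentiableAt),
        Finset.sum_eq_single i (fun j _ hj => by simp [Pi.single_eq_of_ne hj]) (by simp),
        Pi.single_eq_same, one_mul, (h1 i).2.1]
    rw [h4, map_smul]
    rfl
  obtain ⟨D, -, h0D, hD⟩ := hχ.exists_comp hR₁ hTa hT0 hTinj univ_mem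
  set φ : (Fin n → 𝕜) → SymMat 𝕜 := fun R => χ (T R) with hφ
  have hφ0 : φ 0 = χ R₁ := by simp only [hφ, hT0]
  have hrk : ∀ᶠ R in 𝓝 (0 : Fin n → 𝕜), ∀ i, (pd i φ R).1.rank = 1 := by
    filter_upwards [hpd] with R ⟨h1, h2, h3⟩ i
    rw [h3]
    exact ((hchar _ h1 (σ i)).smul (inv_ne_zero (h2 i))).2
  have hφξ : ∀ i, pd i φ 0 = sqMat (ξ i) := by
    intro i
    rw [hpd.self_of_nhds.2.2 i, hσc, hT0, Pi.zero_apply, hτ0, hcq]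
  obtain ⟨η, hη, hη0, hηn⟩ := exists_isNet_of_rank_one (hD.analytic 0 h0D)
    ((hD.eventually_mem h0D).mono fun R hR => (hM (hD.mem hR)).2) hrk hφξ hθ
  refine ⟨D, φ, η, hD, h0D, hφ0, hη, hη0, fun i => ?_⟩
  filter_upwards [(tendsto_single i).eventually hpd] with t ⟨_, h2, h3⟩
  apply hηn
  have h4 := h2 i
  rw [h3 i, hTax, Pi.single_eq_same] at *
  rw [map_smul, map_smul, smul_eq_mul]
  exact inv_mul_cancel₀ h4

/-- The characteristic curves of a submanifold with a normalized net are the coordinate axes. -/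
theorem IsLocalParam.characteristic_curve_eq (h : IsLocalParam n S D φ) (h0 : 0 ∈ D)
    {η : Fin n → (Fin n → 𝕜) → Fin 3 → 𝕜} (hnet : IsNet (symProdL 𝕜) F φ η)
    (hli : LinearIndependent 𝕜 fun i => η i 0) {i : Fin n} {θ : Fin 3 → 𝕜}
    (hax : ∀ᶠ t in 𝓝 (0 : 𝕜), dotL θ (η i (Pi.single i t)) = 1)
    {c : 𝕜 → SymMat 𝕜} {ζ : 𝕜 → Fin 3 → 𝕜} (hc : AnalyticAt 𝕜 c 0) (hc0 : c 0 = φ 0)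
    (hζ0 : ζ 0 = η i 0) (hcS : ∀ᶠ t in 𝓝 (0 : 𝕜), c t ∈ S ∧ HasDerivAt c (sqMat (ζ t)) t ∧
      dotL θ (ζ t) = 1) :
    ∀ᶠ t in 𝓝 (0 : 𝕜), ζ t = η i (Pi.single i t) := by
  obtain ⟨ρ, hρ, hρ0, hρS, -⟩ := h.exists_coordinates h0
  rw [← hc0] at hρ hρ0 hρS
  have hxa : AnalyticAt 𝕜 (fun t => ρ (c t)) 0 := hρ.comp hc
  set x : 𝕜 → Fin n → 𝕜 := fun t => ρ (c t) with hx
  have hx0 : x 0 = 0 := hρ0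
  have tx := tendsto_of_analyticAt hxa hx0
  have hφx : ∀ᶠ t in 𝓝 (0 : 𝕜), φ (x t) = c t := by
    filter_upwards [hc.continuousAt.tendsto.eventually hρS, hcS] with t h1 h2
    exact (h1 h2.1).2
  have hliR : ∀ᶠ R in 𝓝 (0 : Fin n → 𝕜), LinearIndependent 𝕜 fun k => η k R := by
    have hcη : ContinuousAt (fun R => fun k => η k R) 0 :=
      continuousAt_pi.2 fun k => (hnet.analytic_vec k).continuousAt
    exact hcη.eventually (isOpen_setOfPred_linearIndependent.mem_nhds hli)
  have hder : ∀ᶠ t in 𝓝 (0 : 𝕜), ∑ k, deriv x t k • sqMat (η k (x t)) = sqMat (ζ t) := by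
    filter_upwards [hφx.eventually_nhds, hcS, hxa.eventually_analyticAt,
      tx.eventually hnet.pd_eq, tx.eventually (h.eventually_mem h0)] with t h1 h2 h3 h4 h5
    have h6 : HasDerivAt (fun t => φ (x t)) _ t :=
      (h.analytic _ h5).differentiableAt.hasFDerivAt.comp_hasDerivAt t
        h3.differentiableAt.hasDerivAt
    have h7 := h6.unique (h2.2.1.congr_of_eventuallyEq h1)
    rw [fderiv_eq_sum_pd] at h7
    rw [← h7]
    exact Finset.sum_congr rfl fun k _ => by rw [h4 k, quad_symProdL]
  have hd0 : ∀ k, deriv x 0 k = if k = i then 1 else 0 := by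
    have h1 := hder.self_of_nhds
    rw [hx0, hζ0] at h1
    have h2 := linearIndependent_sqMat hli
    have h3 : ∑ k, (deriv x 0 k - if k = i then 1 else 0) • sqMat (η k 0) = 0 := by
      have h4 : ∑ k, (if k = i then (1 : 𝕜) else 0) • sqMat (η k 0) = sqMat (η i 0) := by simp
      rw [← sub_eq_zero, ← h4, ← Finset.sum_sub_distrib] at h1
      rw [← h1]
      exact Finset.sum_congr rfl fun k _ => symMat_ext fun a b => sub_mul _ _ _
    intro k
    exact sub_eq_zero.1 (Fintype.linearIndependent_iff.1 h2 _ h3 k)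
  have hdi : ∀ᶠ t in 𝓝 (0 : 𝕜), deriv x t i ≠ 0 := by
    have : ContinuousAt (fun t => deriv x t i) 0 :=
      (continuous_apply i).continuousAt.comp hxa.deriv.continuousAt
    exact this.eventually_ne (by rw [hd0]; simp)
  -- The velocity has rank one, so at most one coefficient is nonzero. It is the `i`-th at `t = 0`,
  -- and near there by continuity, so the curve never leaves the `i`-th axis.
  have hdk : ∀ᶠ t in 𝓝 (0 : 𝕜), ∀ k, k ≠ i → deriv x t k = 0 := by
    filter_upwards [hdi, hder, tx.eventually hliR, hcS] with t h1 h2 h3 h4 k hk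
    have hζ : ζ t ≠ 0 := fun h => by
      have := h4.2.2
      rw [h, map_zero] at this
      exact zero_ne_one this
    have h5 : (sqMat (ζ t)).1.rank = 1 := by
      simpa using rank_smul_sqMat (one_ne_zero (α := 𝕜)) hζ
    rw [← h2] at h5
    exact (mul_eq_zero.1 (mul_eq_zero_of_sum_smul_sqMat h3 h5 hk)).resolve_right h1
  have hxk : ∀ k, ∀ᶠ t in 𝓝 (0 : 𝕜), HasDerivAt (fun t => x t k) (deriv x t k) t := fun k =>
    hxa.eventually_analyticAt.mono fun t ht =>
      (hasDerivAt_pi.1 ht.differentiableAt.hasDerivAt) k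
  have hxk0 : ∀ᶠ t in 𝓝 (0 : 𝕜), ∀ k, k ≠ i → x t k = 0 := by
    refine eventually_all.2 fun k => ?_
    by_cases hk : k = i
    · exact Eventually.of_forall fun _ h => absurd hk h
    have h1 : ∀ᶠ t in 𝓝 (0 : 𝕜), x t k = 0 :=
      eventually_eq_of_deriv_eq (f := fun t => x t k) (g := fun _ => 0) (f' := fun _ => 0)
        (by rw [hx0]; rfl)
        (by filter_upwards [hxk k, hdk] with t h1 h2; rwa [h2 k hk] at h1)
        (Eventually.of_forall fun t => hasDerivAt_const t _)
    exact h1.mono fun t h _ => h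
  have hxs : ∀ᶠ t in 𝓝 (0 : 𝕜), x t = Pi.single i (x t i) := by
    filter_upwards [hxk0] with t h1
    funext k
    by_cases hk : k = i
    · subst hk; simp
    · rw [h1 k hk, Pi.single_eq_of_ne hk]
  have txi : Tendsto (fun t => x t i) (𝓝 0) (𝓝 0) := (tendsto_coord i).comp tx
  -- Both vectors have the value 1 under `θ`. This fixes their common scale and sign, so the speed
  -- along the axis is 1.
  have hvel : ∀ᶠ t in 𝓝 (0 : 𝕜), deriv x t i = 1 ∧ ζ t = η i (x t) := by
    filter_upwards [hder, hdk, hxs, txi.eventually hax, hcS] with t h1 h2 h3 h4 h5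
    rw [← h3] at h4
    rw [Finset.sum_eq_single i (fun k _ hk => by rw [h2 k hk, zero_smul]) (by simp)] at h1
    have h6 := congrArg (contract θ) h1
    rw [map_smul, contract_sqMat, contract_sqMat, h4, h5.2.2, one_smul, one_smul] at h6
    have h7 := congrArg (dotL θ) h6
    rw [map_smul, h4, h5.2.2, smul_eq_mul, mul_one] at h7
    rw [h7, one_smul] at h6
    exact ⟨h7, h6.symm⟩
  have hxi : ∀ᶠ t in 𝓝 (0 : 𝕜), x t i = t :=
    eventually_eq_of_deriv_eq (f := fun t => x t i) (g := fun t => t) (f' := fun _ => 1)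
      (by rw [hx0]; rfl)
      (by filter_upwards [hxk i, hvel] with t h1 h2; rwa [h2.1] at h1)
      (Eventually.of_forall fun t => hasDerivAt_id t)
  filter_upwards [hvel, hxs, hxi] with t h1 h2 h3
  rw [h1.2, h2, h3]

end NetOnSubmanifold

/-! ### Correspondence of submanifolds and reductions -/

section Correspondence

variable {n : ℕ} {S : Set (SymMat 𝕜)} {D : Set (Fin n → 𝕜)} {φ χ : (Fin n → 𝕜) → SymMat 𝕜}
  {F : SymMat 𝕜 → 𝕜} {s : SymMat 𝕜} {Ω M : Set (SymMat 𝕜)}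

/-- Holonomic submanifolds of the hypersurface. -/
def IsHolonomicIn (n : ℕ) (Ω : Set (SymMat 𝕜)) (F : SymMat 𝕜 → 𝕜) (S : Set (SymMat 𝕜)) : Prop :=
  S ⊆ hypersurface Ω F ∧ IsHolonomic n F S

theorem IsHolonomic.isSubmanifold (h : IsHolonomic n F S) : IsSubmanifold n S := fun s hs => by
  obtain ⟨D, φ, hφ, hsD, -⟩ := h s hs
  exact ⟨D, φ, hφ, hsD⟩

theorem IsHolonomicIn.isSecant (h : IsHolonomicIn n Ω F S) : IsSecant n Ω F S := by
  refine ⟨h.2.isSubmanifold, h.1, fun s hs => ?_⟩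
  obtain ⟨D, φ, hφ, ⟨R, hR, rfl⟩, hc⟩ := h.2 s hs
  refine ⟨fun i => pd i φ R, hφ.linearIndependent_pd hR, fun i => ⟨?_, hc R hR i⟩⟩
  exact ⟨D, φ, hφ, R, hR, rfl, mem_range_self _⟩

/-- Since holonomicity is automatic in dimension two, surfaces and 3-folds can be treated together.
-/
theorem isBisecantSurface_eq : IsBisecantSurface Ω F = IsHolonomicIn 2 Ω F := by
  funext S
  exact propext ⟨fun h => ⟨h.2.1, IsSecant.isHolonomic_two h⟩, fun h => h.isSecant⟩

theorem isHolonomicTrisecant_eq : IsHolonomicTrisecant Ω F = IsHolonomicIn 3 Ω F := by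
  funext S
  exact propext ⟨fun h => ⟨h.1.2.1, h.2⟩, fun h => ⟨h.isSecant, h.2⟩⟩

theorem eq_smul_speedVec {V : SymMat 𝕜} (hV : V.1.rank = 1) (h0 : V.1 0 0 ≠ 0) :
    V = V.1 0 0 • sqMat (speedVec (V.1 0 1 / V.1 0 0) (V.1 0 2 / V.1 0 0)) := by
  obtain ⟨a, ζ, ha, hζ, rfl⟩ := exists_eq_smul_sqMat hV
  have he : ∀ i j, (a • sqMat ζ).1 i j = a * (ζ i * ζ j) := fun i j => rfl
  rw [he] at h0
  have hz : ζ 0 ≠ 0 := fun h => h0 (by rw [h]; ring)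
  have h1 : ζ = ζ 0 • speedVec ((a • sqMat ζ).1 0 1 / (a • sqMat ζ).1 0 0)
      ((a • sqMat ζ).1 0 2 / (a • sqMat ζ).1 0 0) := by
    rw [he, he, he]
    funext k
    fin_cases k <;> simp [speedVec] <;> field_simp
  conv_lhs => rw [h1, sqMat_smul, smul_smul]
  rw [he 0 0, sq]

/-- A map with independent characteristic derivatives of finite speeds is a reduction. -/
theorem exists_isReduction (hD : IsOpen D) (hφ : AnalyticOnNhd 𝕜 φ D) (hM : ∀ R ∈ D, φ R ∈ M)
    (hrk : ∀ R ∈ D, ∀ i, (pd i φ R).1.rank = 1) (h0 : ∀ R ∈ D, ∀ i, (pd i φ R).1 0 0 ≠ 0)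
    (hi : ∀ R ∈ D, ∀ i j, i ≠ j → LinearIndependent 𝕜 ![pd i φ R, pd j φ R]) :
    IsReduction M n D φ (fun i R => (pd i φ R).1 0 2 / (pd i φ R).1 0 0)
      (fun i R => (pd i φ R).1 0 1 / (pd i φ R).1 0 0) := by
  have hen : ∀ R ∈ D, ∀ i a c, AnalyticAt 𝕜 (fun R => (pd i φ R).1 a c) R := fun R hR i a c =>
    ((entryL (𝕜 := 𝕜) a c).analyticAt _).comp (analyticAt_pd i (hφ R hR))
  refine isReduction_of_pd_eq hD hφ (fun i R hR => (hen R hR i 0 2).div (hen R hR i 0 0) (h0 R hR i))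
    (fun i R hR => (hen R hR i 0 1).div (hen R hR i 0 0) (h0 R hR i)) ?_ hM h0
    fun R hR i => eq_smul_speedVec (hrk R hR i) (h0 R hR i)
  intro R hR i j hij heq
  obtain ⟨h1, h2⟩ := Prod.mk.inj heq
  have e1 := eq_smul_speedVec (hrk R hR i) (h0 R hR i)
  have e2 := eq_smul_speedVec (hrk R hR j) (h0 R hR j)
  rw [h1, h2] at e1
  have h3 : ∀ (x y : 𝕜) (W V V' : SymMat 𝕜), V = x • W → V' = y • W → y • V + (-x) • V' = 0 := by
    rintro x y W _ _ rfl rfl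
    module
  exact h0 R hR j (LinearIndependent.pair_iff.1 (hi R hR i j hij) _ _
    (h3 _ _ _ _ _ e1 e2)).1

theorem IsReduction.isCharacteristic {lam mu : Fin n → (Fin n → 𝕜) → 𝕜}
    (hF : AnalyticOnNhd 𝕜 F Ω) (h : IsReduction (hypersurface Ω F) n D φ lam mu)
    {R : Fin n → 𝕜} (hR : R ∈ D) (i : Fin n) : IsCharacteristic F (φ R) (pd i φ R) := by
  obtain ⟨hM, hpd⟩ := h.pd_eq hR
  refine ⟨?_, ?_⟩
  · have h2 := pd_comp i (hF _ hM.1).differentiableAt (h.analytic_U R hR).differentiableAt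
    have h1 : (fun R => F (φ R)) =ᶠ[𝓝 R] fun _ => 0 := by
      filter_upwards [h.isOpen.mem_nhds hR] with R hR
      exact (h.pd_eq hR).1.2
    rw [pd_congr i h1] at h2
    refine h2.symm.trans ?_
    simp [pd]
  · rw [(hpd i).2]
    exact rank_smul_sqMat (hpd i).1 fun h0 => one_ne_zero (α := 𝕜) (congrFun h0 0)

/-- The characteristic directions of a reduction are independent. -/
theorem IsReduction.injective_fderiv {lam mu : Fin n → (Fin n → 𝕜) → 𝕜} (hn : n = 2 ∨ n = 3)
    (hF : AnalyticOnNhd 𝕜 F Ω) (hγ : ∀ s ∈ hypersurface Ω F, IsNonsingularConic F s)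
    (h : IsReduction (hypersurface Ω F) n D φ lam mu)
    {R : Fin n → 𝕜} (hR : R ∈ D) : Function.Injective (fderiv 𝕜 φ R) := by
  obtain ⟨hM, hpd⟩ := h.pd_eq hR
  have hiso : ∀ i, fderiv 𝕜 F (φ R) (sqMat (speedVec (mu i R) (lam i R))) = 0 := fun i => by
    have h1 := (h.isCharacteristic hF hR i).1
    rw [(hpd i).2, map_smul] at h1
    exact (smul_eq_zero.1 h1).resolve_left (hpd i).1
  have hli := linearIndependent_sqMat (linearIndependent_of_conic (hγ _ hM) hn hiso
    fun i j hij => linearIndependent_of_ne rfl rfl fun heq => h.distinct R hR i j hij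
      (Prod.ext (congrFun heq 2) (congrFun heq 1)))
  refine (injective_iff_map_eq_zero _).2 fun v hv => ?_
  rw [fderiv_eq_sum_pd] at hv
  have h1 : ∑ i, (v i * (pd i φ R).1 0 0) • sqMat (speedVec (mu i R) (lam i R)) = 0 := by
    refine Eq.trans (Finset.sum_congr rfl fun i _ => ?_) hv
    rw [mul_smul, ← (hpd i).2]
  funext i
  exact (mul_eq_zero.1 (Fintype.linearIndependent_iff.1 hli _ h1 i)).resolve_right (hpd i).1

/-- The change of variables as a continuous linear map. -/
def changeVarsL (A : Matrix (Fin 3) (Fin 3) 𝕜) : SymMat 𝕜 →L[𝕜] SymMat 𝕜 :=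
  LinearMap.toContinuousLinearMap
    { toFun := changeVars A
      map_add' := fun U V => Subtype.ext (by
        change A.transpose * (U.1 + V.1) * A = A.transpose * U.1 * A + A.transpose * V.1 * A
        rw [Matrix.mul_add, Matrix.add_mul])
      map_smul' := fun c U => Subtype.ext (by
        change A.transpose * (c • U.1) * A = c • (A.transpose * U.1 * A)
        rw [Matrix.mul_smul, Matrix.smul_mul]) }

theorem changeVarsL_apply (A : Matrix (Fin 3) (Fin 3) 𝕜) (U : SymMat 𝕜) :
    changeVarsL A U = changeVars A U := rfl

theorem changeVars_changeVars {A B : Matrix (Fin 3) (Fin 3) 𝕜} (h : A * B = 1) (U : SymMat 𝕜) :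
    changeVars B (changeVars A U) = U := by
  refine Subtype.ext ?_
  change B.transpose * (A.transpose * U.1 * A) * B = U.1
  have h2 : B.transpose * A.transpose = 1 := by
    rw [← Matrix.transpose_mul, h, Matrix.transpose_one]
  calc B.transpose * (A.transpose * U.1 * A) * B
      = (B.transpose * A.transpose) * U.1 * (A * B) := by simp only [Matrix.mul_assoc]
    _ = U.1 := by rw [h, h2, Matrix.one_mul, Matrix.mul_one]

theorem changeVars_sqMat (A : Matrix (Fin 3) (Fin 3) 𝕜) (ζ : Fin 3 → 𝕜) :
    changeVars A (sqMat ζ) = sqMat (A.transpose.mulVec ζ) := by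
  refine Subtype.ext ?_
  change A.transpose * Matrix.vecMulVec ζ ζ * A = Matrix.vecMulVec _ _
  rw [Matrix.mul_vecMulVec, Matrix.vecMulVec_mul, Matrix.mulVec_transpose]

/-- Transport of a parametrization by a change of variables. -/
theorem IsLocalParam.changeVars (h : IsLocalParam n S D φ) {A : Matrix (Fin 3) (Fin 3) 𝕜}
    (hA : IsUnit A.det) :
    IsLocalParam n (changeVars A '' S) D (fun R => DispersionlessHirota.changeVars A (φ R)) := by
  have h1 : A * A⁻¹ = 1 := Matrix.mul_nonsing_inv A hA
  have h2 : A⁻¹ * A = 1 := Matrix.nonsing_inv_mul A hA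
  have hl : Function.LeftInverse (DispersionlessHirota.changeVars A⁻¹)
      (DispersionlessHirota.changeVars A) := changeVars_changeVars h1
  have hr : Function.RightInverse (DispersionlessHirota.changeVars A⁻¹)
      (DispersionlessHirota.changeVars A) := changeVars_changeVars h2
  have hc : ∀ B : Matrix (Fin 3) (Fin 3) 𝕜,
      Continuous (DispersionlessHirota.changeVars B : SymMat 𝕜 → SymMat 𝕜) := fun B =>
    (changeVarsL B).continuous
  have hemb : IsEmbedding (DispersionlessHirota.changeVars A : SymMat 𝕜 → SymMat 𝕜) :=
    IsEmbedding.of_comp (hc A) (hc A⁻¹) (by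
      rw [show DispersionlessHirota.changeVars A⁻¹ ∘ DispersionlessHirota.changeVars A = id from
        funext hl]
      exact IsEmbedding.id)
  refine ⟨h.isOpen, fun R hR => ((changeVarsL A).analyticAt _).comp (h.analytic R hR), ?_,
    hemb.comp h.embedding, ?_⟩
  · intro R hR
    have h3 : HasFDerivAt (fun R => DispersionlessHirota.changeVars A (φ R)) _ R :=
      (changeVarsL A).hasFDerivAt.comp R (h.analytic R hR).differentiableAt.hasFDerivAt
    have h4 : Function.Injective
        (fderiv 𝕜 (fun R => DispersionlessHirota.changeVars A (φ R)) R) := by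
      rw [h3.fderiv]
      exact hl.injective.comp (h.immersion R hR)
    exact h4
  · obtain ⟨W, hW, hSW⟩ := h.image
    refine ⟨DispersionlessHirota.changeVars A⁻¹ ⁻¹' W, hW.preimage (hc _), ?_⟩
    rw [← image_eq_preimage_of_inverse hl hr, ← image_inter hl.injective, ← hSW, image_image]

/-- The restriction of a parametrization to a neighbourhood of a point. -/
theorem IsLocalParam.exists_restrict (h : IsLocalParam n S D φ) {R : Fin n → 𝕜} (hR : R ∈ D)
    {A : Set (Fin n → 𝕜)} (hA : A ∈ 𝓝 R) : ∃ D' ⊆ A ∩ D, R ∈ D' ∧ IsLocalParam n S D' φ :=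
  h.exists_isLocalParam hR (h.analytic R hR) (h.immersion R hR) rfl
    ((h.eventually_mem hR).mono fun _ hR => h.mem hR) (inter_mem hA (h.eventually_mem hR))

/-- A net of finite speeds after a change of variables is a reduction. -/
theorem isReductionImageAt_changeVars (hSM : S ⊆ M) (h : IsLocalParam n S D φ)
    (hc : ∀ R ∈ D, ∀ i, (pd i φ R).1.rank = 1) {R : Fin n → 𝕜} (hR : R ∈ D)
    {A : Matrix (Fin 3) (Fin 3) 𝕜} (hA : IsUnit A.det)
    (h0 : ∀ i, (changeVars A (pd i φ R)).1 0 0 ≠ 0) :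
    IsReductionImageAt (changeVars A '' M) n (changeVars A '' S) (changeVars A (φ R)) := by
  set L : SymMat 𝕜 →L[𝕜] 𝕜 := (entryL 0 0).comp (changeVarsL A)
  have hev : ∀ᶠ R' in 𝓝 R, ∀ i, (changeVars A (pd i φ R')).1 0 0 ≠ 0 := by
    refine eventually_all.2 fun i => ?_
    have h1 : ContinuousAt (fun R' => L (pd i φ R')) R :=
      L.continuous.continuousAt.comp (analyticAt_pd i (h.analytic R hR)).continuousAt
    exact h1.eventually_ne (h0 i)
  obtain ⟨D', hD', hRD', hφ⟩ := h.exists_restrict hR hev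
  have hpd : ∀ R ∈ D', ∀ i, pd i (fun R => changeVars A (φ R)) R = changeVars A (pd i φ R) := by
    intro R hR i
    have h1 := pd_comp (g := changeVarsL A) i (changeVarsL A).differentiableAt
      (hφ.analytic R hR).differentiableAt
    rwa [ContinuousLinearMap.fderiv] at h1
  have hφA := hφ.changeVars hA
  refine ⟨D', _, _, _, exists_isReduction hφ.isOpen hφA.analytic
    (fun R hR => mem_image_of_mem _ (hSM (hφ.mem hR))) (fun R hR i => ?_) (fun R hR i => ?_)
    (fun R hR i j hij => linearIndependent_pair (hφA.linearIndependent_pd hR) hij), hφA,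
    mem_image_of_mem _ hRD'⟩
  · rw [hpd R hR]
    obtain ⟨a, ζ, ha, hζ, hV⟩ := exists_eq_smul_sqMat (hc R (hD' hR).2 i)
    have hne := (hD' hR).1 i
    rw [hV, ← changeVarsL_apply, map_smul, changeVarsL_apply, changeVars_sqMat] at hne ⊢
    refine rank_smul_sqMat ha fun h => hne ?_
    rw [h]
    change a * (0 * 0) = 0
    ring
  · rw [hpd R hR]
    exact (hD' hR).1 i

theorem exists_isUnit_det_col {a : Fin 3 → 𝕜} (ha : a ≠ 0) :
    ∃ A : Matrix (Fin 3) (Fin 3) 𝕜, IsUnit A.det ∧ ∀ j, A j 0 = a j := by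
  obtain ⟨f, hf⟩ := SeparatingDual.exists_continuousLinearEquiv_apply_eq (R := 𝕜)
    (x := (Pi.single 0 1 : Fin 3 → 𝕜)) (y := a) (by simp) ha
  refine ⟨LinearMap.toMatrix' f.toLinearEquiv.toLinearMap, ?_, fun j => ?_⟩
  · rw [LinearMap.det_toMatrix']
    exact f.toLinearEquiv.isUnit_det'
  · rw [LinearMap.toMatrix'_apply, ← hf]
    congr 2

theorem changeVars_one (U : SymMat 𝕜) : changeVars 1 U = U := by
  refine Subtype.ext ?_
  change Matrix.transpose 1 * U.1 * 1 = U.1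
  simp

/-- Holonomic submanifolds of dimension two and three correspond to hydrodynamic reductions. -/
theorem correspondToReductions (hn : n = 2 ∨ n = 3) (hF : AnalyticOnNhd 𝕜 F Ω)
    (hγ : ∀ s ∈ hypersurface Ω F, IsNonsingularConic F s) :
    CorrespondToReductions n Ω F (IsHolonomicIn n Ω F) := by
  refine ⟨fun D U lam mu h R hR => ?_, fun S hS s hs => ⟨?_, fun h => ?_⟩, fun S hS s hs => ?_⟩
  · obtain ⟨D', hD', hRD', hU⟩ := exists_isLocalParam_image (h.analytic_U R hR)
      (h.injective_fderiv hn hF hγ hR) (h.isOpen.mem_nhds hR)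
    refine ⟨D', hD', hRD', hU, ?_, fun s hs => ⟨D', U, hU, hs, fun R hR i =>
      h.isCharacteristic hF (hD' hR) i⟩⟩
    rintro _ ⟨R, hR, rfl⟩
    exact (h.pd_eq (hD' hR)).1
  · rintro ⟨D, U, lam, mu, h, hU, R, hR, rfl⟩ V hV hVc
    obtain ⟨k, c, hc, rfl⟩ := exists_eq_smul_of_mem_span hn (hγ _ (hS.1 hs))
      (hU.linearIndependent_pd hR) (fun i => h.isCharacteristic hF hR i) hVc.2
      (hU.mem_span_pd hR hV)
    exact mul_ne_zero hc ((h.pd_eq hR).2 k).1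
  · obtain ⟨D, φ, hφ, ⟨R, hR, rfl⟩, hc⟩ := hS.2 s hs
    have h1 := isReductionImageAt_changeVars hS.1 hφ (fun R hR i => (hc R hR i).2) hR
      (A := 1) (by simp) (fun i => by
        rw [changeVars_one]
        exact h _ ⟨D, φ, hφ, R, hR, rfl, mem_range_self _⟩ (hc R hR i))
    simpa only [changeVars_one, image_id'] using h1
  · obtain ⟨D, φ, hφ, ⟨R, hR, rfl⟩, hc⟩ := hS.2 s hs
    choose a ζ ha hζ hVa hFζ using fun i => (hc R hR i).exists_vec
    have hli : LinearIndependent 𝕜 ζ := linearIndependent_of_conic (hγ _ (hS.1 hs)) hn hFζ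
      fun i j hij => linearIndependent_pair_of_sqMat (hφ.linearIndependent_pd hR) ha hVa hij
    -- After the change of variables the leading entry of `ζ ζᵀ` is the square of the product of `ζ`
    -- with the first column of `A`. The sum of the dual vectors takes the value 1 on all
    -- characteristic directions at once.
    obtain ⟨l, hl⟩ := exists_dual hli
    have hla : ∀ i, dotProduct (∑ k, l k) (ζ i) = 1 := by
      intro i
      rw [sum_dotProduct, Finset.sum_eq_single i (fun k _ hk => by
        rw [← dotL_apply, hl, if_neg hk]) (by simp), ← dotL_apply, hl, if_pos rfl]
    have hne : (∑ k, l k) ≠ 0 := by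
      intro h0
      have i₀ : Fin n := ⟨0, by omega⟩
      have := hla i₀
      rw [h0, zero_dotProduct] at this
      exact zero_ne_one this
    obtain ⟨A, hA, hAc⟩ := exists_isUnit_det_col hne
    refine ⟨A, hA, isReductionImageAt_changeVars hS.1 hφ (fun R hR i => (hc R hR i).2) hR hA
      fun i => ?_⟩
    rw [hVa, ← changeVarsL_apply, map_smul, changeVarsL_apply, changeVars_sqMat]
    have h1 : A.transpose.mulVec (ζ i) 0 = 1 := by
      rw [← hla i]
      change ∑ j, A.transpose 0 j * ζ i j = ∑ j, (∑ k, l k) j * ζ i j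
      exact Finset.sum_congr rfl fun j _ => by rw [Matrix.transpose_apply, hAc]
    change a i * (_ * _) ≠ 0
    rw [h1]
    simpa using ha i

end Correspondence

/-! ### Holonomic submanifolds with prescribed characteristic curves -/

section Parametrization

variable {n : ℕ} {S : Set (SymMat 𝕜)} {D : Set (Fin n → 𝕜)} {Φ φ χ : (Fin n → 𝕜) → SymMat 𝕜}
  {F : SymMat 𝕜 → 𝕜} {s : SymMat 𝕜} {Ω : Set (SymMat 𝕜)} {ξ θ ψ : Fin n → Fin 3 → 𝕜}
  {h : Fin n → 𝕜 → 𝕜} {η : Fin n → (Fin n → 𝕜) → Fin 3 → 𝕜}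

/-- The compatibility conditions of the equations of an `n`-dimensional characteristic net. -/
def IsInvolutive (n : ℕ) (Ω : Set (SymMat 𝕜)) (F : SymMat 𝕜 → 𝕜) : Prop :=
  ∀ U ∈ hypersurface Ω F, ∀ ξ : Fin n → Fin 3 → 𝕜, (∀ i, fderiv 𝕜 F U (sqMat (ξ i)) = 0) →
    (∀ i j, i ≠ j → LinearIndependent 𝕜 ![ξ i, ξ j]) → ∀ i j k, i ≠ j → i ≠ k → j ≠ k →
      obstruction (symProdL 𝕜) F U (ξ i) (ξ j) (ξ k) = 0

theorem isInvolutive_two : IsInvolutive 2 Ω F := fun U _ ξ _ _ i j k hij hik hjk => by omega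

/-- The compatibility conditions involve three directions at a time, so additional components impose
nothing new. -/
theorem IsInvolutive.of_three (h : IsInvolutive 3 Ω F) (n : ℕ) : IsInvolutive n Ω F := by
  intro U hU ξ hξ hi i j k hij hik hjk
  have h1 := h U hU ![ξ i, ξ j, ξ k] (fun a => by fin_cases a <;> exact hξ _) (fun a c hac => by
    fin_cases a <;> fin_cases c <;>
      first | exact absurd rfl hac | exact hi _ _ ‹_› | exact hi _ _ (Ne.symm ‹_›))
    0 1 2 (by decide) (by decide) (by decide)
  exact h1

theorem exists_fderiv_ne_zero (hs : IsNonsingularConic F s) : ∃ V, fderiv 𝕜 F s V ≠ 0 := by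
  by_contra! h
  have h1 := hs (Pi.single 0 1) fun η => h _
  exact one_ne_zero (α := 𝕜) (by simpa using congrFun h1 0)

theorem exists_polar_ne_zero (hs : IsNonsingularConic F s) {ζ : Fin 3 → 𝕜} (hζ : ζ ≠ 0) :
    ∃ v, fderiv 𝕜 F s (symProd ζ v) ≠ 0 := by
  by_contra! h
  exact hζ (hs ζ h)

/-- Existence of characteristic nets with given speeds along the axes. -/
theorem IsInvolutive.exists_isNet (hinv : IsInvolutive n Ω F) (hΩ : IsOpen Ω)
    (hF : AnalyticOnNhd 𝕜 F Ω) (hsM : s ∈ hypersurface Ω F) (hs : IsNonsingularConic F s)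
    (hξ : ∀ i, fderiv 𝕜 F s (sqMat (ξ i)) = 0)
    (hi : ∀ i j, i ≠ j → LinearIndependent 𝕜 ![ξ i, ξ j])
    (hθ : ∀ i, dotProduct (θ i) (ξ i) = 1) (hloc : ∀ i, IsLocalParameter F s (ξ i) (θ i) (ψ i))
    (hh : ∀ i, AnalyticAt 𝕜 (h i) 0 ∧ h i 0 = dotProduct (ψ i) (ξ i)) :
    ∃ (Φ : (Fin n → 𝕜) → SymMat 𝕜) (η : Fin n → (Fin n → 𝕜) → Fin 3 → 𝕜),
      IsNet (symProdL 𝕜) F Φ η ∧ Φ 0 = s ∧ (∀ i, η i 0 = ξ i) ∧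
      ∀ i, ∀ᶠ t in 𝓝 (0 : 𝕜), dotL (θ i) (η i (Pi.single i t)) = 1 ∧
        dotL (ψ i) (η i (Pi.single i t)) = h i t := by
  refine DispersionlessHirota.exists_isNet (b := symProdL 𝕜) (θ := fun i => dotL (θ i))
    (ψ := fun i => dotL (ψ i)) (Module.finrank_fin_fun 𝕜) symProd_comm (hF s hsM.1) hsM.2
    (fun i => by rw [quad_symProdL]; exact hξ i)
    (fun i j hij => polar_ne_zero hs (hξ i) (hξ j) (hi i j hij)) (exists_fderiv_ne_zero hs)
    (fun i => exists_polar_ne_zero hs fun h0 => ?_) (fun i v h1 h2 h3 => hloc i v h1 h2 h3)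
    hθ ?_ (fun i => (hh i).1) (fun i => (hh i).2)
  · have := hθ i
    rw [h0, dotProduct_zero] at this
    exact zero_ne_one this
  -- Membership in `Ω` and pairwise independence are open conditions, so involutivity applies at all
  -- nearby points of the hypersurface with isotropic directions.
  · have h1 : ∀ᶠ p : SymMat 𝕜 × (Fin n → Fin 3 → 𝕜) in 𝓝 (s, ξ), p.1 ∈ Ω :=
      continuous_fst.continuousAt.eventually_mem (hΩ.mem_nhds hsM.1)
    have h2 : ∀ᶠ p : SymMat 𝕜 × (Fin n → Fin 3 → 𝕜) in 𝓝 (s, ξ), ∀ i j, i ≠ j →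
        LinearIndependent 𝕜 ![p.2 i, p.2 j] := by
      refine eventually_all.2 fun i => eventually_all.2 fun j => ?_
      by_cases hij : i = j
      · exact Eventually.of_forall fun p hne => absurd hij hne
      have hc : Continuous fun p : SymMat 𝕜 × (Fin n → Fin 3 → 𝕜) => ![p.2 i, p.2 j] := by
        refine continuous_pi fun a => ?_
        fin_cases a
        · exact (continuous_apply i).comp continuous_snd
        · exact (continuous_apply j).comp continuous_snd
      have := hc.continuousAt.eventually_mem (x := (s, ξ))
        (isOpen_setOfPred_linearIndependent.mem_nhds (hi i j hij))
      exact this.mono fun p hp _ => hp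
    filter_upwards [h1, h2] with p hp1 hp2 hp3 hp4
    rw [quad_symProdL] at hp4
    exact hinv p.1 ⟨hp1, hp3⟩ p.2 hp4 hp2

/-- Uniqueness of characteristic nets with given speeds along the axes. -/
theorem IsNet.eq_of_axes (hF : AnalyticAt 𝕜 F s) (hs : IsNonsingularConic F s)
    (hξ : ∀ i, fderiv 𝕜 F s (sqMat (ξ i)) = 0)
    (hi : ∀ i j, i ≠ j → LinearIndependent 𝕜 ![ξ i, ξ j])
    (hloc : ∀ i, IsLocalParameter F s (ξ i) (θ i) (ψ i))
    {Φ' : (Fin n → 𝕜) → SymMat 𝕜} {η' : Fin n → (Fin n → 𝕜) → Fin 3 → 𝕜}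
    (hnet : IsNet (symProdL 𝕜) F Φ η) (hnet' : IsNet (symProdL 𝕜) F Φ' η')
    (h0 : Φ 0 = s) (h0' : Φ' 0 = s) (hη0 : ∀ i, η i 0 = ξ i) (hη0' : ∀ i, η' i 0 = ξ i)
    (hax : ∀ i, ∀ᶠ t in 𝓝 (0 : 𝕜), dotL (θ i) (η i (Pi.single i t)) = 1 ∧
      dotL (ψ i) (η i (Pi.single i t)) = h i t)
    (hax' : ∀ i, ∀ᶠ t in 𝓝 (0 : 𝕜), dotL (θ i) (η' i (Pi.single i t)) = 1 ∧
      dotL (ψ i) (η' i (Pi.single i t)) = h i t) :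
    ∀ᶠ R in 𝓝 0, Φ R = Φ' R ∧ ∀ i, η i R = η' i R :=
  IsNet.eq_of_goursat (b := symProdL 𝕜) (θ := fun i => dotL (θ i)) (ψ := fun i => dotL (ψ i))
    (Module.finrank_fin_fun 𝕜) symProd_comm (fun _ _ _ _ => symProd_eq_symProd) hF
    (fun i v h1 h2 h3 => hloc i v h1 h2 h3) hi
    (fun i j hij => polar_ne_zero hs (hξ i) (hξ j) (hi i j hij)) hnet hnet' h0 h0' hη0 hη0'
    fun i => by
      filter_upwards [hax i, hax' i] with t h1 h2
      exact ⟨h1.1.trans h2.1.symm, h1.2.trans h2.2.symm⟩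

theorem hasDerivAt_single_comp {E : Type*} [NormedAddCommGroup E] [NormedSpace 𝕜 E]
    {f : (Fin n → 𝕜) → E} (i : Fin n) {t : 𝕜} (hf : DifferentiableAt 𝕜 f (Pi.single i t)) :
    HasDerivAt (fun t => f (Pi.single i t)) (pd i f (Pi.single i t)) t := by
  have h1 : HasDerivAt (fun t : 𝕜 => (Pi.single i t : Fin n → 𝕜)) (Pi.single i 1) t := by
    have := (ContinuousLinearMap.single 𝕜 (fun _ : Fin n => 𝕜) i).hasDerivAt (x := t)
    simpa using this
  exact hf.hasFDerivAt.comp_hasDerivAt t h1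

theorem analyticAt_single_comp {E : Type*} [NormedAddCommGroup E] [NormedSpace 𝕜 E]
    {f : (Fin n → 𝕜) → E} (i : Fin n) (hf : AnalyticAt 𝕜 f 0) :
    AnalyticAt 𝕜 (fun t : 𝕜 => f (Pi.single i t)) 0 :=
  hf.comp_of_eq ((ContinuousLinearMap.single 𝕜 (fun _ : Fin n => 𝕜) i).analyticAt 0)
    (by simp)

/-- Near a point with independent vectors, the image of a net is a holonomic submanifold. -/
theorem IsNet.exists_isHolonomicIn (hΩ : IsOpen Ω) (hF : AnalyticOnNhd 𝕜 F Ω)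
    (hnet : IsNet (symProdL 𝕜) F Φ η) (h0 : Φ 0 ∈ Ω)
    (hli : LinearIndependent 𝕜 fun i => η i 0) {A : Set (Fin n → 𝕜)} (hA : A ∈ 𝓝 0) :
    ∃ D ⊆ A, 0 ∈ D ∧ IsLocalParam n (Φ '' D) D Φ ∧ IsHolonomicIn n Ω F (Φ '' D) := by
  have hpd := hnet.pd_eq
  rw [quad_symProdL] at hpd
  have hinj : Function.Injective (fderiv 𝕜 Φ 0) := by
    refine (injective_iff_map_eq_zero _).2 fun v hv => ?_
    rw [fderiv_eq_sum_pd] at hv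
    have h1 : ∑ i, v i • sqMat (η i 0) = 0 := by
      refine Eq.trans (Finset.sum_congr rfl fun i _ => ?_) hv
      rw [hpd.self_of_nhds i]
    have h2 := linearIndependent_sqMat hli
    have h3 := Fintype.linearIndependent_iff.1 h2 v h1
    exact funext h3
  have hne : ∀ᶠ R in 𝓝 (0 : Fin n → 𝕜), ∀ i, η i R ≠ 0 :=
    eventually_all.2 fun i => (hnet.analytic_vec i).continuousAt.eventually_ne (hli.ne_zero i)
  have hdom : ∀ᶠ R in 𝓝 (0 : Fin n → 𝕜), Φ R ∈ Ω :=
    hnet.analytic_map.continuousAt.eventually_mem (hΩ.mem_nhds h0)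
  have hiso := hnet.isotropic (hF _ h0)
  rw [quad_symProdL] at hiso
  obtain ⟨D, hDA, hD0, hD⟩ := exists_isLocalParam_image hnet.analytic_map hinj
    (inter_mem hA (hpd.and (hne.and (hdom.and (hnet.mem.and hiso)))))
  refine ⟨D, fun R hR => (hDA hR).1, hD0, hD, ?_, fun s hs => ⟨D, Φ, hD, hs, fun R hR i => ?_⟩⟩
  · rintro _ ⟨R, hR, rfl⟩
    obtain ⟨-, -, -, h1, h2, -⟩ := hDA hR
    exact ⟨h1, h2⟩
  · obtain ⟨-, h1, h2, -, -, h3⟩ := hDA hR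
    rw [h1 i]
    refine ⟨h3 i, ?_⟩
    have := rank_smul_sqMat (one_ne_zero (α := 𝕜)) (h2 i)
    rwa [one_smul] at this

theorem IsLocalParam.hasCharacteristicCurves (hφ : IsLocalParam n S D φ) (hD : 0 ∈ D)
    (h0 : φ 0 = s) (hnet : IsNet (symProdL 𝕜) F φ η) (hη0 : ∀ i, η i 0 = ξ i)
    (hax : ∀ i, ∀ᶠ t in 𝓝 (0 : 𝕜), dotL (θ i) (η i (Pi.single i t)) = 1 ∧
      dotL (ψ i) (η i (Pi.single i t)) = h i t) : HasCharacteristicCurves s ξ θ ψ h S := by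
  intro i
  refine ⟨fun t => φ (Pi.single i t), fun t => η i (Pi.single i t),
    analyticAt_single_comp i hnet.analytic_map, analyticAt_single_comp i (hnet.analytic_vec i),
    by simpa using h0, by simpa using hη0 i, ?_⟩
  have hpd := hnet.pd_eq
  rw [quad_symProdL] at hpd
  filter_upwards [hax i, (tendsto_single i).eventually hpd,
    (tendsto_single i).eventually (hφ.isOpen.mem_nhds hD)] with t h1 h2 h3
  have h4 := hasDerivAt_single_comp i (hφ.analytic _ h3).differentiableAt
  rw [h2 i] at h4
  exact ⟨hφ.mem h3, h4, h1.1, h1.2⟩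

/-- Along its characteristic curves, a holonomic submanifold is parametrized by a net. -/
theorem IsHolonomicIn.exists_isNet (hn : n = 2 ∨ n = 3) (hS : IsHolonomicIn n Ω F S)
    (hs : IsNonsingularConic F s) (hξ : ∀ i, fderiv 𝕜 F s (sqMat (ξ i)) = 0)
    (hi : ∀ i j, i ≠ j → LinearIndependent 𝕜 ![ξ i, ξ j])
    (hθ : ∀ i, dotProduct (θ i) (ξ i) = 1) (hc : HasCharacteristicCurves s ξ θ ψ h S) :
    ∃ (D : Set (Fin n → 𝕜)) (φ : (Fin n → 𝕜) → SymMat 𝕜) (η : Fin n → (Fin n → 𝕜) → Fin 3 → 𝕜),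
      IsLocalParam n S D φ ∧ 0 ∈ D ∧ φ 0 = s ∧ IsNet (symProdL 𝕜) F φ η ∧ (∀ i, η i 0 = ξ i) ∧
      ∀ i, ∀ᶠ t in 𝓝 (0 : 𝕜), dotL (θ i) (η i (Pi.single i t)) = 1 ∧
        dotL (ψ i) (η i (Pi.single i t)) = h i t := by
  choose c ζ hca hζa hc0 hζ0 hev using hc
  have i₀ : Fin n := ⟨0, by omega⟩
  have hsS : s ∈ S := hc0 i₀ ▸ (hev i₀).self_of_nhds.1
  have hT : ∀ i, sqMat (ξ i) ∈ tangentVectors n S s := by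
    intro i
    obtain ⟨D, χ, hχ, ⟨R, hR, hRs⟩, -⟩ := hS.2 s hsS
    have h1 := hχ.fderiv_mem_range hR (hca i).differentiableAt ((hc0 i).trans hRs.symm)
      ((hev i).mono fun t ht => ht.1) 1
    have h2 : fderiv 𝕜 (c i) 0 1 = sqMat (ξ i) := by
      rw [← hζ0 i]
      exact (hev i).self_of_nhds.2.1.deriv
    rw [h2] at h1
    exact ⟨D, χ, hχ, R, hR, hRs, h1⟩
  obtain ⟨D, φ, η, hφ, hD, h0, hnet, hη0, hax⟩ :=
    IsHolonomic.exists_isNet hn hS.2 hS.1 hsS hs hξ hi hθ hT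
  refine ⟨D, φ, η, hφ, hD, h0, hnet, hη0, fun i => ?_⟩
  have hli : LinearIndependent 𝕜 fun i => η i 0 := by
    simp only [hη0]
    exact linearIndependent_of_conic hs hn hξ hi
  have h1 := hφ.characteristic_curve_eq hD hnet hli (hax i) (hca i) ((hc0 i).trans h0.symm)
    ((hζ0 i).trans (hη0 i).symm) ((hev i).mono fun t ht => ⟨ht.1, ht.2.1, ht.2.2.1⟩)
  filter_upwards [hax i, h1, hev i] with t h2 h3 h4
  refine ⟨h2, ?_⟩
  rw [← h3]
  exact h4.2.2.2

theorem IsLocalParam.eventually_mem_of_eq {S' : Set (SymMat 𝕜)} {D' : Set (Fin n → 𝕜)}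
    {φ' : (Fin n → 𝕜) → SymMat 𝕜} (hφ : IsLocalParam n S D φ) (hφ' : IsLocalParam n S' D' φ')
    (hD : 0 ∈ D) (hD' : 0 ∈ D') (heq : ∀ᶠ R in 𝓝 0, φ R = φ' R) :
    ∀ᶠ U in 𝓝 (φ 0), U ∈ S → U ∈ S' := by
  obtain ⟨ρ, hρ, hρ0, hρS, -⟩ := hφ.exists_coordinates hD
  have hc : Tendsto ρ (𝓝 (φ 0)) (𝓝 0) := by
    have := hρ.continuousAt.tendsto
    rwa [hρ0] at this
  filter_upwards [hρS, hc.eventually heq, hc.eventually (hφ'.isOpen.mem_nhds hD')]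
    with U h1 h2 h3 hU
  rw [← (h1 hU).2, h2]
  exact hφ'.mem h3

/-- Holonomic submanifolds are parametrized by their characteristic curves through a point. -/
theorem parametrizedByFunctions (hn : n = 2 ∨ n = 3) (hΩ : IsOpen Ω) (hF : AnalyticOnNhd 𝕜 F Ω)
    (hγ : ∀ s ∈ hypersurface Ω F, IsNonsingularConic F s) (hinv : IsInvolutive n Ω F) :
    ParametrizedByFunctions n Ω F (IsHolonomicIn n Ω F) := by
  intro s hsM ξ θ ψ hξ hi hθ hloc
  have hs := hγ s hsM
  refine ⟨fun h hh => ⟨?_, fun S S' hS hS' hc hc' => ?_⟩, fun S hS hsS hT => ?_⟩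
  · obtain ⟨Φ, η, hnet, h0, hη0, hax⟩ := hinv.exists_isNet hΩ hF hsM hs hξ hi hθ hloc hh
    obtain ⟨D, -, hD, hΦ, hS⟩ := hnet.exists_isHolonomicIn hΩ hF (h0 ▸ hsM.1)
      (by simp only [hη0]; exact linearIndependent_of_conic hs hn hξ hi) univ_mem
    exact ⟨Φ '' D, hS, ⟨0, hD, h0⟩, hΦ.hasCharacteristicCurves hD h0 hnet hη0 hax⟩
  -- The characteristic curves are the axes of a normalized net on each submanifold. The two nets
  -- thus have the same data and coincide as germs.
  · obtain ⟨D, φ, η, hφ, hD, h0, hnet, hη0, hax⟩ := hS.exists_isNet hn hs hξ hi hθ hc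
    obtain ⟨D', φ', η', hφ', hD', h0', hnet', hη0', hax'⟩ := hS'.exists_isNet hn hs hξ hi hθ hc'
    have heq := (hnet.eq_of_axes (hF s hsM.1) hs hξ hi hloc hnet' h0 h0' hη0 hη0' hax hax').mono
      fun R hR => hR.1
    have h1 := hφ.eventually_mem_of_eq hφ' hD hD' heq
    have h2 := hφ'.eventually_mem_of_eq hφ hD' hD (heq.mono fun R hR => hR.symm)
    rw [h0] at h1
    rw [h0'] at h2
    filter_upwards [h1, h2] with U h1 h2
    exact ⟨h1, h2⟩
  · obtain ⟨D, φ, η, hφ, hD, h0, hnet, hη0, hax⟩ :=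
      IsHolonomic.exists_isNet hn hS.2 hS.1 hsS hs hξ hi hθ hT
    refine ⟨fun i t => dotL (ψ i) (η i (Pi.single i t)), fun i => ⟨?_, ?_⟩, ?_, fun h' hc i => ?_⟩
    · exact ((dotL (ψ i)).analyticAt _).comp (analyticAt_single_comp i (hnet.analytic_vec i))
    · simp only [Pi.single_zero, hη0]
      rfl
    · exact hφ.hasCharacteristicCurves hD h0 hnet hη0 fun i => (hax i).mono fun t ht => ⟨ht, rfl⟩
    · obtain ⟨c, ζ, hca, hζa, hc0, hζ0, hev⟩ := hc i
      have hli : LinearIndependent 𝕜 fun i => η i 0 := by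
        simp only [hη0]
        exact linearIndependent_of_conic hs hn hξ hi
      have h1 := hφ.characteristic_curve_eq hD hnet hli (hax i) hca (hc0.trans h0.symm)
        (hζ0.trans (hη0 i).symm) (hev.mono fun t ht => ⟨ht.1, ht.2.1, ht.2.2.1⟩)
      filter_upwards [h1, hev] with t h3 h4
      rw [← h3]
      exact h4.2.2.2.symm

end Parametrization

/-! ### Involutivity from the existence of holonomic submanifolds -/

section Necessity

variable {n : ℕ} {S : Set (SymMat 𝕜)} {F : SymMat 𝕜 → 𝕜} {s : SymMat 𝕜} {Ω : Set (SymMat 𝕜)}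

/-- Local parameters on a nonsingular conic exist. -/
theorem exists_isLocalParameter (hs : IsNonsingularConic F s) {ξ θ : Fin 3 → 𝕜}
    (hξ : fderiv 𝕜 F s (sqMat ξ) = 0) (hθ : dotProduct θ ξ = 1) :
    ∃ ψ, IsLocalParameter F s ξ θ ψ := by
  set L : (Fin 3 → 𝕜) →L[𝕜] 𝕜 := (fderiv 𝕜 F s).comp (symProdL 𝕜 ξ) with hL
  have hLv : ∀ v, L v = fderiv 𝕜 F s (symProd ξ v) := fun v => rfl
  -- `ψ` must complete `θ` and the polar form `β` of `ξ` to a basis of the dual space. These two are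
  -- independent because `β` is nonzero and vanishes at `ξ`, whereas `θ` is 1 there.
  set β : Fin 3 → 𝕜 := fun k => L (Pi.single k 1) with hβ
  have hβv : ∀ v, dotProduct β v = L v := by
    intro v
    conv_rhs => rw [pi_eq_sum_univ' v, map_sum]
    refine Finset.sum_congr rfl fun k _ => ?_
    rw [map_smul, smul_eq_mul, mul_comm]
  have hξ0 : ξ ≠ 0 := by
    rintro rfl
    rw [dotProduct_zero] at hθ
    exact zero_ne_one hθ
  obtain ⟨w, hw⟩ := exists_polar_ne_zero hs hξ0
  have hli : LinearIndependent 𝕜 ![θ, β] := by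
    refine LinearIndependent.pair_iff.2 fun a c hac => ?_
    have h1 : ∀ v, a * dotProduct θ v + c * L v = 0 := by
      intro v
      have := congrArg (fun u => dotProduct u v) hac
      simpa [add_dotProduct, smul_dotProduct, hβv] using this
    have ha : a = 0 := by
      have := h1 ξ
      rwa [hθ, hLv, polar_self hξ, mul_one, mul_zero, add_zero] at this
    refine ⟨ha, ?_⟩
    have := h1 w
    rw [ha, zero_mul, zero_add] at this
    exact (mul_eq_zero.1 this).resolve_right hw
  obtain ⟨ψ, hψ⟩ := exists_linearIndependent_snoc_of_lt_finrank hli (by simp)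
  refine ⟨ψ, fun v h1 h2 h3 => ?_⟩
  have hu : IsUnit (Matrix.of (Fin.snoc (α := fun _ => Fin 3 → 𝕜) ![θ, β] ψ) :
      Matrix (Fin 3) (Fin 3) 𝕜) :=
    Matrix.linearIndependent_rows_iff_isUnit.1 hψ
  refine Matrix.mulVec_injective_of_isUnit hu ?_
  rw [Matrix.mulVec_zero]
  funext k
  fin_cases k
  · exact h1
  · exact (hβv v).trans h3
  · exact h2

theorem exists_dotProduct_eq_one {ξ : Fin 3 → 𝕜} (hξ : ξ ≠ 0) :
    ∃ θ : Fin 3 → 𝕜, dotProduct θ ξ = 1 := by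
  obtain ⟨k, hk⟩ := Function.ne_iff.1 hξ
  exact ⟨Pi.single k (ξ k)⁻¹, by rw [single_dotProduct]; exact inv_mul_cancel₀ hk⟩

theorem IsNet.obstruction_zero {φ : (Fin n → 𝕜) → SymMat 𝕜} {η : Fin n → (Fin n → 𝕜) → Fin 3 → 𝕜}
    (hnet : IsNet (symProdL 𝕜) F φ η) (h0 : φ 0 = s) (hF : AnalyticAt 𝕜 F s)
    (hs : IsNonsingularConic F s) {ξ : Fin n → Fin 3 → 𝕜} (hη0 : ∀ i, η i 0 = ξ i)
    (hξ : ∀ i, fderiv 𝕜 F s (sqMat (ξ i)) = 0)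
    (hi : ∀ i j, i ≠ j → LinearIndependent 𝕜 ![ξ i, ξ j]) {i j k : Fin n} (hij : i ≠ j)
    (hik : i ≠ k) (hjk : j ≠ k) : obstruction (symProdL 𝕜) F s (ξ i) (ξ j) (ξ k) = 0 := by
  subst h0
  have h1 := IsNet.obstruction_eq_zero (b := symProdL 𝕜) symProd_comm hnet hF
    (fun _ _ _ _ => symProd_eq_symProd) (fun i j hij => by rw [hη0, hη0]; exact hi i j hij)
    (fun i j hij => by
      rw [hη0, hη0]; exact polar_ne_zero hs (hξ i) (hξ j) (hi i j hij)) hij hik hjk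
  rwa [hη0, hη0, hη0] at h1

theorem IsHolonomicIn.obstruction_eq_zero (hF : AnalyticOnNhd 𝕜 F Ω) (hS : IsHolonomicIn 3 Ω F S)
    (hsS : s ∈ S) (hs : IsNonsingularConic F s) {ξ : Fin 3 → Fin 3 → 𝕜}
    (hξ : ∀ i, fderiv 𝕜 F s (sqMat (ξ i)) = 0)
    (hi : ∀ i j, i ≠ j → LinearIndependent 𝕜 ![ξ i, ξ j])
    (hT : ∀ i, sqMat (ξ i) ∈ tangentVectors 3 S s) {i j k : Fin 3} (hij : i ≠ j) (hik : i ≠ k)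
    (hjk : j ≠ k) : obstruction (symProdL 𝕜) F s (ξ i) (ξ j) (ξ k) = 0 := by
  have hli := linearIndependent_of_conic hs (Or.inr rfl) hξ hi
  choose θ hθ using fun i => exists_dotProduct_eq_one (hli.ne_zero i)
  obtain ⟨D, φ, η, -, -, h0, hnet, hη0, -⟩ :=
    IsHolonomic.exists_isNet (Or.inr rfl) hS.2 hS.1 hsS hs hξ hi hθ hT
  exact hnet.obstruction_zero h0 (hF s (hS.1 hsS).1) hs hη0 hξ hi hij hik hjk

/-- Every triple of characteristic directions at every point is tangent to some holonomic 3-fold,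
and the net it carries forces the obstruction to vanish. Constant data already suffice. -/
theorem ParametrizedByFunctions.isInvolutive (hF : AnalyticOnNhd 𝕜 F Ω)
    (hγ : ∀ s ∈ hypersurface Ω F, IsNonsingularConic F s)
    (h : ParametrizedByFunctions 3 Ω F (IsHolonomicIn 3 Ω F)) : IsInvolutive 3 Ω F := by
  intro s hsM ξ hξ hi i j k hij hik hjk
  have hs := hγ s hsM
  have hli := linearIndependent_of_conic hs (Or.inr rfl) hξ hi
  choose θ hθ using fun i => exists_dotProduct_eq_one (hli.ne_zero i)
  choose ψ hψ using fun i => exists_isLocalParameter hs (hξ i) (hθ i)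
  obtain ⟨⟨S, hS, hsS, hc⟩, -⟩ := (h s hsM ξ θ ψ hξ hi hθ hψ).1
    (fun i _ => dotProduct (ψ i) (ξ i)) fun i => ⟨analyticAt_const, rfl⟩
  obtain ⟨D, φ, η, -, -, h0, hnet, hη0, -⟩ := hS.exists_isNet (Or.inr rfl) hs hξ hi hθ hc
  exact hnet.obstruction_zero h0 (hF s hsM.1) hs hη0 hξ hi hij hik hjk

end Necessity

/-! ### Reductions with prescribed speeds along the axes -/

section Reductions

variable {n : ℕ} {F : SymMat 𝕜 → 𝕜} {s : SymMat 𝕜} {Ω M : Set (SymMat 𝕜)}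
  {D D' : Set (Fin n → 𝕜)} {U U' : (Fin n → 𝕜) → SymMat 𝕜} {lam mu : Fin n → (Fin n → 𝕜) → 𝕜}
  {ξ ψ : Fin n → Fin 3 → 𝕜} {h : Fin n → 𝕜 → 𝕜}

theorem dotL_fst (ζ : Fin 3 → 𝕜) : dotL ![1, 0, 0] ζ = ζ 0 := by
  rw [dotL_apply]
  simp [dotProduct, Fin.sum_univ_three]

theorem eq_of_sqMat_eq {ζ η : Fin 3 → 𝕜} (h : sqMat ζ = sqMat η) (h0 : ζ 0 = 1) (h1 : η 0 = 1) :
    ζ = η := by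
  funext k
  have h2 : ζ 0 * ζ k = η 0 * η k := congrArg (fun V : SymMat 𝕜 => V.1 0 k) h
  rwa [h0, h1, one_mul, one_mul] at h2

theorem speedVec_eq {V : SymMat 𝕜} {ζ : Fin 3 → 𝕜} (h : V = sqMat ζ) (h0 : ζ 0 ≠ 0) :
    speedVec (V.1 0 1 / V.1 0 0) (V.1 0 2 / V.1 0 0) = (ζ 0)⁻¹ • ζ := by
  subst h
  simp only [sqMat_apply]
  funext k
  fin_cases k <;> simp [speedVec] <;> field_simp

theorem linearIndependent_sqMat_pair {ζ η : Fin 3 → 𝕜} (h : LinearIndependent 𝕜 ![ζ, η]) :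
    LinearIndependent 𝕜 ![sqMat ζ, sqMat η] := by
  have h1 := linearIndependent_sqMat h
  convert h1 using 1
  funext i
  fin_cases i <;> rfl

/-- A characteristic net of finite speeds is a reduction. -/
theorem IsNet.exists_isReduction {η : Fin n → (Fin n → 𝕜) → Fin 3 → 𝕜} (hΩ : IsOpen Ω)
    (hnet : IsNet (symProdL 𝕜) F U η) (h0 : U 0 ∈ Ω) (hη0 : ∀ i, η i 0 0 ≠ 0)
    (hi : ∀ i j, i ≠ j → LinearIndependent 𝕜 ![η i 0, η j 0]) :
    ∃ D, 0 ∈ D ∧ IsReduction (hypersurface Ω F) n D U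
      (fun i R => (pd i U R).1 0 2 / (pd i U R).1 0 0)
      (fun i R => (pd i U R).1 0 1 / (pd i U R).1 0 0) := by
  have hpd := hnet.pd_eq
  rw [quad_symProdL] at hpd
  have h1 : ∀ᶠ R in 𝓝 (0 : Fin n → 𝕜), U R ∈ Ω :=
    hnet.analytic_map.continuousAt.eventually_mem (hΩ.mem_nhds h0)
  have h2 : ∀ᶠ R in 𝓝 (0 : Fin n → 𝕜), ∀ i, η i R 0 ≠ 0 := eventually_all.2 fun i =>
    ((continuous_apply (0 : Fin 3)).continuousAt.comp
      (hnet.analytic_vec i).continuousAt).eventually_ne (hη0 i)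
  have h3 : ∀ᶠ R in 𝓝 (0 : Fin n → 𝕜), ∀ i j, i ≠ j → LinearIndependent 𝕜 ![η i R, η j R] := by
    refine eventually_all.2 fun i => eventually_all.2 fun j => ?_
    by_cases hij : i = j
    · exact Eventually.of_forall fun R hne => absurd hij hne
    have hc : ContinuousAt (fun R : Fin n → 𝕜 => ![η i R, η j R]) 0 := by
      refine continuousAt_pi.2 fun a => ?_
      fin_cases a
      · exact (hnet.analytic_vec i).continuousAt
      · exact (hnet.analytic_vec j).continuousAt
    exact (hc.eventually_mem (isOpen_setOfPred_linearIndependent.mem_nhds (hi i j hij))).mono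
      fun R hR _ => hR
  obtain ⟨D, hD, hDo, hD0⟩ := mem_nhds_iff.1
    (hnet.analytic_map.eventually_analyticAt.and (hpd.and (hnet.mem.and (h1.and (h2.and h3)))))
  refine ⟨D, hD0, DispersionlessHirota.exists_isReduction hDo (fun R hR => (hD hR).1)
    (fun R hR => ⟨(hD hR).2.2.2.1, (hD hR).2.2.1⟩) (fun R hR i => ?_) (fun R hR i => ?_)
    fun R hR i j hij => ?_⟩ <;> obtain ⟨-, hp, -, -, hz, hl⟩ := hD hR
  · rw [hp]
    have := rank_smul_sqMat (one_ne_zero (α := 𝕜)) fun h => hz i (congrFun h 0)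
    rwa [one_smul] at this
  · rw [hp]
    exact mul_ne_zero (hz i) (hz i)
  · rw [hp, hp]
    exact linearIndependent_sqMat_pair (hl i j hij)

/-- The normalization `u_xx = s_xx + R^i` on the axis becomes the normalization of net vectors by
the form `θ = (1, 0, 0)`. -/
theorem HasGoursatData.pd_entry_eq (hU : AnalyticAt 𝕜 U 0) (hd : HasGoursatData s ξ ψ h D U lam mu)
    (i : Fin n) : ∀ᶠ t in 𝓝 (0 : 𝕜), (pd i U (Pi.single i t)).1 0 0 = 1 := by
  have h1 := ((hd.2.2.2 i).mono fun t ht => ht.1).eventually_nhds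
  filter_upwards [h1, (tendsto_single i).eventually hU.eventually_analyticAt] with t h2 h3
  have h4 := (entryL (𝕜 := 𝕜) 0 0).hasFDerivAt.comp_hasDerivAt t
    (hasDerivAt_single_comp i h3.differentiableAt)
  have h5 : HasDerivAt (fun t => s.1 0 0 + t) 1 t := (hasDerivAt_id t).const_add _
  exact (h4.congr_of_eventuallyEq (h2.mono fun t ht => ht.symm)).unique h5

/-- A normalized reduction is a characteristic net. -/
theorem IsReduction.exists_isNet (hR : IsReduction (hypersurface Ω F) n D U lam mu)
    (hd : HasGoursatData s ξ ψ h D U lam mu) :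
    ∃ η : Fin n → (Fin n → 𝕜) → Fin 3 → 𝕜, IsNet (symProdL 𝕜) F U η ∧ (∀ i, η i 0 = ξ i) ∧
      ∀ i, ∀ᶠ t in 𝓝 (0 : 𝕜), dotL ![1, 0, 0] (η i (Pi.single i t)) = 1 ∧
        dotL (ψ i) (η i (Pi.single i t)) = h i t := by
  have hU := hR.analytic_U 0 hd.1
  have hDn := hR.isOpen.mem_nhds hd.1
  have hone := hd.pd_entry_eq hU
  obtain ⟨η, hnet, hη0, hη1⟩ := exists_isNet_of_rank_one (F := F) (θ := fun _ => ![1, 0, 0]) hU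
    (Filter.mem_of_superset hDn fun R hRD => (hR.pd_eq hRD).1.2)
    (Filter.mem_of_superset hDn fun R hRD i => by
      have h1 := (hR.pd_eq hRD).2 i
      change (pd i U R).1.rank = 1
      rw [h1.2]
      exact rank_smul_sqMat h1.1 fun h0 => one_ne_zero (α := 𝕜) (congrFun h0 0))
    (ξ := ξ) (fun i => by
      have h1 := ((hR.pd_eq hd.1).2 i).2
      have h2 := (hone i).self_of_nhds
      rw [Pi.single_zero] at h2
      rw [h2, one_smul] at h1
      rw [h1, ← hd.2.2.1 i]
      rfl)
    (fun i => by rw [dotL_fst, ← hd.2.2.1 i]; rfl)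
  refine ⟨η, hnet, hη0, fun i => ?_⟩
  have hpd := hnet.pd_eq
  rw [quad_symProdL] at hpd
  filter_upwards [hone i, (tendsto_single i).eventually hpd, (tendsto_single i).eventually hDn,
    hd.2.2.2 i] with t h1 h2 h3 h4
  have h5 : dotL ![1, 0, 0] (η i (Pi.single i t)) = 1 := by
    refine hη1 i _ ?_
    rw [dotL_fst]
    refine Eq.trans ?_ h1
    change ∑ j, (pd i U (Pi.single i t)).1 0 j * (![1, 0, 0] : Fin 3 → 𝕜) j = _
    simp [Fin.sum_univ_three]
  refine ⟨h5, ?_⟩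
  rw [dotL_fst] at h5
  have h6 := ((hR.pd_eq h3).2 i).2
  rw [h1, one_smul, h2 i] at h6
  rw [eq_of_sqMat_eq h6 h5 rfl, ← h4.2]
  rfl

/-- Involutive equations possess reductions with arbitrary speeds along the axes. -/
theorem IsInvolutive.hasReductions (hinv : IsInvolutive 3 Ω F) (hΩ : IsOpen Ω)
    (hF : AnalyticOnNhd 𝕜 F Ω) (hγ : ∀ s ∈ hypersurface Ω F, IsNonsingularConic F s) (n : ℕ) :
    HasReductionsParametrizedByFunctions n Ω F := by
  intro s hsM ξ ψ hξ hne hloc h hh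
  have hs := hγ s hsM
  have hi : ∀ i j, i ≠ j → LinearIndependent 𝕜 ![ξ i, ξ j] := fun i j hij =>
    linearIndependent_of_ne (hξ i).1 (hξ j).1 (hne i j hij)
  have hθ : ∀ i, dotProduct ![1, 0, 0] (ξ i) = 1 := fun i => (dotL_fst _).trans (hξ i).1
  refine ⟨?_, fun D D' U U' lam mu lam' mu' hR hd hR' hd' => ?_⟩
  -- Nets require only pairwise independent directions, so the number of components is arbitrary
  -- here, although `U` need not be an immersion for large `n`.
  · obtain ⟨Φ, η, hnet, h0, hη0, hax⟩ := (hinv.of_three n).exists_isNet hΩ hF hsM hs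
      (fun i => (hξ i).2) hi hθ hloc hh
    obtain ⟨D, hD0, hD⟩ := hnet.exists_isReduction hΩ (h0 ▸ hsM.1)
      (fun i => by rw [hη0, (hξ i).1]; exact one_ne_zero)
      (fun i j hij => by rw [hη0, hη0]; exact hi i j hij)
    have hpd := hnet.pd_eq
    rw [quad_symProdL] at hpd
    refine ⟨D, Φ, _, _, hD, hD0, h0, fun i => ?_, fun i => ?_⟩
    · refine (speedVec_eq (hpd.self_of_nhds i) ?_).trans ?_
      · rw [hη0, (hξ i).1]; exact one_ne_zero
      · rw [hη0, (hξ i).1, inv_one, one_smul]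
    · have h1 : ∀ᶠ t in 𝓝 (0 : 𝕜), HasDerivAt (fun t => (Φ (Pi.single i t)).1 0 0) 1 t := by
        filter_upwards [hax i, (tendsto_single i).eventually hpd,
          (tendsto_single i).eventually hnet.analytic_map.eventually_analyticAt] with t h2 h3 h4
        have h5 : HasDerivAt (fun t => (Φ (Pi.single i t)).1 0 0) _ t :=
          (entryL (𝕜 := 𝕜) 0 0).hasFDerivAt.comp_hasDerivAt t
            (hasDerivAt_single_comp i h4.differentiableAt)
        rw [h3 i] at h5
        refine h5.congr_deriv ?_
        have h6 := h2.1
        rw [dotL_fst] at h6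
        change η i (Pi.single i t) 0 * η i (Pi.single i t) 0 = 1
        rw [h6, one_mul]
      have h2 : ∀ᶠ t in 𝓝 (0 : 𝕜), HasDerivAt (fun t => s.1 0 0 + t) 1 t :=
        Eventually.of_forall fun t => (hasDerivAt_id t).const_add _
      have h3 := eventually_eq_of_deriv_eq (f' := fun _ => (1 : 𝕜)) (by
        rw [Pi.single_zero, h0, add_zero]) h1 h2
      filter_upwards [h3, hax i, (tendsto_single i).eventually hpd] with t h4 h5 h6
      refine ⟨h4, ?_⟩
      have h7 := h5.1
      rw [dotL_fst] at h7
      rw [← h5.2]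
      refine congrArg (dotProduct (ψ i)) ((speedVec_eq (h6 i) ?_).trans ?_)
      · rw [h7]; exact one_ne_zero
      · rw [h7, inv_one, one_smul]
  · obtain ⟨η, hnet, hη0, hax⟩ := hR.exists_isNet hd
    obtain ⟨η', hnet', hη0', hax'⟩ := hR'.exists_isNet hd'
    have heq := hnet.eq_of_axes (hF s hsM.1) hs (fun i => (hξ i).2) hi hloc hnet' hd.2.1 hd'.2.1
      hη0 hη0' hax hax'
    -- Equality of the maps near `R` gives equality of their derivatives, and the first row of
    -- `∂_iU` determines the speeds.
    filter_upwards [(heq.mono fun R hR => hR.1).eventually_nhds, hR.isOpen.mem_nhds hd.1,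
      hR'.isOpen.mem_nhds hd'.1] with R h1 h2 h3
    refine ⟨h1.self_of_nhds, fun i => ?_⟩
    have h4 := (hR.pd_eq h2).2 i
    have h5 := (hR'.pd_eq h3).2 i
    rw [← pd_congr i h1] at h5
    have h6 : ∀ k, speedVec (mu i R) (lam i R) k = speedVec (mu' i R) (lam' i R) k := by
      intro k
      have h7 : (pd i U R).1 0 0 • sqMat (speedVec (mu i R) (lam i R)) =
        (pd i U R).1 0 0 • sqMat (speedVec (mu' i R) (lam' i R)) := h4.2.symm.trans h5.2
      have h8 : (pd i U R).1 0 0 * (1 * speedVec (mu i R) (lam i R) k) =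
          (pd i U R).1 0 0 * (1 * speedVec (mu' i R) (lam' i R) k) :=
        congrArg (fun V : SymMat 𝕜 => V.1 0 k) h7
      simpa using mul_left_cancel₀ h4.1 h8
    exact ⟨h6 2, h6 1⟩

end Reductions

/-! ### Involutivity of integrable equations -/

section Integrable

variable {F : SymMat 𝕜 → 𝕜} {s : SymMat 𝕜} {Ω : Set (SymMat 𝕜)}

theorem eventually_quadratic_ne_zero {a b c : 𝕜} (h : a ≠ 0 ∨ b ≠ 0 ∨ c ≠ 0) :
    ∀ᶠ e in 𝓝[≠] (0 : 𝕜), a + e * b + e ^ 2 * c ≠ 0 := by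
  have hlin : ∀ {a b : 𝕜}, a ≠ 0 → ∀ᶠ e in 𝓝[≠] (0 : 𝕜), a + e * b ≠ 0 := by
    intro a b ha
    have h1 : ContinuousAt (fun e : 𝕜 => a + e * b) 0 := by fun_prop
    exact (h1.eventually_ne (by simpa using ha)).filter_mono nhdsWithin_le_nhds
  by_cases ha : a = 0
  · by_cases hb : b = 0
    · have hc : c ≠ 0 := by simpa [ha, hb] using h
      filter_upwards [self_mem_nhdsWithin] with e he
      rw [ha, hb, mul_zero, add_zero, zero_add]
      exact mul_ne_zero (pow_ne_zero 2 he) hc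
    · filter_upwards [self_mem_nhdsWithin, hlin (b := c) hb] with e he h1
      rw [show a + e * b + e ^ 2 * c = e * (b + e * c) by rw [ha]; ring]
      exact mul_ne_zero he h1
  · have h1 : ContinuousAt (fun e : 𝕜 => a + e * b + e ^ 2 * c) 0 := by fun_prop
    exact (h1.eventually_ne (by simpa using ha)).filter_mono nhdsWithin_le_nhds

/-- Directions on the conic are limits of directions with finite speeds. -/
theorem exists_isotropic_curve (hs : IsNonsingularConic F s) {ξ p : Fin 3 → 𝕜}
    (hξ : fderiv 𝕜 F s (sqMat ξ) = 0) (hp : fderiv 𝕜 F s (sqMat p) = 0)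
    (hi : LinearIndependent 𝕜 ![ξ, p]) :
    ∃ x : 𝕜 → Fin 3 → 𝕜, AnalyticAt 𝕜 x 0 ∧ x 0 = ξ ∧ (∀ e, fderiv 𝕜 F s (sqMat (x e)) = 0) ∧
      ∀ᶠ e in 𝓝[≠] (0 : 𝕜), x e 0 ≠ 0 := by
  set B : (Fin 3 → 𝕜) → (Fin 3 → 𝕜) → 𝕜 := fun v w => fderiv 𝕜 F s (symProd v w) with hB
  have hBs : ∀ v w, B v w = B w v := fun v w => congrArg _ (symProd_comm v w)
  have hBadd : ∀ u v w, B u (v + w) = B u v + B u w := fun u v w => by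
    change fderiv 𝕜 F s (symProdL 𝕜 u (v + w)) = _
    rw [map_add, map_add]
    rfl
  have hBsmul : ∀ c v w, B v (c • w) = c * B v w := fun c v w => by
    change fderiv 𝕜 F s (symProdL 𝕜 v (c • w)) = _
    rw [map_smul, map_smul]
    rfl
  have hBξ : B ξ ξ = 0 := polar_self hξ
  have hBp : B p p = 0 := polar_self hp
  have hξp : B ξ p ≠ 0 := polar_ne_zero hs hξ hp hi
  -- The vector `v` is the pole of the line through `ξ` and `p`. In the basis `ξ, p, v` the only
  -- nonzero values of the form are `B ξ p` and `B v v`.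
  obtain ⟨v, hv0, hv1, hv2⟩ : ∃ v : Fin 3 → 𝕜, v ≠ 0 ∧ B ξ v = 0 ∧ B p v = 0 := by
    let L : (Fin 3 → 𝕜) →ₗ[𝕜] 𝕜 × 𝕜 :=
      (((fderiv 𝕜 F s).comp (symProdL 𝕜 ξ)).prod ((fderiv 𝕜 F s).comp (symProdL 𝕜 p))).toLinearMap
    have h1 : ¬ Function.Injective L := fun hinj => by
      have := LinearMap.finrank_le_finrank_of_injective hinj
      simp at this
    rw [injective_iff_map_eq_zero] at h1
    push Not at h1
    obtain ⟨v, hv, hv0⟩ := h1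
    exact ⟨v, hv0, congrArg Prod.fst hv, congrArg Prod.snd hv⟩
  have hli : ∀ a b c : 𝕜, a • ξ + b • p + c • v = 0 → a = 0 ∧ b = 0 ∧ c = 0 := by
    intro a b c h
    have hBz : ∀ u, a * B u ξ + b * B u p + c * B u v = 0 := by
      intro u
      have h1 : B u (a • ξ + b • p + c • v) = 0 := by
        rw [h]
        change fderiv 𝕜 F s (symProdL 𝕜 u 0) = 0
        rw [map_zero, map_zero]
      rwa [hBadd, hBadd, hBsmul, hBsmul, hBsmul] at h1
    have hb : b = 0 := by
      have := hBz ξ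
      rw [hBξ, hv1, mul_zero, mul_zero, zero_add, add_zero] at this
      exact (mul_eq_zero.1 this).resolve_right hξp
    have ha : a = 0 := by
      have := hBz p
      rw [hBp, hv2, hBs p ξ, mul_zero, mul_zero, add_zero, add_zero] at this
      exact (mul_eq_zero.1 this).resolve_right hξp
    rw [ha, hb, zero_smul, zero_smul, zero_add, zero_add] at h
    exact ⟨ha, hb, (smul_eq_zero.1 h).resolve_right hv0⟩
  have hvv : B v v ≠ 0 := by
    intro h
    have h1 : fderiv 𝕜 F s (sqMat v) = 0 := by
      have h2 : (2 : 𝕜) • fderiv 𝕜 F s (sqMat v) = 0 := by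
        rw [← map_smul, ← symProd_self]
        exact h
      exact (smul_eq_zero.1 h2).resolve_left two_ne_zero
    refine polar_ne_zero hs hξ h1 (LinearIndependent.pair_iff.2 fun a c hac => ?_) hv1
    have := hli a 0 c (by rw [zero_smul, add_zero]; exact hac)
    exact ⟨this.1, this.2.2⟩
  -- On the curve `ξ + e v + e² c p` the quadratic form equals `e² (B v v + 2 c B ξ p)`, and `c`
  -- makes it vanish.
  set c : 𝕜 := -(B v v) / (2 * B ξ p) with hc
  have hc0 : c ≠ 0 := div_ne_zero (neg_ne_zero.2 hvv) (mul_ne_zero two_ne_zero hξp)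
  refine ⟨fun e => ξ + e • v + e ^ 2 • c • p, ?_, by simp, fun e => ?_, ?_⟩
  · exact (analyticAt_const.add (analyticAt_id.fun_smul analyticAt_const)).add
      ((analyticAt_id.pow 2).fun_smul analyticAt_const)
  · have h1 : (2 : 𝕜) • fderiv 𝕜 F s (sqMat (ξ + e • v + e ^ 2 • c • p)) = 0 := by
      rw [← map_smul, ← symProd_self]
      change B _ _ = 0
      have hx : ∀ u, B u (ξ + e • v + e ^ 2 • c • p) = B u ξ + e * B u v + e ^ 2 * (c * B u p) := by
        intro u
        rw [hBadd, hBadd, hBsmul, hBsmul, hBsmul]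
      rw [hx, hBs _ ξ, hBs _ v, hBs _ p, hx, hx, hx, hBξ, hBp, hv1, hv2, hBs v ξ, hv1, hBs v p, hv2,
        hBs p ξ]
      have h2 : 2 * B ξ p * c = -B v v := by
        rw [hc]
        field_simp
      linear_combination e ^ 2 * h2
    exact (smul_eq_zero.1 h1).resolve_left two_ne_zero
  -- These are the coefficients of the first entry of `x e` as a polynomial in `e`. If all were
  -- zero, the basis `ξ, p, v` would lie in a plane.
  · have h1 : ξ 0 ≠ 0 ∨ v 0 ≠ 0 ∨ c * p 0 ≠ 0 := by
      by_contra! h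
      obtain ⟨h1, h2, h3⟩ := h
      have h4 : LinearIndependent 𝕜 ![ξ, p, v] := by
        refine Fintype.linearIndependent_iff.2 fun g hg => ?_
        rw [Fin.sum_univ_three] at hg
        obtain ⟨g0, g1, g2⟩ := hli (g 0) (g 1) (g 2) hg
        intro i
        fin_cases i
        · exact g0
        · exact g1
        · exact g2
      have hp0 : p 0 = 0 := (mul_eq_zero.1 h3).resolve_left hc0
      have h5 := h4.span_eq_top_of_card_eq_finrank' (by simp)
      have h6 : Submodule.span 𝕜 (range ![ξ, p, v]) ≤
          LinearMap.ker (LinearMap.proj (R := 𝕜) (φ := fun _ : Fin 3 => 𝕜) 0) := by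
        rw [Submodule.span_le]
        rintro _ ⟨i, rfl⟩
        fin_cases i
        · exact h1
        · exact hp0
        · exact h2
      rw [h5] at h6
      have h7 : (Pi.single 0 1 : Fin 3 → 𝕜) 0 = 0 := h6 (Submodule.mem_top (x := Pi.single 0 1))
      rw [Pi.single_eq_same] at h7
      exact one_ne_zero h7
    filter_upwards [eventually_quadratic_ne_zero h1] with e he
    exact he

/-- Scaled to first entry 1, the directions are speeds of a reduction through `s`. Its image is a
holonomic 3-fold tangent to all three, and such a 3-fold carries a net with these directions. -/
theorem IsIntegrable.obstruction_eq_zero_of_finite (h : IsIntegrable Ω F)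
    (hF : AnalyticOnNhd 𝕜 F Ω) (hγ : ∀ s ∈ hypersurface Ω F, IsNonsingularConic F s)
    (hsM : s ∈ hypersurface Ω F) {ξ : Fin 3 → Fin 3 → 𝕜}
    (hξ : ∀ i, fderiv 𝕜 F s (sqMat (ξ i)) = 0)
    (hi : ∀ i j, i ≠ j → LinearIndependent 𝕜 ![ξ i, ξ j]) (h0 : ∀ i, ξ i 0 ≠ 0) {i j k : Fin 3}
    (hij : i ≠ j) (hik : i ≠ k) (hjk : j ≠ k) :
    obstruction (symProdL 𝕜) F s (ξ i) (ξ j) (ξ k) = 0 := by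
  have hs := hγ s hsM
  set ζ : Fin 3 → Fin 3 → 𝕜 := fun i => (ξ i 0)⁻¹ • ξ i with hζ
  have hζ0 : ∀ i, ζ i 0 = 1 := fun i => inv_mul_cancel₀ (h0 i)
  have hξζ : ∀ i, ξ i = ξ i 0 • ζ i := fun i => by
    rw [hζ, smul_smul, mul_inv_cancel₀ (h0 i), one_smul]
  have hζc : ∀ i, fderiv 𝕜 F s (sqMat (ζ i)) = 0 := fun i => by
    rw [hζ, sqMat_smul, map_smul, hξ, smul_zero]
  choose ψ hψ using fun i => exists_isLocalParameter (θ := ![1, 0, 0]) hs (hζc i)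
    ((dotL_fst _).trans (hζ0 i))
  obtain ⟨⟨D, U, lam, mu, hR, hD0, hU0, hsp, -⟩, -⟩ := h 3 s hsM ζ ψ (fun i => ⟨hζ0 i, hζc i⟩)
    (fun i j hij heq => by
      have h1 := LinearIndependent.pair_iff.1 (hi i j hij) (ξ j 0) (-ξ i 0) (by
        rw [hξζ i, hξζ j, heq]
        simp only [smul_smul, Pi.smul_apply, hζ0, smul_eq_mul, mul_one]
        module)
      exact h0 j h1.1)
    hψ (fun i _ => dotProduct (ψ i) (ζ i)) fun i => ⟨analyticAt_const, rfl⟩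
  obtain ⟨D', hD', hRD', hUD, hS⟩ :=
    (correspondToReductions (Or.inr rfl) hF hγ).1 D U lam mu hR 0 hD0
  refine hS.obstruction_eq_zero hF ⟨0, hRD', hU0⟩ hs hξ hi (fun i => ?_) hij hik hjk
  refine ⟨D', U, hUD, 0, hRD', hU0, ?_⟩
  obtain ⟨hc, hp⟩ := (hR.pd_eq hD0).2 i
  refine ⟨(ξ i 0 ^ 2 * ((pd i U 0).1 0 0)⁻¹) • Pi.single i 1, ?_⟩
  rw [map_smul]
  change _ • pd i U 0 = _
  have key : ∀ (c a : 𝕜) (V W : SymMat 𝕜), c ≠ 0 → V = c • W → (a * c⁻¹) • V = a • W := by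
    rintro c a _ W hc rfl
    rw [smul_smul, mul_assoc, inv_mul_cancel₀ hc, mul_one]
  have hsq : sqMat (ξ i) = ξ i 0 ^ 2 • sqMat (speedVec (mu i 0) (lam i 0)) := by
    rw [show speedVec (mu i 0) (lam i 0) = ζ i from hsp i, ← sqMat_smul, ← hξζ i]
  exact (key _ _ _ _ hc hp).trans hsq.symm

/-- Integrable equations are involutive. -/
theorem IsIntegrable.isInvolutive (h : IsIntegrable Ω F) (hF : AnalyticOnNhd 𝕜 F Ω)
    (hγ : ∀ s ∈ hypersurface Ω F, IsNonsingularConic F s) : IsInvolutive 3 Ω F := by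
  intro s hsM ξ hξ hi i j k hij hik hjk
  have hs := hγ s hsM
  -- Directions of infinite speed are not seen by reductions. Each direction is moved along the
  -- conic, with another of the three as auxiliary point, to reach finite speeds; the obstruction is
  -- continuous along the deformation.
  have hx : ∀ a, ∃ x : 𝕜 → Fin 3 → 𝕜, AnalyticAt 𝕜 x 0 ∧ x 0 = ξ a ∧
      (∀ e, fderiv 𝕜 F s (sqMat (x e)) = 0) ∧ ∀ᶠ e in 𝓝[≠] (0 : 𝕜), x e 0 ≠ 0 := by
    intro a
    obtain ⟨a', ha⟩ := exists_ne a
    exact exists_isotropic_curve hs (hξ a) (hξ a') (hi a a' ha.symm)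
  choose x hxa hx0 hxc hxf using hx
  have hne : ∀ a c, a ≠ c → fderiv 𝕜 F s (symProd (x a 0) (x c 0)) ≠ 0 := fun a c hac => by
    rw [hx0, hx0]
    exact polar_ne_zero hs (hξ a) (hξ c) (hi a c hac)
  have hcont : ContinuousAt (fun e => obstruction (symProdL 𝕜) F s (x i e) (x j e) (x k e)) 0 :=
    (analyticAt_obstruction (u := fun _ => s) (hF s hsM.1) analyticAt_const (hxa i) (hxa j) (hxa k)
      (hne i j hij) (hne i k hik) (hne j k hjk)).continuousAt
  have hli : ∀ᶠ e in 𝓝 (0 : 𝕜), ∀ a c, a ≠ c → LinearIndependent 𝕜 ![x a e, x c e] := by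
    refine eventually_all.2 fun a => eventually_all.2 fun c => ?_
    by_cases hac : a = c
    · exact Eventually.of_forall fun e hne => absurd hac hne
    have hc : ContinuousAt (fun e : 𝕜 => ![x a e, x c e]) 0 := by
      refine continuousAt_pi.2 fun b => ?_
      fin_cases b
      · exact (hxa a).continuousAt
      · exact (hxa c).continuousAt
    refine (hc.eventually_mem (isOpen_setOfPred_linearIndependent.mem_nhds ?_)).mono
      fun e he _ => he
    change LinearIndependent 𝕜 ![x a 0, x c 0]
    rw [hx0, hx0]
    exact hi a c hac
  have hz : ∀ᶠ e in 𝓝[≠] (0 : 𝕜),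
      obstruction (symProdL 𝕜) F s (x i e) (x j e) (x k e) = 0 := by
    filter_upwards [hli.filter_mono nhdsWithin_le_nhds, eventually_all.2 hxf] with e h1 h2
    exact h.obstruction_eq_zero_of_finite hF hγ hsM (ξ := fun a => x a e) (fun a => hxc a e) h1 h2
      hij hik hjk
  have h1 := hcont.tendsto.mono_left (nhdsWithin_le_nhds (s := {(0 : 𝕜)}ᶜ))
  have h2 := tendsto_nhds_unique (h1.congr' hz) tendsto_const_nhds
  rwa [hx0, hx0, hx0] at h2

end Integrable

end

end DispersionlessHirota

end

/-- Both sides of the final equivalence reduce to involutivity for three directions: it is necessary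
for each and sufficient for each. -/
theorem theorem3 {𝕜 : Type*} [RCLike 𝕜]
    (Ω : Set (DispersionlessHirota.SymMat 𝕜)) (hΩ : IsOpen Ω)
    (F : DispersionlessHirota.SymMat 𝕜 → 𝕜) (hF : AnalyticOnNhd 𝕜 F Ω)
    (hγ : ∀ s ∈ DispersionlessHirota.hypersurface Ω F,
      DispersionlessHirota.HasRationalNormalCurve F s) :
    DispersionlessHirota.CorrespondToReductions 2 Ω F
        (DispersionlessHirota.IsBisecantSurface Ω F) ∧
    DispersionlessHirota.CorrespondToReductions 3 Ω F
        (DispersionlessHirota.IsHolonomicTrisecant Ω F) ∧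
    DispersionlessHirota.ParametrizedByFunctions 2 Ω F
        (DispersionlessHirota.IsBisecantSurface Ω F) ∧
    (DispersionlessHirota.IsIntegrable Ω F ↔
      DispersionlessHirota.ParametrizedByFunctions 3 Ω F
        (DispersionlessHirota.IsHolonomicTrisecant Ω F)) := by
  have hγ' : ∀ s ∈ DispersionlessHirota.hypersurface Ω F,
      DispersionlessHirota.IsNonsingularConic F s := fun s hs => (hγ s hs).1
  rw [DispersionlessHirota.isBisecantSurface_eq, DispersionlessHirota.isHolonomicTrisecant_eq]
  exact ⟨DispersionlessHirota.correspondToReductions (Or.inl rfl) hF hγ',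
    DispersionlessHirota.correspondToReductions (Or.inr rfl) hF hγ',
    DispersionlessHirota.parametrizedByFunctions (Or.inl rfl) hΩ hF hγ'
      DispersionlessHirota.isInvolutive_two,
    fun h => DispersionlessHirota.parametrizedByFunctions (Or.inr rfl) hΩ hF hγ'
      (h.isInvolutive hF hγ'),
    fun h n => (h.isInvolutive hF hγ').hasReductions hΩ hF hγ' n⟩
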